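/- Let $p>1$, $L>0$, and let $c:[0,L]\to\mathbb S^2\subset\mathbb R^3$ be a rectifiable curve parametrized by arc length, regarded as an open curve (no closing condition is imposed, and no corner is counted at the end points). Write $d$ for the geodesic distance of $\mathbb S^2$. *Inscribed polygonals.* A polygonal $P$ inscribed in $c$ is given by a partition $0=t_0<\dots<t_n=L$ such that consecutive points $c(t_i),c(t_{i+1})$ are neither equal nor antipodal; its edges are the minimizing geodesic arcs from $c(t_i)$ to $c(t_{i+1})$, with lengths $\bar\ell_i=d(c(t_i),c(t_{i+1}))$, $0\le i<n$. Its modulus $\mu_c(P)$ is the maximum over $i$ of the geodesic diameter of the arc $c([t_i,t_{i+1}])$. For $1\le i\le n-1$ let $\theta_i\in[0,\pi]$ be the turning angle of $P$ at $c(t_i)$ and $\ell_i=\min\{\bar\ell_{i-1},\bar\ell_i\}$. *$p$-rotation.* If all $\theta_i<\pi$, let $\gamma(P)$ be the $C^1$ curve obtained from $P$ by replacing, at each corner $c(t_i)$ with $1\le i\le n-1$, the two pieces of length $\ell_i/2$ of the edges that meet there by the arc of constant geodesic curvature that joins their outer end points and is tangent to both edges there, and put $$\mathbf k_p(P)=\int_{\gamma(P)}|k_{\mathbb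 S^2}(\gamma(P))|^p\,ds ,$$ where $k_{\mathbb S^2}$ is the geodesic curvature. If some $\theta_i=\pi$, put $\mathbf k_p(P)=+\infty$. *Relaxed $p$-curvature.* $$\mathcal F_p(c)=\inf\Bigl\{\liminf_{h\to\infty}\mathbf k_p(P_h)\;:\;P_h\text{ inscribed in }c,\ \mu_c(P_h)\to0\Bigr\}\in[0,+\infty].$$ Let $W^{2,p}([0,L],\mathbb S^2)$ be the set of $u\in W^{2,p}((0,L),\mathbb R^3)$ with $\|u\|=1$ almost everywhere. **Theorem.** One has $$\mathcal F_p(c)<\infty\iff c\in W^{2,p}([0,L],\mathbb S^2),$$ and in this case $$\mathcal F_p(c)=\int_c|k_{\mathbb S^2}|^p\,ds=\int_0^L\|\ddot c^{\top}(s)\|^p\,ds ,$$ where $\dot c,\ddot c$ are the weak derivatives of $c$, $k_{\mathbb S^2}=\ddot c\cdot(c\times\dot c)$ is the geodesic curvature of $c$, and $\ddot c^{\top}=\ddot c-(\ddot c\cdot c)\,c$ is the projection of $\ddot c$ onto the tangent plane $T_{c(s)}\mathbb S^2$. -/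

import Mathlib

open MeasureTheory Filter Topology Set
open scoped ENNReal ContDiff

noncomputable section

namespace SphericalCurve

/-- Euclidean three-space; the unit sphere is the set of its vectors of norm one. -/
abbrev E3 : Type := EuclideanSpace ℝ (Fin 3)

/-- The vector product in three-space. -/
def cross (x y : E3) : E3 :=
  WithLp.toLp 2 (crossProduct (WithLp.ofLp x) (WithLp.ofLp y))

/-- The geodesic distance of the unit sphere: the angle between two unit vectors. -/
def sphDist (x y : E3) : ℝ := InnerProductGeometry.angle x y

/-- For a unit vector `x`, the orthogonal projection of `w` onto the plane tangent
to the sphere at `x`. -/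
def tangentPart (x w : E3) : E3 := w - inner ℝ x w • x

/-- Geodesic curvature of a spherical curve parametrized by arc length, at a point where the
position is `x`, the velocity is `v` and the acceleration is `w`: the component of `w` along the
unit conormal, which is the vector product of the unit normal `x` and the unit tangent `v`. -/
def geodCurvature (x v w : E3) : ℝ := inner ℝ w (cross x v)

/-- For unit vectors `x`, `y` that are neither equal nor antipodal, the unit tangent vector at `x`
of the minimizing geodesic from `x` to `y`. -/
def direction (x y : E3) : E3 := ‖tangentPart x y‖⁻¹ • tangentPart x y

/-- The unit speed geodesic of the sphere from the unit vector `x`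
with initial velocity the unit tangent vector `a`. -/
def geodesic (x a : E3) (s : ℝ) : E3 := Real.cos s • x + Real.sin s • a

/-- `∫ |k|^p ds` over the part with parameters in `[a, b]` of a smooth spherical curve `γ`
parametrized by arc length, `k` being its geodesic curvature. -/
def arcEnergy (p : ℝ) (γ : ℝ → E3) (a b : ℝ) : ℝ≥0∞ :=
  ∫⁻ s in Icc a b, ‖geodCurvature (γ s) (deriv γ s) (deriv (deriv γ) s)‖ₑ ^ p

/-! ### The bend at a corner

A corner has its vertex at `V`, the unit tangent vectors at `V` towards the previous and the next
vertex are `a` and `b`, and the turning angle is the angle between `-a` and `b`. The bend is the arc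
of the parallel (a curve of constant geodesic curvature) that touches both edges at distance `ℓ / 2`
from `V`. Below `m` (the bisector of `a` and `b`), `e` (the normalized `b - a`) and `V` are the
orthonormal frame of the corner. -/

/-- The turning angle. -/
def turn (a b : E3) : ℝ := InnerProductGeometry.angle (-a) b

/-- `√(sin²(ℓ/2) + sin²(θ/2) cos²(ℓ/2))`. -/
def bendPsi (ℓ θ : ℝ) : ℝ :=
  √(Real.sin (ℓ / 2) ^ 2 + Real.sin (θ / 2) ^ 2 * Real.cos (ℓ / 2) ^ 2)

/-- The sine of the spherical radius of the parallel, that is its Euclidean radius. -/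
def bendRadius (ℓ θ : ℝ) : ℝ := Real.cos (θ / 2) * Real.sin (ℓ / 2) / bendPsi ℓ θ

/-- The cosine of the spherical radius of the parallel. -/
def bendHeight (ℓ θ : ℝ) : ℝ := Real.sin (θ / 2) / bendPsi ℓ θ

/-- Half of the angle that the arc subtends at the axis of the parallel. -/
def bendHalfAngle (ℓ θ : ℝ) : ℝ :=
  Real.arctan (bendPsi ℓ θ / (Real.cos (θ / 2) * Real.cos (ℓ / 2)))

/-- Half of the length of the bend. -/
def bendHalfLength (ℓ θ : ℝ) : ℝ := bendHalfAngle ℓ θ * bendRadius ℓ θ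

/-- The bend, parametrized by arc length on
`[-bendHalfLength ℓ (turn a b), bendHalfLength ℓ (turn a b)]`, for a turning angle less than `π`.
It starts at `geodesic V a (ℓ / 2)` with velocity directed to `V`, and it ends at
`geodesic V b (ℓ / 2)` with velocity directed away from `V`. When `a = -b` the bisector is undefined,
but it then has coefficient zero, and the bend is the given geodesic. -/
def bend (V a b : E3) (ℓ : ℝ) (s : ℝ) : E3 :=
  let θ := turn a b
  let m := ‖a + b‖⁻¹ • (a + b)
  let e := ‖b - a‖⁻¹ • (b - a)
  let τ := Real.sin (θ / 2) * Real.cos (ℓ / 2) / bendPsi ℓ θ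
  let σ := Real.sin (ℓ / 2) / bendPsi ℓ θ
  let axis := σ • m + τ • V
  let f := σ • V - τ • m
  let φ := s / bendRadius ℓ θ
  bendRadius ℓ θ • (Real.cos φ • f + Real.sin φ • e) + bendHeight ℓ θ • axis

/-! ### Inscribed polygonals -/

/-- A geodesic polygonal inscribed in the curve `c` on `[0, L]`, given by a partition
`0 = t 0 < ⋯ < t n = L`. Its edges are the geodesic arcs that join `c (t i)` to `c (t (i + 1))`;
consecutive vertices are neither equal nor antipodal, so that each edge is a well-defined arc
of positive length. -/
structure InscribedPolygonal (L : ℝ) (c : ℝ → E3) where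
  /-- the number of edges -/
  n : ℕ
  /-- the points of the partition; values at indices above `n` are irrelevant -/
  t : ℕ → ℝ
  t_zero : t 0 = 0
  t_last : t n = L
  t_lt : ∀ i < n, t i < t (i + 1)
  edge_pos : ∀ i < n, 0 < sphDist (c (t i)) (c (t (i + 1)))
  edge_lt_pi : ∀ i < n, sphDist (c (t i)) (c (t (i + 1))) < Real.pi

namespace InscribedPolygonal

variable {L : ℝ} {c : ℝ → E3}

/-- The modulus: the largest geodesic diameter of the arcs of `c` determined by
consecutive vertices. -/
def modulus (P : InscribedPolygonal L c) : ℝ :=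
  sSup {r : ℝ | ∃ i < P.n, ∃ x ∈ Icc (P.t i) (P.t (i + 1)), ∃ y ∈ Icc (P.t i) (P.t (i + 1)),
    r = sphDist (c x) (c y)}

/-- The `i`-th vertex. -/
def vertex (P : InscribedPolygonal L c) (i : ℕ) : E3 := c (P.t i)

/-- Length of the `i`-th edge, which joins the vertices `i` and `i + 1`. -/
def edgeLength (P : InscribedPolygonal L c) (i : ℕ) : ℝ :=
  sphDist (P.vertex i) (P.vertex (i + 1))

/-- Unit tangent vector at the vertex `i` towards the vertex `i - 1` (for `1 ≤ i ≤ n`). -/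
def dirPrev (P : InscribedPolygonal L c) (i : ℕ) : E3 :=
  direction (P.vertex i) (P.vertex (i - 1))

/-- Unit tangent vector at the vertex `i` towards the vertex `i + 1` (for `i < n`). -/
def dirNext (P : InscribedPolygonal L c) (i : ℕ) : E3 :=
  direction (P.vertex i) (P.vertex (i + 1))

/-- Turning angle at the vertex `i` (for `1 ≤ i ≤ n - 1`). -/
def turnAngle (P : InscribedPolygonal L c) (i : ℕ) : ℝ := turn (P.dirPrev i) (P.dirNext i)

/-- The length of the shorter of the two edges that meet at the vertex `i`
(for `1 ≤ i ≤ n - 1`). -/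
def cornerLength (P : InscribedPolygonal L c) (i : ℕ) : ℝ :=
  min (P.edgeLength (i - 1)) (P.edgeLength i)

/-- The length that is cut off each edge at the vertex `i`:
half of `cornerLength`, and nothing at the two end points of the polygonal. -/
def trim (P : InscribedPolygonal L c) (i : ℕ) : ℝ :=
  if i = 0 ∨ i = P.n then 0 else P.cornerLength i / 2

open Classical in
/-- The `p`-rotation of `P`: the integral of `|k|^p` with respect to arc length along the curve of
class `C¹` that consists of the bends at the corners `1, …, n - 1` and of the trimmed edges
`0, …, n - 1`. If some turning angle is `π` then the bend there degenerates to a point of infinite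
curvature, and the `p`-rotation is infinite. -/
def pRotation (P : InscribedPolygonal L c) (p : ℝ) : ℝ≥0∞ :=
  if ∃ i ∈ Finset.Ico 1 P.n, P.turnAngle i = Real.pi then ⊤
  else
    ∑ i ∈ Finset.range P.n,
        arcEnergy p (geodesic (P.vertex i) (P.dirNext i))
          (P.trim i) (P.edgeLength i - P.trim (i + 1))
      + ∑ i ∈ Finset.Ico 1 P.n,
        arcEnergy p (bend (P.vertex i) (P.dirPrev i) (P.dirNext i) (P.cornerLength i))
          (-bendHalfLength (P.cornerLength i) (P.turnAngle i))
          (bendHalfLength (P.cornerLength i) (P.turnAngle i))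

end InscribedPolygonal

/-- The relaxed `p`-curvature functional: the infimum of `liminf k_p(P_h)` over all sequences of
polygonals `P_h` inscribed in `c` whose modulus tends to zero. -/
def pCurvature (p L : ℝ) (c : ℝ → E3) : ℝ≥0∞ :=
  ⨅ (P : ℕ → InscribedPolygonal L c)
    (_ : Tendsto (fun h ↦ (P h).modulus) atTop (𝓝 0)),
    liminf (fun h ↦ (P h).pRotation p) atTop

/-! ### Sobolev curves -/

/-- `v` is a weak derivative of `u` on the interval `(0, L)`; both are integrable there. -/
def IsWeakDeriv (L : ℝ) (u v : ℝ → E3) : Prop :=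
  IntegrableOn u (Ioo 0 L) ∧ IntegrableOn v (Ioo 0 L) ∧
    ∀ φ : ℝ → ℝ, ContDiff ℝ ∞ φ → HasCompactSupport φ → tsupport φ ⊆ Ioo 0 L →
      ∫ s in Ioo 0 L, deriv φ s • u s = -∫ s in Ioo 0 L, φ s • v s

/-- The class `W^{2,p}` of maps from `[0, L]` to the unit sphere. -/
def MemW2 (p L : ℝ) (u : ℝ → E3) : Prop :=
  (∀ᵐ s ∂volume.restrict (Ioo 0 L), ‖u s‖ = 1) ∧
    ∃ v w : ℝ → E3, IsWeakDeriv L u v ∧ IsWeakDeriv L v w ∧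
      MemLp u (ENNReal.ofReal p) (volume.restrict (Ioo 0 L)) ∧
      MemLp v (ENNReal.ofReal p) (volume.restrict (Ioo 0 L)) ∧
      MemLp w (ENNReal.ofReal p) (volume.restrict (Ioo 0 L))

end SphericalCurve

end

namespace SphericalCurve

/-! ### Vector algebra -/

/-! The bend at a corner with turning angle `θ` and cut length `ℓ` has constant curvature `tan (θ/2)
/ sin (ℓ/2)` and half length between `cos (θ/2) sin (ℓ/2)` and `tan (ℓ/2)`. Its energy is therefore
explicit (`arcEnergy_bend`), and for fine, nearly straight polygonals it is close to `‖jump‖^p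
ℓ^(1-p)`, where the jump of the unit tangent at the corner has norm `2 sin (θ/2)`. The trimmed edges
are geodesic and contribute nothing. Both inequalities compare this discrete energy with the
integral of `‖w + c‖^p`, where `w` is the second derivative. Since `⟪c, w⟫ = -1`, the vector `w + c`
is the tangential part of `w`, and it has length `|k|` because `w` is also orthogonal to the unit
velocity.

Lower bound. Along an edge of length `ℓ` the unit tangent changes by about `-ℓ` times the vertex, so
the sum of the jumps over a parameter interval is, up to a small error, the increment of `T + ∫ c`,
where `T` is the direction of the edge. Hölder's inequality bounds the `p`-variation of Riesz of
this function by the energy, and the bound survives passage to the limit (`rieszBound_limit`). By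
the criterion of Riesz, `T + ∫ c` is absolutely continuous and its derivative has `p`-energy at most
the bound. Moreover `T` is the derivative of `c`, so the derivative of `T + ∫ c` is `w + c`
(`exists_hasSecondDeriv_of_pCurvature_lt`).

Upper bound. For equidistant vertices with step `δ`, the energy at a corner is at most a constant
close to 1 times `δ^(1-2p) ‖τ‖^p`, where `τ` is the tangential part of the second difference of `c`
(`corner_energy_le`). The second difference is a double integral of `w`. Jensen's inequality, used
twice, and the disjointness of the translated windows bound the sum of all `‖τ‖^p` by `δ^(2p-1)`
times nearly the integral of `‖w + c‖^p` (`sum_rpow_second_difference_le`), and the powers of `δ`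
cancel.

Weak derivatives are reduced to classical ones by the lemma of du Bois-Reymond
(`exists_hasSecondDeriv_of_isWeakDeriv`). -/

theorem inner_eq_coords (x y : E3) : inner ℝ x y = x 0 * y 0 + x 1 * y 1 + x 2 * y 2 := by
  simp [PiLp.inner_apply, Fin.sum_univ_three, mul_comm]

theorem inner_cross_eq_coords (z x y : E3) :
    inner ℝ z (cross x y) = z 0 * (x 1 * y 2 - x 2 * y 1) + z 1 * (x 2 * y 0 - x 0 * y 2)
      + z 2 * (x 0 * y 1 - x 1 * y 0) := by
  rw [inner_eq_coords]
  simp [cross, cross_apply]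

/-- The Gram determinant of three vectors. -/
theorem sq_inner_cross (x y z : E3) :
    inner ℝ z (cross x y) ^ 2 = inner ℝ x x * inner ℝ y y * inner ℝ z z
      + 2 * inner ℝ x y * inner ℝ y z * inner ℝ z x - inner ℝ x x * inner ℝ y z ^ 2
      - inner ℝ y y * inner ℝ z x ^ 2 - inner ℝ z z * inner ℝ x y ^ 2 := by
  rw [inner_cross_eq_coords]
  simp only [inner_eq_coords]
  ring

theorem abs_inner_cross_of_orthonormal {x y z : E3} (hx : ‖x‖ = 1) (hy : ‖y‖ = 1) (hz : ‖z‖ = 1)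
    (hxy : inner ℝ x y = 0) (hyz : inner ℝ y z = 0) (hzx : inner ℝ z x = 0) :
    |inner ℝ z (cross x y)| = 1 := by
  have h := sq_inner_cross x y z
  simp only [real_inner_self_eq_norm_sq, hx, hy, hz, hxy, hyz, hzx] at h
  rw [← sq_eq_sq₀ (abs_nonneg _) zero_le_one, sq_abs, h]
  norm_num

/-! ### Energies of circular arcs -/

theorem hasDerivAt_circle (R : ℝ) (f e B : E3) (s : ℝ) :
    HasDerivAt (fun s ↦ R • (Real.cos (s / R) • f + Real.sin (s / R) • e) + B)
      ((R * R⁻¹) • (Real.cos (s / R) • e - Real.sin (s / R) • f)) s := by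
  have h0 : HasDerivAt (fun s : ℝ ↦ s / R) (R⁻¹) s := by
    simpa using (hasDerivAt_id s).div_const R
  have h1 := (h0.cos.smul_const f).add (h0.sin.smul_const e)
  refine ((h1.const_smul R).add_const B).congr_deriv ?_
  module

theorem deriv_circle {R : ℝ} (hR : R ≠ 0) (f e B : E3) :
    deriv (fun s ↦ R • (Real.cos (s / R) • f + Real.sin (s / R) • e) + B)
      = fun s ↦ Real.cos (s / R) • e - Real.sin (s / R) • f := by
  ext1 s
  rw [(hasDerivAt_circle R f e B s).deriv, mul_inv_cancel₀ hR, one_smul]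

theorem deriv_deriv_circle {R : ℝ} (hR : R ≠ 0) (f e B : E3) :
    deriv (deriv (fun s ↦ R • (Real.cos (s / R) • f + Real.sin (s / R) • e) + B))
      = fun s ↦ R⁻¹ • (-(Real.cos (s / R) • f) - Real.sin (s / R) • e) := by
  rw [deriv_circle hR]
  ext1 s
  have h0 : HasDerivAt (fun s : ℝ ↦ s / R) (R⁻¹) s := by
    simpa using (hasDerivAt_id s).div_const R
  refine (((h0.cos.smul_const e).sub (h0.sin.smul_const f)).congr_deriv ?_).deriv
  module

/-- The acceleration is radial, so only the component `h • A` of the position survives in the triple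
product. Rotating the pair `f`, `e` in its plane does not change the determinant, so no
orthonormality is needed. -/
theorem geodCurvature_circle {R h : ℝ} (hR : R ≠ 0) (f e A : E3) (s : ℝ) :
    geodCurvature (R • (Real.cos (s / R) • f + Real.sin (s / R) • e) + h • A)
      (Real.cos (s / R) • e - Real.sin (s / R) • f)
      (R⁻¹ • (-(Real.cos (s / R) • f) - Real.sin (s / R) • e))
    = h / R * inner ℝ e (cross A f) := by
  rw [geodCurvature, inner_cross_eq_coords, inner_cross_eq_coords]
  have h1 := Real.sin_sq_add_cos_sq (s / R)
  generalize Real.sin (s / R) = S at *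
  generalize Real.cos (s / R) = C at *
  simp only [PiLp.add_apply, PiLp.smul_apply, PiLp.sub_apply, PiLp.neg_apply, smul_eq_mul]
  field_simp
  linear_combination (h * (e 0 * (A 1 * f 2 - A 2 * f 1) + e 1 * (A 2 * f 0 - A 0 * f 2)
    + e 2 * (A 0 * f 1 - A 1 * f 0))) * h1

theorem arcEnergy_circle {p R h H : ℝ} (hp : 0 ≤ p) (hR : R ≠ 0) (f e A : E3) :
    arcEnergy p (fun s ↦ R • (Real.cos (s / R) • f + Real.sin (s / R) • e) + h • A) (-H) H
      = ENNReal.ofReal (|h / R * inner ℝ e (cross A f)| ^ p) * ENNReal.ofReal (2 * H) := by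
  rw [arcEnergy, deriv_deriv_circle hR, deriv_circle hR]
  simp only [geodCurvature_circle hR]
  rw [lintegral_const, Measure.restrict_apply_univ, Real.volume_Icc, sub_neg_eq_add, ← two_mul,
    ← ofReal_norm, Real.norm_eq_abs, ENNReal.ofReal_rpow_of_nonneg (abs_nonneg _) hp]

theorem arcEnergy_geodesic {p : ℝ} (hp : 0 < p) (x a : E3) (s t : ℝ) :
    arcEnergy p (geodesic x a) s t = 0 := by
  -- A great circle is the circle of radius one and height zero, and its curvature vanishes.
  have h : geodesic x a = fun s ↦ (1 : ℝ) • (Real.cos (s / 1) • x + Real.sin (s / 1) • a)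
      + (0 : ℝ) • (0 : E3) := by
    ext1 s
    simp [geodesic]
  rw [arcEnergy, h, deriv_deriv_circle one_ne_zero, deriv_circle one_ne_zero]
  simp only [geodCurvature_circle one_ne_zero]
  simp [hp]

/-! ### The energy of a bend -/

theorem bendPsi_sq (ℓ θ : ℝ) : bendPsi ℓ θ ^ 2 =
    Real.sin (ℓ / 2) ^ 2 + Real.sin (θ / 2) ^ 2 * Real.cos (ℓ / 2) ^ 2 :=
  Real.sq_sqrt (by positivity)

theorem bendPsi_pos {ℓ θ : ℝ} (h0 : 0 < ℓ) (h1 : ℓ < Real.pi) : 0 < bendPsi ℓ θ := by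
  have : 0 < Real.sin (ℓ / 2) := Real.sin_pos_of_pos_of_lt_pi (by linarith) (by linarith)
  exact Real.sqrt_pos.2 (by positivity)

theorem bendPsi_sq_add (ℓ θ : ℝ) :
    bendPsi ℓ θ ^ 2 + (Real.cos (θ / 2) * Real.cos (ℓ / 2)) ^ 2 = 1 := by
  rw [bendPsi_sq]
  linear_combination Real.cos (ℓ / 2) ^ 2 * Real.sin_sq_add_cos_sq (θ / 2)
    + Real.sin_sq_add_cos_sq (ℓ / 2)

section Corner

variable {a b : E3}

theorem turn_nonneg (a b : E3) : 0 ≤ turn a b := InnerProductGeometry.angle_nonneg _ _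

theorem turn_le_pi (a b : E3) : turn a b ≤ Real.pi := InnerProductGeometry.angle_le_pi _ _

theorem cos_turn (ha : ‖a‖ = 1) (hb : ‖b‖ = 1) : Real.cos (turn a b) = -inner ℝ a b := by
  rw [turn, InnerProductGeometry.cos_angle, norm_neg, ha, hb, inner_neg_left]
  simp

theorem norm_add_eq_two_mul_sin (ha : ‖a‖ = 1) (hb : ‖b‖ = 1) :
    ‖a + b‖ = 2 * Real.sin (turn a b / 2) := by
  have h0 : 0 ≤ Real.sin (turn a b / 2) := Real.sin_nonneg_of_nonneg_of_le_pi
    (by linarith [turn_nonneg a b]) (by linarith [turn_le_pi a b, Real.pi_pos])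
  rw [← sq_eq_sq₀ (norm_nonneg _) (by positivity), norm_add_sq_real, ha, hb]
  have h1 := cos_turn ha hb
  have h2 := Real.cos_sq (turn a b / 2)
  have h3 := Real.sin_sq_add_cos_sq (turn a b / 2)
  rw [mul_div_cancel₀ _ (two_ne_zero' ℝ), h1] at h2
  linear_combination 4 * h2 - 4 * h3

/-- The curvature of a parallel is the cotangent of its spherical radius, here `bendHeight /
bendRadius`. The curvature is constant, so the energy is its `p`-th power times the length. -/
theorem arcEnergy_bend {V : E3} {p ℓ : ℝ} (hp : 0 < p) (hV : ‖V‖ = 1) (ha : ‖a‖ = 1) (hb : ‖b‖ = 1)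
    (hVa : inner ℝ V a = 0) (hVb : inner ℝ V b = 0) (hturn : turn a b ≠ Real.pi)
    (h0 : 0 < ℓ) (h1 : ℓ < Real.pi) :
    arcEnergy p (bend V a b ℓ) (-bendHalfLength ℓ (turn a b)) (bendHalfLength ℓ (turn a b))
      = ENNReal.ofReal (2 * bendHalfLength ℓ (turn a b)
          * (Real.tan (turn a b / 2) / Real.sin (ℓ / 2)) ^ p) := by
  have hθ : turn a b < Real.pi := lt_of_le_of_ne (turn_le_pi a b) hturn
  have hθ0 := turn_nonneg a b
  have hsin : 0 < Real.sin (ℓ / 2) := Real.sin_pos_of_pos_of_lt_pi (by linarith) (by linarith)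
  have hcosθ : 0 < Real.cos (turn a b / 2) :=
    Real.cos_pos_of_mem_Ioo ⟨by linarith [Real.pi_pos], by linarith⟩
  have hsinθ : 0 ≤ Real.sin (turn a b / 2) := Real.sin_nonneg_of_nonneg_of_le_pi
    (by linarith) (by linarith [Real.pi_pos])
  have hψ : 0 < bendPsi ℓ (turn a b) := bendPsi_pos h0 h1
  have hR : 0 < bendRadius ℓ (turn a b) := by unfold bendRadius; positivity
  have hj := norm_add_eq_two_mul_sin ha hb
  have hK : bendHeight ℓ (turn a b) / bendRadius ℓ (turn a b)
      = Real.tan (turn a b / 2) / Real.sin (ℓ / 2) := by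
    rw [bendHeight, bendRadius, Real.tan_eq_sin_div_cos]
    field_simp
  have hK0 : 0 ≤ Real.tan (turn a b / 2) / Real.sin (ℓ / 2) := by
    rw [Real.tan_eq_sin_div_cos]; positivity
  have key := arcEnergy_circle (p := p) (h := bendHeight ℓ (turn a b))
    (H := bendHalfLength ℓ (turn a b)) hp.le hR.ne'
    ((Real.sin (ℓ / 2) / bendPsi ℓ (turn a b)) • V
      - (Real.sin (turn a b / 2) * Real.cos (ℓ / 2) / bendPsi ℓ (turn a b)) •
        (‖a + b‖⁻¹ • (a + b)))
    (‖b - a‖⁻¹ • (b - a))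
    ((Real.sin (ℓ / 2) / bendPsi ℓ (turn a b)) • (‖a + b‖⁻¹ • (a + b))
      + (Real.sin (turn a b / 2) * Real.cos (ℓ / 2) / bendPsi ℓ (turn a b)) • V)
  refine Eq.trans (b := _) ?_ (key.trans ?_)
  · rfl
  rw [hK, abs_mul, abs_of_nonneg hK0, ← ENNReal.ofReal_mul (by positivity), mul_comm]
  congr 1
  -- For `θ = 0` the bisector is undefined and the frame is not orthonormal, but then the curvature
  -- is zero.
  rcases hsinθ.eq_or_lt with hz | hpos
  · rw [Real.tan_eq_sin_div_cos, ← hz]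
    simp [Real.zero_rpow hp.ne']
  · have hab : a + b ≠ 0 := by
      rw [← norm_pos_iff, hj]; positivity
    have hba : b - a ≠ 0 := by
      intro h
      have hba' : b = a := sub_eq_zero.1 h
      apply hturn
      rw [turn, hba']
      exact InnerProductGeometry.angle_neg_self_of_nonzero (by rw [← norm_pos_iff, ha]; norm_num)
    have hm : ‖‖a + b‖⁻¹ • (a + b)‖ = 1 := by
      rw [norm_smul, norm_inv, norm_norm, inv_mul_cancel₀ (norm_ne_zero_iff.2 hab)]
    have he : ‖‖b - a‖⁻¹ • (b - a)‖ = 1 := by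
      rw [norm_smul, norm_inv, norm_norm, inv_mul_cancel₀ (norm_ne_zero_iff.2 hba)]
    have hme : inner ℝ (‖b - a‖⁻¹ • (b - a)) (‖a + b‖⁻¹ • (a + b)) = 0 := by
      rw [real_inner_smul_left, real_inner_smul_right, inner_sub_left, inner_add_right,
        inner_add_right, real_inner_self_eq_norm_sq, real_inner_self_eq_norm_sq, ha, hb,
        real_inner_comm]
      ring
    have hmV : inner ℝ (‖a + b‖⁻¹ • (a + b)) V = 0 := by
      rw [real_inner_smul_left, inner_add_left, real_inner_comm, hVa, real_inner_comm, hVb]; simp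
    have hVe : inner ℝ V (‖b - a‖⁻¹ • (b - a)) = 0 := by
      rw [real_inner_smul_right, inner_sub_right, hVa, hVb]; simp
    have h1 := abs_inner_cross_of_orthonormal hm hV he hmV hVe hme
    generalize ‖b - a‖⁻¹ • (b - a) = e at *
    generalize ‖a + b‖⁻¹ • (a + b) = m at *
    have hστ : (Real.sin (ℓ / 2) / bendPsi ℓ (turn a b)) ^ 2
        + (Real.sin (turn a b / 2) * Real.cos (ℓ / 2) / bendPsi ℓ (turn a b)) ^ 2 = 1 := by
      have := bendPsi_sq ℓ (turn a b)
      field_simp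
      linear_combination -this
    generalize Real.sin (ℓ / 2) / bendPsi ℓ (turn a b) = σ at *
    generalize Real.sin (turn a b / 2) * Real.cos (ℓ / 2) / bendPsi ℓ (turn a b) = τ at *
    -- The pair (axis, `f`) arises from `(m, V)` by a rotation, whose determinant is `σ² + τ² = 1`.
    have h2 : inner ℝ e (cross (σ • m + τ • V) (σ • V - τ • m)) = inner ℝ e (cross m V) := by
      rw [inner_cross_eq_coords, inner_cross_eq_coords]
      simp only [PiLp.add_apply, PiLp.smul_apply, PiLp.sub_apply, smul_eq_mul]
      linear_combination (e 0 * (m 1 * V 2 - m 2 * V 1) + e 1 * (m 2 * V 0 - m 0 * V 2)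
        + e 2 * (m 0 * V 1 - m 1 * V 0)) * hστ
    rw [h2, h1, mul_one]

/-- This is `α ≤ tan α` for the half angle `α`: the radius times `tan α` equals `tan (ℓ/2)`. -/
theorem bendHalfLength_le {ℓ θ : ℝ} (h0 : 0 < ℓ) (h1 : ℓ < Real.pi) (hθ0 : 0 ≤ θ)
    (hθ : θ < Real.pi) : bendHalfLength ℓ θ ≤ Real.tan (ℓ / 2) := by
  have hsin : 0 < Real.sin (ℓ / 2) := Real.sin_pos_of_pos_of_lt_pi (by linarith) (by linarith)
  have hcos : 0 < Real.cos (ℓ / 2) :=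
    Real.cos_pos_of_mem_Ioo ⟨by linarith [Real.pi_pos], by linarith⟩
  have hcosθ : 0 < Real.cos (θ / 2) :=
    Real.cos_pos_of_mem_Ioo ⟨by linarith [Real.pi_pos], by linarith⟩
  have hψ : 0 < bendPsi ℓ θ := bendPsi_pos h0 h1
  have hR : 0 < bendRadius ℓ θ := by unfold bendRadius; positivity
  have hx : 0 ≤ bendPsi ℓ θ / (Real.cos (θ / 2) * Real.cos (ℓ / 2)) := by positivity
  have h : bendHalfAngle ℓ θ ≤ bendPsi ℓ θ / (Real.cos (θ / 2) * Real.cos (ℓ / 2)) :=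
    (Real.le_tan (Real.arctan_nonneg.2 hx) (Real.arctan_lt_pi_div_two _)).trans_eq
      (Real.tan_arctan _)
  calc bendHalfLength ℓ θ
      ≤ bendPsi ℓ θ / (Real.cos (θ / 2) * Real.cos (ℓ / 2)) * bendRadius ℓ θ :=
        mul_le_mul_of_nonneg_right h hR.le
    _ = Real.tan (ℓ / 2) := by
        rw [bendRadius, Real.tan_eq_sin_div_cos]
        field_simp

/-- This is `sin α ≤ α` for the half angle `α`, whose sine is `bendPsi`. The left side is half the
chord of the bend. -/
theorem le_bendHalfLength {ℓ θ : ℝ} (h0 : 0 < ℓ) (h1 : ℓ < Real.pi) (hθ0 : 0 ≤ θ)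
    (hθ : θ < Real.pi) : Real.cos (θ / 2) * Real.sin (ℓ / 2) ≤ bendHalfLength ℓ θ := by
  have hsin : 0 < Real.sin (ℓ / 2) := Real.sin_pos_of_pos_of_lt_pi (by linarith) (by linarith)
  have hcos : 0 < Real.cos (ℓ / 2) :=
    Real.cos_pos_of_mem_Ioo ⟨by linarith [Real.pi_pos], by linarith⟩
  have hcosθ : 0 < Real.cos (θ / 2) :=
    Real.cos_pos_of_mem_Ioo ⟨by linarith [Real.pi_pos], by linarith⟩
  have hψ : 0 < bendPsi ℓ θ := bendPsi_pos h0 h1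
  have hR : 0 < bendRadius ℓ θ := by unfold bendRadius; positivity
  have h : bendPsi ℓ θ ≤ bendHalfAngle ℓ θ := by
    have hs : Real.sin (bendHalfAngle ℓ θ) = bendPsi ℓ θ := by
      have hc : 0 < Real.cos (θ / 2) * Real.cos (ℓ / 2) := by positivity
      have h2 : 1 + (bendPsi ℓ θ / (Real.cos (θ / 2) * Real.cos (ℓ / 2))) ^ 2
          = ((Real.cos (θ / 2) * Real.cos (ℓ / 2))⁻¹) ^ 2 := by
        have := bendPsi_sq_add ℓ θ
        field_simp
        linear_combination this
      rw [bendHalfAngle, Real.sin_arctan, h2, Real.sqrt_sq (by positivity)]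
      field_simp
    rw [← hs]
    exact Real.sin_le (Real.arctan_nonneg.2 (by positivity))
  calc Real.cos (θ / 2) * Real.sin (ℓ / 2) = bendPsi ℓ θ * bendRadius ℓ θ := by
        rw [bendRadius]; field_simp
    _ ≤ bendHalfLength ℓ θ := mul_le_mul_of_nonneg_right h hR.le

/-- The left side is the discrete energy of a tangent jump of norm `2 sin (θ/2)` spread over the
length `ℓ`. -/
theorem rpow_le_bend_energy {ℓ θ p : ℝ} (hp : 1 < p) (h0 : 0 < ℓ) (h1 : ℓ < Real.pi)
    (hθ0 : 0 ≤ θ) (hθ : θ < Real.pi) :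
    (2 * Real.sin (θ / 2)) ^ p * ℓ ^ (1 - p)
      ≤ 2 * bendHalfLength ℓ θ * (Real.tan (θ / 2) / Real.sin (ℓ / 2)) ^ p := by
  have hsin : 0 < Real.sin (ℓ / 2) := Real.sin_pos_of_pos_of_lt_pi (by linarith) (by linarith)
  have hcosθ : 0 < Real.cos (θ / 2) :=
    Real.cos_pos_of_mem_Ioo ⟨by linarith [Real.pi_pos], by linarith⟩
  have hsinθ : 0 ≤ Real.sin (θ / 2) := Real.sin_nonneg_of_nonneg_of_le_pi
    (by linarith) (by linarith [Real.pi_pos])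
  have hK0 : 0 ≤ Real.tan (θ / 2) / Real.sin (ℓ / 2) := by
    rw [Real.tan_eq_sin_div_cos]; positivity
  have hsl : Real.sin (ℓ / 2) ≤ ℓ / 2 := Real.sin_le (by linarith)
  calc (2 * Real.sin (θ / 2)) ^ p * ℓ ^ (1 - p)
      = 2 * (Real.sin (θ / 2) ^ p * (ℓ / 2) ^ (1 - p)) := by
        rw [Real.mul_rpow zero_le_two hsinθ, Real.div_rpow h0.le zero_le_two,
          Real.rpow_sub zero_lt_two, Real.rpow_one]
        field_simp
    _ ≤ 2 * (Real.sin (θ / 2) ^ p * (Real.cos (θ / 2) * Real.sin (ℓ / 2)) ^ (1 - p)) := by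
        gcongr 2 * (_ * ?_)
        -- The exponent `1 - p` is negative, so replacing `ℓ/2` by the smaller `cos (θ/2) sin (ℓ/2)`
        -- increases the power.
        refine Real.rpow_le_rpow_of_nonpos (by positivity) ?_ (by linarith)
        exact (mul_le_of_le_one_left hsin.le (Real.cos_le_one _)).trans hsl
    _ = 2 * (Real.cos (θ / 2) * Real.sin (ℓ / 2))
          * (Real.tan (θ / 2) / Real.sin (ℓ / 2)) ^ p := by
        rw [Real.tan_eq_sin_div_cos, div_div, Real.div_rpow hsinθ (by positivity),
          Real.rpow_sub (by positivity), Real.rpow_one]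
        field_simp
    _ ≤ _ := by
        gcongr
        exact le_bendHalfLength h0 h1 hθ0 hθ

end Corner

/-! ### Edges and vertices -/

section Edge

variable {x y : E3}

theorem inner_eq_cos_sphDist (hx : ‖x‖ = 1) (hy : ‖y‖ = 1) :
    inner ℝ x y = Real.cos (sphDist x y) := by
  rw [sphDist, InnerProductGeometry.cos_angle, hx, hy]; simp

theorem sphDist_comm (x y : E3) : sphDist x y = sphDist y x := InnerProductGeometry.angle_comm x y

theorem inner_self_tangentPart (hx : ‖x‖ = 1) (w : E3) : inner ℝ x (tangentPart x w) = 0 := by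
  rw [tangentPart, inner_sub_right, real_inner_smul_right, real_inner_self_eq_norm_sq, hx]; simp

theorem norm_tangentPart_sq (hx : ‖x‖ = 1) (w : E3) :
    ‖tangentPart x w‖ ^ 2 = ‖w‖ ^ 2 - inner ℝ x w ^ 2 := by
  rw [tangentPart, norm_sub_sq_real, norm_smul, real_inner_smul_right, hx, real_inner_comm,
    Real.norm_eq_abs, mul_one, sq_abs]
  ring

theorem norm_tangentPart_le (hx : ‖x‖ = 1) (w : E3) : ‖tangentPart x w‖ ≤ ‖w‖ := by
  rw [← sq_le_sq₀ (norm_nonneg _) (norm_nonneg _), norm_tangentPart_sq hx]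
  linarith [sq_nonneg (inner ℝ x w)]

theorem norm_tangentPart_eq_sin (hx : ‖x‖ = 1) (hy : ‖y‖ = 1) :
    ‖tangentPart x y‖ = Real.sin (sphDist x y) := by
  have h0 : 0 ≤ Real.sin (sphDist x y) := InnerProductGeometry.sin_angle_nonneg x y
  rw [← sq_eq_sq₀ (norm_nonneg _) h0, norm_tangentPart_sq hx, inner_eq_cos_sphDist hx hy, hy,
    Real.sin_sq]
  ring

theorem inner_direction (hx : ‖x‖ = 1) (y : E3) : inner ℝ x (direction x y) = 0 := by
  rw [direction, real_inner_smul_right, inner_self_tangentPart hx, mul_zero]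

variable (hx : ‖x‖ = 1) (hy : ‖y‖ = 1) (h0 : 0 < sphDist x y) (h1 : sphDist x y < Real.pi)
include hx hy h0 h1

theorem norm_tangentPart_pos : 0 < ‖tangentPart x y‖ := by
  rw [norm_tangentPart_eq_sin hx hy]
  exact Real.sin_pos_of_pos_of_lt_pi h0 h1

theorem norm_direction : ‖direction x y‖ = 1 := by
  rw [direction, norm_smul, norm_inv, norm_norm,
    inv_mul_cancel₀ (norm_tangentPart_pos hx hy h0 h1).ne']

theorem eq_cos_add_sin_direction :
    y = Real.cos (sphDist x y) • x + Real.sin (sphDist x y) • direction x y := by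
  have h := norm_tangentPart_pos hx hy h0 h1
  rw [direction, ← norm_tangentPart_eq_sin hx hy, smul_smul, mul_inv_cancel₀ h.ne', one_smul,
    tangentPart, inner_eq_cos_sphDist hx hy]
  abel

theorem direction_symm :
    direction y x = Real.sin (sphDist x y) • x - Real.cos (sphDist x y) • direction x y := by
  have hs : Real.sin (sphDist x y) ≠ 0 := (Real.sin_pos_of_pos_of_lt_pi h0 h1).ne'
  have h := eq_cos_add_sin_direction hx hy h0 h1
  rw [direction, norm_tangentPart_eq_sin hy hx, tangentPart, inner_eq_cos_sphDist hy hx,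
    sphDist_comm y x]
  generalize direction x y = b at *
  generalize sphDist x y = l at *
  rw [inv_smul_eq_iff₀ hs, h]
  have := Real.sin_sq_add_cos_sq l
  match_scalars
  · linear_combination -this
  · ring

end Edge

/-! ### The `p`-rotation as a sum over the corners -/

namespace InscribedPolygonal

variable {L : ℝ} {c : ℝ → E3} (P : InscribedPolygonal L c)

theorem t_mono {i j : ℕ} (hij : i ≤ j) (hj : j ≤ P.n) : P.t i ≤ P.t j := by
  induction j, hij using Nat.le_induction with
  | base => exact le_rfl
  | succ k _ ih => exact (ih (by omega)).trans (P.t_lt k (by omega)).le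

theorem t_mem {i : ℕ} (hi : i ≤ P.n) : P.t i ∈ Icc 0 L :=
  ⟨P.t_zero ▸ P.t_mono (Nat.zero_le i) hi, (P.t_mono hi le_rfl).trans_eq P.t_last⟩

theorem edgeLength_pos {i : ℕ} (hi : i < P.n) : 0 < P.edgeLength i := P.edge_pos i hi

theorem edgeLength_lt_pi {i : ℕ} (hi : i < P.n) : P.edgeLength i < Real.pi := P.edge_lt_pi i hi

theorem cornerLength_pos {i : ℕ} (hi : i ∈ Finset.Ico 1 P.n) : 0 < P.cornerLength i := by
  rw [Finset.mem_Ico] at hi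
  exact lt_min (P.edgeLength_pos (by omega)) (P.edgeLength_pos hi.2)

theorem cornerLength_lt_pi {i : ℕ} (hi : i ∈ Finset.Ico 1 P.n) : P.cornerLength i < Real.pi :=
  (min_le_right _ _).trans_lt (P.edgeLength_lt_pi (Finset.mem_Ico.1 hi).2)

section Sphere

variable (hc : ∀ s ∈ Icc 0 L, ‖c s‖ = 1)
include hc

theorem norm_vertex {i : ℕ} (hi : i ≤ P.n) : ‖P.vertex i‖ = 1 := hc _ (P.t_mem hi)

theorem norm_dirNext {i : ℕ} (hi : i < P.n) : ‖P.dirNext i‖ = 1 :=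
  norm_direction (P.norm_vertex hc hi.le) (P.norm_vertex hc hi) (P.edge_pos i hi) (P.edge_lt_pi i hi)

theorem vertex_succ {i : ℕ} (hi : i < P.n) : P.vertex (i + 1) =
    Real.cos (P.edgeLength i) • P.vertex i + Real.sin (P.edgeLength i) • P.dirNext i :=
  eq_cos_add_sin_direction (P.norm_vertex hc hi.le) (P.norm_vertex hc hi) (P.edge_pos i hi)
    (P.edge_lt_pi i hi)

theorem dirPrev_succ {i : ℕ} (hi : i < P.n) : P.dirPrev (i + 1) =
    Real.sin (P.edgeLength i) • P.vertex i - Real.cos (P.edgeLength i) • P.dirNext i :=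
  direction_symm (P.norm_vertex hc hi.le) (P.norm_vertex hc hi) (P.edge_pos i hi)
    (P.edge_lt_pi i hi)

theorem norm_dirPrev {i : ℕ} (hi : i ∈ Finset.Ico 1 P.n) : ‖P.dirPrev i‖ = 1 := by
  obtain ⟨h1, hn⟩ := Finset.mem_Ico.1 hi
  obtain ⟨k, rfl⟩ : ∃ k, i = k + 1 := ⟨i - 1, by omega⟩
  refine norm_direction (P.norm_vertex hc hn.le) (P.norm_vertex hc (by omega)) ?_ ?_
  · rw [sphDist_comm]; exact P.edge_pos k (by omega)
  · rw [sphDist_comm]; exact P.edge_lt_pi k (by omega)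

theorem pRotation_eq {p : ℝ} (hp : 0 < p)
    (hP : ∀ i ∈ Finset.Ico 1 P.n, P.turnAngle i ≠ Real.pi) :
    P.pRotation p = ∑ i ∈ Finset.Ico 1 P.n,
      ENNReal.ofReal (2 * bendHalfLength (P.cornerLength i) (P.turnAngle i)
        * (Real.tan (P.turnAngle i / 2) / Real.sin (P.cornerLength i / 2)) ^ p) := by
  rw [pRotation, if_neg (by simpa using hP)]
  simp only [arcEnergy_geodesic hp, Finset.sum_const_zero, zero_add]
  refine Finset.sum_congr rfl fun i hi ↦ ?_
  have hn := (Finset.mem_Ico.1 hi).2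
  exact arcEnergy_bend hp (P.norm_vertex hc hn.le) (P.norm_dirPrev hc hi) (P.norm_dirNext hc hn)
    (inner_direction (P.norm_vertex hc hn.le) _) (inner_direction (P.norm_vertex hc hn.le) _)
    (hP i hi) (P.cornerLength_pos hi) (P.cornerLength_lt_pi hi)

/-- The polygonal enters a vertex with tangent `-dirPrev` and leaves it with tangent `dirNext`, so
the sum of the two directions is the jump of the tangent, of norm `2 sin (θ/2)`. -/
theorem sum_norm_rpow_le_pRotation {p : ℝ} (hp : 1 < p) :
    ENNReal.ofReal (∑ i ∈ Finset.Ico 1 P.n,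
      ‖P.dirPrev i + P.dirNext i‖ ^ p * P.cornerLength i ^ (1 - p)) ≤ P.pRotation p := by
  by_cases hP : ∃ i ∈ Finset.Ico 1 P.n, P.turnAngle i = Real.pi
  · rw [pRotation, if_pos hP]
    exact le_top
  · have hP' : ∀ i ∈ Finset.Ico 1 P.n, P.turnAngle i ≠ Real.pi := by simpa using hP
    rw [P.pRotation_eq hc (by linarith) hP', ENNReal.ofReal_sum_of_nonneg fun i hi ↦
      mul_nonneg (by positivity) (Real.rpow_nonneg (P.cornerLength_pos hi).le _)]
    refine Finset.sum_le_sum fun i hi ↦ ENNReal.ofReal_le_ofReal ?_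
    rw [norm_add_eq_two_mul_sin (P.norm_dirPrev hc hi) (P.norm_dirNext hc (Finset.mem_Ico.1 hi).2)]
    exact rpow_le_bend_energy hp (P.cornerLength_pos hi) (P.cornerLength_lt_pi hi) (turn_nonneg _ _)
      (lt_of_le_of_ne (turn_le_pi _ _) (hP' i hi))

end Sphere

end InscribedPolygonal

/-! ### A criterion of F. Riesz -/

/-- Hölder's inequality in the form of Radon. -/
theorem rpow_sum_le {ι : Type*} (s : Finset ι) {f l : ι → ℝ} {p : ℝ} (hp : 1 < p)
    (hf : ∀ i ∈ s, 0 ≤ f i) (hl : ∀ i ∈ s, 0 < l i) :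
    (∑ i ∈ s, f i) ^ p ≤ (∑ i ∈ s, f i ^ p * l i ^ (1 - p)) * (∑ i ∈ s, l i) ^ (p - 1) := by
  have hp0 : 0 < p := by linarith
  have hpq := Real.HolderConjugate.conjExponent hp
  set q := p.conjExponent with hq
  have hq' : 1 / q * p = p - 1 := by
    rw [hq, Real.conjExponent]
    have : p - 1 ≠ 0 := by linarith
    field_simp
  have h := Real.inner_le_Lp_mul_Lq_of_nonneg s (f := fun i ↦ f i * l i ^ (-(1 / q)))
    (g := fun i ↦ l i ^ (1 / q)) hpq
    (fun i hi ↦ mul_nonneg (hf i hi) (Real.rpow_nonneg (hl i hi).le _))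
    (fun i hi ↦ Real.rpow_nonneg (hl i hi).le _)
  have e1 : ∑ i ∈ s, f i * l i ^ (-(1 / q)) * l i ^ (1 / q) = ∑ i ∈ s, f i :=
    Finset.sum_congr rfl fun i hi ↦ by
      rw [mul_assoc, ← Real.rpow_add (hl i hi)]; simp
  have e2 : ∑ i ∈ s, (f i * l i ^ (-(1 / q))) ^ p = ∑ i ∈ s, f i ^ p * l i ^ (1 - p) :=
    Finset.sum_congr rfl fun i hi ↦ by
      rw [Real.mul_rpow (hf i hi) (Real.rpow_nonneg (hl i hi).le _), ← Real.rpow_mul (hl i hi).le,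
        neg_mul, hq', neg_sub]
  have e3 : ∑ i ∈ s, (l i ^ (1 / q)) ^ q = ∑ i ∈ s, l i :=
    Finset.sum_congr rfl fun i hi ↦ by
      rw [← Real.rpow_mul (hl i hi).le, one_div, inv_mul_cancel₀ hpq.symm.ne_zero, Real.rpow_one]
  rw [e1, e2, e3] at h
  have hA : 0 ≤ ∑ i ∈ s, f i ^ p * l i ^ (1 - p) := Finset.sum_nonneg fun i hi ↦
    mul_nonneg (Real.rpow_nonneg (hf i hi) _) (Real.rpow_nonneg (hl i hi).le _)
  have hB : 0 ≤ ∑ i ∈ s, l i := Finset.sum_nonneg fun i hi ↦ (hl i hi).le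
  calc (∑ i ∈ s, f i) ^ p
      ≤ ((∑ i ∈ s, f i ^ p * l i ^ (1 - p)) ^ (1 / p) * (∑ i ∈ s, l i) ^ (1 / q)) ^ p :=
        Real.rpow_le_rpow (Finset.sum_nonneg hf) h hp0.le
    _ = _ := by
        rw [Real.mul_rpow (Real.rpow_nonneg hA _) (Real.rpow_nonneg hB _), ← Real.rpow_mul hA,
          ← Real.rpow_mul hB, hq', one_div, inv_mul_cancel₀ hp0.ne', Real.rpow_one]

/-- The `p`-variation of Riesz of `G` on `[0, L]` is at most `M`. -/
def RieszBound (p L M : ℝ) (G : ℝ → E3) : Prop :=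
  ∀ (S : Finset ℕ) (a b : ℕ → ℝ), (∀ i ∈ S, 0 ≤ a i ∧ a i < b i ∧ b i ≤ L) →
    (S : Set ℕ).PairwiseDisjoint (fun i ↦ Ioc (a i) (b i)) →
    ∑ i ∈ S, ‖G (b i) - G (a i)‖ ^ p * (b i - a i) ^ (1 - p) ≤ M

/-- Radon's form of Hölder's inequality gives `(∑ ‖ΔG‖)^p ≤ M (∑ Δt)^(p-1)`, and `p - 1 > 0`. -/
theorem RieszBound.absolutelyContinuousOnInterval {p L M : ℝ} {G : ℝ → E3} (hp : 1 < p)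
    (hL : 0 < L) (h : RieszBound p L M G) : AbsolutelyContinuousOnInterval G 0 L := by
  have hM : 0 ≤ M := by simpa using h ∅ 0 0 (by simp) (by simp)
  rw [absolutelyContinuousOnInterval_iff]
  intro ε hε
  -- This solves `(M + 1) δ^(p-1) = ε^p`. The summand 1 covers `M = 0`.
  refine ⟨(ε ^ p / (M + 1)) ^ (p - 1)⁻¹, by positivity, ?_⟩
  rintro ⟨n, I⟩ ⟨hI, hd⟩ hlt
  simp only at hI hd hlt ⊢
  -- Absolute continuity admits degenerate and reversed intervals. The former are discarded, the
  -- latter are reordered by `min` and `max`.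
  set S := (Finset.range n).filter fun i ↦ (I i).1 ≠ (I i).2 with hS
  have hSd : ∀ f : ℝ → E3, ∑ i ∈ Finset.range n, dist (f (I i).1) (f (I i).2)
      = ∑ i ∈ S, ‖f (max (I i).1 (I i).2) - f (min (I i).1 (I i).2)‖ := by
    intro f
    rw [hS, Finset.sum_filter]
    refine Finset.sum_congr rfl fun i _ ↦ ?_
    split_ifs with hne
    · rcases le_total (I i).1 (I i).2 with hle | hle
      · rw [max_eq_right hle, min_eq_left hle, dist_comm, dist_eq_norm]
      · rw [max_eq_left hle, min_eq_right hle, dist_eq_norm]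
    · rw [not_not.1 hne, dist_self]
  have hpos : ∀ i ∈ S, 0 < max (I i).1 (I i).2 - min (I i).1 (I i).2 := by
    intro i hi
    rw [sub_pos, min_lt_max]
    exact (Finset.mem_filter.1 hi).2
  have hlen : ∑ i ∈ Finset.range n, dist (I i).1 (I i).2
      = ∑ i ∈ S, (max (I i).1 (I i).2 - min (I i).1 (I i).2) := by
    rw [hS, Finset.sum_filter]
    refine Finset.sum_congr rfl fun i _ ↦ ?_
    rw [Real.dist_eq, max_sub_min_eq_abs']
    split_ifs with hne
    · rfl
    · rw [not_not.1 hne, sub_self, abs_zero]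
  have hR := h S (fun i ↦ min (I i).1 (I i).2) (fun i ↦ max (I i).1 (I i).2) (by
      intro i hi
      have h1 := hI i (Finset.mem_filter.1 hi).1
      rw [uIcc_of_le hL.le] at h1
      exact ⟨le_min h1.1.1 h1.2.1, by simpa using hpos i hi, max_le h1.1.2 h1.2.2⟩) (by
      refine (hd.subset ?_)
      intro i hi
      exact (Finset.mem_filter.1 hi).1)
  have hH := rpow_sum_le S (f := fun i ↦ ‖G (max (I i).1 (I i).2) - G (min (I i).1 (I i).2)‖) hp
    (fun i _ ↦ norm_nonneg _) hpos
  rw [hlen] at hlt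
  rw [hSd]
  set D := ∑ i ∈ S, (max (I i).1 (I i).2 - min (I i).1 (I i).2)
  have hD : 0 ≤ D := Finset.sum_nonneg fun i hi ↦ (hpos i hi).le
  have h1 : D ^ (p - 1) < ε ^ p / (M + 1) := by
    have := Real.rpow_lt_rpow hD hlt (by linarith : 0 < p - 1)
    rwa [← Real.rpow_mul (by positivity), inv_mul_cancel₀ (by linarith), Real.rpow_one] at this
  rw [← Real.rpow_lt_rpow_iff (Finset.sum_nonneg fun _ _ ↦ norm_nonneg _) hε.le
    (by linarith : 0 < p)]
  calc _ ≤ _ := hH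
    _ ≤ (M + 1) * D ^ (p - 1) := by
      have := Real.rpow_nonneg hD (p - 1)
      gcongr
      linarith
    _ < (M + 1) * (ε ^ p / (M + 1)) := by gcongr
    _ = ε ^ p := by field_simp

theorem absolutelyContinuousOnInterval_coord {G : ℝ → E3} {a b : ℝ}
    (hG : AbsolutelyContinuousOnInterval G a b) (k : Fin 3) :
    AbsolutelyContinuousOnInterval (fun s ↦ G s k) a b := by
  rw [absolutelyContinuousOnInterval_iff] at hG ⊢
  intro ε hε
  obtain ⟨δ, hδ, h⟩ := hG ε hε
  refine ⟨δ, hδ, fun E hE hlt ↦ (Finset.sum_le_sum fun i _ ↦ ?_).trans_lt (h E hE hlt)⟩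
  rw [dist_eq_norm, dist_eq_norm]
  exact PiLp.norm_apply_le (G (E.2 i).1 - G (E.2 i).2) k

theorem intervalIntegrable_coord {g : ℝ → E3} {a b : ℝ} (hg : IntervalIntegrable g volume a b)
    (k : Fin 3) : IntervalIntegrable (fun s ↦ g s k) volume a b :=
  ⟨hg.1.eval_piLp k, hg.2.eval_piLp k⟩

theorem intervalIntegral_coord {g : ℝ → E3} {a b : ℝ} (hg : IntervalIntegrable g volume a b)
    (k : Fin 3) : (∫ s in a..b, g s) k = ∫ s in a..b, g s k := by
  rw [intervalIntegral, PiLp.sub_apply, eval_integral_piLp fun k ↦ hg.1.eval_piLp k,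
    eval_integral_piLp fun k ↦ hg.2.eval_piLp k, intervalIntegral]

/-- The fundamental theorem of calculus for absolutely continuous curves in three-space. -/
theorem exists_eq_add_integral {G : ℝ → E3} {L : ℝ} (hL : 0 < L)
    (hG : AbsolutelyContinuousOnInterval G 0 L) :
    ∃ g : ℝ → E3, IntervalIntegrable g volume 0 L ∧
      ∀ t ∈ Icc 0 L, G t = G 0 + ∫ s in (0 : ℝ)..t, g s := by
  have hk := absolutelyContinuousOnInterval_coord hG
  have hint : IntervalIntegrable (fun s ↦ (WithLp.toLp 2 fun k ↦ deriv (fun s ↦ G s k) s : E3))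
      volume 0 L :=
    ⟨Integrable.of_eval_piLp fun k ↦ (hk k).intervalIntegrable_deriv.1,
      Integrable.of_eval_piLp fun k ↦ (hk k).intervalIntegrable_deriv.2⟩
  refine ⟨_, hint, fun t ht ↦ ?_⟩
  have hsub : uIcc 0 t ⊆ uIcc 0 L := by
    rw [uIcc_of_le ht.1, uIcc_of_le hL.le]; exact Icc_subset_Icc_right ht.2
  ext k
  rw [PiLp.add_apply, intervalIntegral_coord (hint.mono_set hsub)]
  have := ((hk k).mono hsub).integral_deriv_eq_sub
  simp only
  rw [this]
  ring

theorem ae_hasDerivAt_of_eq_add_integral {G g : ℝ → E3} {L : ℝ} (hL : 0 < L)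
    (hg : IntervalIntegrable g volume 0 L)
    (hG : ∀ t ∈ Icc 0 L, G t = G 0 + ∫ s in (0 : ℝ)..t, g s) :
    ∀ᵐ t, t ∈ Ioo 0 L → HasDerivAt G (g t) t := by
  filter_upwards [hg.ae_hasDerivAt_integral] with t ht htL
  have h := (ht (by rw [uIcc_of_le hL.le]; exact Ioo_subset_Icc_self htL) 0 (by simp)).const_add
    (G 0)
  refine h.congr_of_eventuallyEq ?_
  filter_upwards [isOpen_Ioo.mem_nhds htL] with s hs using hG s (Ioo_subset_Icc_self hs)

/-- The straddle lemma. -/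
theorem HasDerivAt.straddle {G : ℝ → E3} {g : E3} {t : ℝ} (h : HasDerivAt G g t) {ε : ℝ}
    (hε : 0 < ε) : ∃ δ > 0, ∀ a b, a ≤ t → t ≤ b → t - δ < a → b < t + δ →
      ‖G b - G a - (b - a) • g‖ ≤ ε * (b - a) := by
  have h1 := (hasDerivAt_iff_isLittleO.1 h).def hε
  obtain ⟨δ, hδ, h2⟩ := Metric.eventually_nhds_iff.1 h1
  refine ⟨δ, hδ, fun a b ha hb hat hbt ↦ ?_⟩
  have ha' := h2 (y := a) (by rw [Real.dist_eq, abs_lt]; constructor <;> linarith)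
  have hb' := h2 (y := b) (by rw [Real.dist_eq, abs_lt]; constructor <;> linarith)
  rw [Real.norm_eq_abs, abs_of_nonpos (by linarith)] at ha'
  rw [Real.norm_eq_abs, abs_of_nonneg (by linarith)] at hb'
  calc ‖G b - G a - (b - a) • g‖
      = ‖(G b - G t - (b - t) • g) - (G a - G t - (a - t) • g)‖ := by congr 1; module
    _ ≤ _ := norm_sub_le _ _
    _ ≤ ε * (b - a) := by linarith

/-- On the partition into `N + 1` equal pieces, the step function `f N` takes the `p`-th power of
the norm of the difference quotient. Its integral is a Riesz sum, hence at most `M`. It converges to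
`‖g‖^p` almost everywhere, and Fatou's lemma concludes. -/
theorem RieszBound.lintegral_le {p L M : ℝ} {G g : ℝ → E3} (hp : 1 < p)
    (hL : 0 < L) (h : RieszBound p L M G) (hg : ∀ᵐ t, t ∈ Ioo 0 L → HasDerivAt G (g t) t) :
    ∫⁻ s in Ioo 0 L, ‖g s‖ₑ ^ p ≤ ENNReal.ofReal M := by
  have hp0 : 0 < p := by linarith
  set d : ℕ → ℝ := fun N ↦ L / (N + 1 : ℕ) with hd
  have hdpos : ∀ N, 0 < d N := fun N ↦ by positivity
  set e : ℕ → ℕ → ℝ := fun N j ↦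
    ‖G ((j + 1 : ℕ) * d N) - G (j * d N)‖ ^ p * ((j + 1 : ℕ) * d N - j * d N) ^ (1 - p) with he
  set f : ℕ → ℝ → ℝ≥0∞ := fun N t ↦ ∑ j ∈ Finset.range (N + 1),
    (Ioc (j * d N) ((j + 1 : ℕ) * d N)).indicator
      (fun _ ↦ ENNReal.ofReal (e N j * (d N)⁻¹)) t with hf
  have hfm : ∀ N, Measurable (f N) := fun N ↦
    Finset.measurable_fun_sum _ fun j _ ↦ measurable_const.indicator measurableSet_Ioc
  have he0 : ∀ N j, 0 ≤ e N j := fun N j ↦ by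
    have := hdpos N
    refine mul_nonneg (by positivity) (Real.rpow_nonneg ?_ _)
    push_cast; linarith
  have hint : ∀ N, ∫⁻ t in Ioo 0 L, f N t ≤ ENNReal.ofReal M := by
    intro N
    refine (setLIntegral_le_lintegral _ _).trans ?_
    rw [lintegral_finsetSum _ fun j _ ↦ measurable_const.indicator measurableSet_Ioc]
    have h1 : ∀ j ∈ Finset.range (N + 1), ∫⁻ t, (Ioc (j * d N) ((j + 1 : ℕ) * d N)).indicator
        (fun _ ↦ ENNReal.ofReal (e N j * (d N)⁻¹)) t = ENNReal.ofReal (e N j) := by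
      intro j _
      rw [lintegral_indicator measurableSet_Ioc, lintegral_const, Measure.restrict_apply_univ,
        Real.volume_Ioc, ← ENNReal.ofReal_mul (mul_nonneg (he0 N j) (inv_nonneg.2 (hdpos N).le))]
      congr 1
      have := (hdpos N).ne'
      push_cast
      field_simp
      ring
    rw [Finset.sum_congr rfl h1, ← ENNReal.ofReal_sum_of_nonneg fun j _ ↦ he0 N j]
    refine ENNReal.ofReal_le_ofReal (h _ _ _ ?_ ?_)
    · intro j hj
      have := hdpos N
      refine ⟨by positivity, by push_cast; linarith, ?_⟩
      have hj' : ((j + 1 : ℕ) : ℝ) ≤ (N + 1 : ℕ) := by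
        exact_mod_cast Finset.mem_range.1 hj
      calc ((j + 1 : ℕ) : ℝ) * d N ≤ (N + 1 : ℕ) * d N := by gcongr
        _ = L := by rw [hd]; field_simp
    · have hm : Monotone fun j : ℕ ↦ (j : ℝ) * d N := fun i j hij ↦ by
        have := hdpos N
        simp only; gcongr
      exact (hm.pairwise_disjoint_on_Ioc_succ).set_pairwise _
  have hlim : ∀ᵐ t ∂volume.restrict (Ioo 0 L), ‖g t‖ₑ ^ p ≤ liminf (fun N ↦ f N t) atTop := by
    rw [ae_restrict_iff' measurableSet_Ioo]
    filter_upwards [hg] with t ht htL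
    have ht := ht htL
    -- the partition interval that contains `t`
    set j : ℕ → ℕ := fun N ↦ ⌈t / d N⌉₊ - 1 with hj
    have hj1 : ∀ N, (j N : ℝ) * d N < t ∧ t ≤ (j N + 1 : ℕ) * d N ∧ j N < N + 1 := by
      intro N
      have hdN := hdpos N
      have hc : 0 < ⌈t / d N⌉₊ := Nat.ceil_pos.2 (div_pos htL.1 hdN)
      have hc' : j N + 1 = ⌈t / d N⌉₊ := by rw [hj]; simp only; omega
      have h1 : (j N : ℝ) < t / d N := Nat.lt_ceil.1 (by omega)
      have h2 : t / d N ≤ (j N + 1 : ℕ) := by rw [hc']; exact Nat.le_ceil _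
      refine ⟨by rwa [lt_div_iff₀ hdN] at h1, by rwa [div_le_iff₀ hdN] at h2, ?_⟩
      have h3 : (j N : ℝ) < (N + 1 : ℕ) := by
        refine h1.trans_le ?_
        rw [div_le_iff₀ hdN, hd]
        simp only
        rw [mul_div_cancel₀ _ (by positivity)]
        exact htL.2.le
      exact_mod_cast h3
    have hslope : Tendsto (fun N ↦ ‖(d N)⁻¹ • (G ((j N + 1 : ℕ) * d N) - G (j N * d N))‖ₑ ^ p) atTop
        (𝓝 (‖g t‖ₑ ^ p)) := by
      refine (ENNReal.continuous_rpow_const.tendsto _).comp ((continuous_enorm.tendsto _).comp ?_)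
      rw [Metric.tendsto_nhds]
      intro ε hε
      obtain ⟨δ, hδ, hst⟩ := HasDerivAt.straddle ht (half_pos hε)
      have hd0 : Tendsto d atTop (𝓝 0) :=
        (tendsto_const_nhds.div_atTop tendsto_natCast_atTop_atTop).comp (tendsto_add_atTop_nat 1)
      filter_upwards [hd0.eventually (gt_mem_nhds hδ)] with N hN
      obtain ⟨h1, h2, _⟩ := hj1 N
      have hw : ((j N + 1 : ℕ) : ℝ) * d N - j N * d N = d N := by push_cast; ring
      have h3 := hst _ _ h1.le h2 (by linarith) (by linarith)
      rw [hw] at h3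
      have hdN := hdpos N
      rw [dist_eq_norm]
      calc ‖(d N)⁻¹ • (G ((j N + 1 : ℕ) * d N) - G (j N * d N)) - g t‖
          = ‖(d N)⁻¹ • (G ((j N + 1 : ℕ) * d N) - G (j N * d N) - d N • g t)‖ := by
            rw [smul_sub _ (_ - _), smul_smul, inv_mul_cancel₀ hdN.ne', one_smul]
        _ ≤ (d N)⁻¹ * (ε / 2 * d N) := by
            rw [norm_smul, norm_inv, Real.norm_of_nonneg hdN.le]
            gcongr
        _ = ε / 2 := by field_simp
        _ < ε := half_lt_self hε
    rw [← hslope.liminf_eq]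
    refine liminf_le_liminf (Eventually.of_forall fun N ↦ ?_)
    obtain ⟨h1, h2, h3⟩ := hj1 N
    have hdN := hdpos N
    -- The summand of the piece that contains `t` already equals the power of the difference
    -- quotient.
    refine le_trans ?_ (Finset.single_le_sum (f := fun i : ℕ ↦
      (Ioc (i * d N) ((i + 1 : ℕ) * d N)).indicator
      (fun _ ↦ ENNReal.ofReal (e N i * (d N)⁻¹)) t) (fun _ _ ↦ zero_le)
      (Finset.mem_range.2 h3))
    rw [indicator_of_mem (mem_Ioc.2 ⟨h1, h2⟩), ← ofReal_norm, ENNReal.ofReal_rpow_of_nonneg (norm_nonneg _)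
      hp0.le]
    refine ENNReal.ofReal_le_ofReal (le_of_eq ?_)
    have hw : ((j N + 1 : ℕ) : ℝ) * d N - j N * d N = d N := by push_cast; ring
    rw [he]
    simp only
    rw [hw, norm_smul, Real.mul_rpow (norm_nonneg _) (norm_nonneg _), norm_inv,
      Real.norm_of_nonneg hdN.le, Real.inv_rpow hdN.le, Real.rpow_sub hdN, Real.rpow_one]
    field_simp
  calc ∫⁻ s in Ioo 0 L, ‖g s‖ₑ ^ p ≤ ∫⁻ s in Ioo 0 L, liminf (fun N ↦ f N s) atTop :=
        lintegral_mono_ae hlim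
    _ ≤ liminf (fun N ↦ ∫⁻ s in Ioo 0 L, f N s) atTop := lintegral_liminf_le hfm
    _ ≤ liminf (fun _ ↦ ENNReal.ofReal M) atTop := liminf_le_liminf (Eventually.of_forall hint)
    _ = ENNReal.ofReal M := liminf_const _

/-! ### Discrete estimates for fine polygonals -/

theorem norm_sub_sub_sum_Ico_le {E : Type*} [SeminormedAddCommGroup E] {f u : ℕ → E} {e : ℕ → ℝ}
    {m n : ℕ} (hmn : m ≤ n) (h : ∀ k ∈ Finset.Ico m n, ‖f (k + 1) - f k - u k‖ ≤ e k) :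
    ‖f n - f m - ∑ k ∈ Finset.Ico m n, u k‖ ≤ ∑ k ∈ Finset.Ico m n, e k := by
  have hf : ∑ k ∈ Finset.Ico m n, (f (k + 1) - f k) = f n - f m := Finset.sum_Ico_sub f hmn
  rw [← hf, ← Finset.sum_sub_distrib]
  exact norm_sum_le_of_le _ h

/-- The error of linearizing a geodesic of length `l` is quadratic. Summed over the edges it is at
most the mesh times the total length. -/
theorem self_sub_sin_add_one_sub_cos_le {l : ℝ} (h0 : 0 < l) (h1 : l ≤ 1) :
    |l - Real.sin l| + |Real.cos l - 1| ≤ l ^ 2 := by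
  have h2 := Real.one_sub_sq_div_two_le_cos (x := l)
  have h3 := Real.sin_gt_sub_cube h0
  have h4 := Real.sin_le h0.le
  have h5 := Real.cos_le_one l
  rw [abs_of_nonneg (by linarith), abs_of_nonpos (by linarith)]
  nlinarith [mul_nonneg (sq_nonneg l) (sub_nonneg.2 h1), sq_nonneg l]

namespace InscribedPolygonal

variable {L : ℝ} {c : ℝ → E3} (P : InscribedPolygonal L c)

/-- The partition is fine, and the polygonal is almost as long as the curve. -/
structure Fine (η : ℝ) : Prop where
  le_one : η ≤ 1
  mesh : ∀ i < P.n, P.t (i + 1) - P.t i ≤ η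
  edge : ∀ i < P.n, P.edgeLength i ≤ η
  length : ∑ i ∈ Finset.range P.n, |P.edgeLength i - (P.t (i + 1) - P.t i)| ≤ η

/-- The jump of the unit tangent vector at a vertex. -/
noncomputable def jump (i : ℕ) : E3 := P.dirPrev i + P.dirNext i

/-- An edge whose parameter interval contains `s`. -/
noncomputable def idx (s : ℝ) : ℕ := Nat.findGreatest (fun k ↦ P.t k ≤ s) (P.n - 1)

theorem n_pos (hL : 0 < L) : 0 < P.n := by
  rcases Nat.eq_zero_or_pos P.n with h | h
  · have h1 := P.t_last
    rw [h, P.t_zero] at h1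
    exact absurd h1 hL.ne
  · exact h

theorem idx_lt (hL : 0 < L) (s : ℝ) : P.idx s < P.n := by
  have h := Nat.findGreatest_le (P := fun k ↦ P.t k ≤ s) (P.n - 1)
  have h1 := P.n_pos hL
  unfold idx
  omega

theorem t_idx_le {s : ℝ} (hs : 0 ≤ s) : P.t (P.idx s) ≤ s :=
  Nat.findGreatest_spec (P := fun k ↦ P.t k ≤ s) (Nat.zero_le _) (by rw [P.t_zero]; exact hs)

theorem lt_t_of_idx_lt {s : ℝ} {k : ℕ} (hk : P.idx s < k) (hn : k < P.n) : s < P.t k :=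
  not_le.1 (Nat.findGreatest_is_greatest (P := fun k ↦ P.t k ≤ s) hk (by omega))

theorem le_t_idx_succ (hL : 0 < L) {s : ℝ} (hs : s ≤ L) : s ≤ P.t (P.idx s + 1) := by
  have h := P.idx_lt hL s
  rcases Nat.lt_or_ge (P.idx s + 1) P.n with h1 | h1
  · exact (P.lt_t_of_idx_lt (Nat.lt_succ_self _) h1).le
  · rw [show P.idx s + 1 = P.n by omega, P.t_last]
    exact hs

theorem idx_mono {s s' : ℝ} (h : s ≤ s') : P.idx s ≤ P.idx s' :=
  Nat.findGreatest_mono (fun _ hk ↦ le_trans hk h) le_rfl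

section Estimates

variable {P} {η : ℝ} (hL : 0 < L) (hc : ∀ s ∈ Icc 0 L, ‖c s‖ = 1) (hP : P.Fine η)
include hL hc hP

omit hc in
theorem Fine.pos : 0 < η := (P.edgeLength_pos (P.n_pos hL)).trans_le (hP.edge 0 (P.n_pos hL))

omit hc in
theorem Fine.sub_le_t_idx {s : ℝ} (hs : s ≤ L) : s - η ≤ P.t (P.idx s) := by
  have h1 := hP.mesh _ (P.idx_lt hL s)
  have h2 := P.le_t_idx_succ hL hs
  linarith

omit hL hc in
theorem Fine.abs_sum_edgeLength_sub_le {m k : ℕ} (hmk : m ≤ k) (hk : k ≤ P.n) :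
    |∑ i ∈ Finset.Ico m k, P.edgeLength i - (P.t k - P.t m)| ≤ η := by
  rw [← Finset.sum_Ico_sub P.t hmk, ← Finset.sum_sub_distrib]
  refine (Finset.abs_sum_le_sum_abs _ _).trans (le_trans ?_ hP.length)
  refine Finset.sum_le_sum_of_subset_of_nonneg ?_ fun _ _ _ ↦ abs_nonneg _
  intro i hi
  rw [Finset.mem_Ico] at hi
  exact Finset.mem_range.2 (by omega)

omit hL in
theorem Fine.norm_vertex_step {k : ℕ} (hk : k < P.n) :
    ‖P.vertex (k + 1) - P.vertex k - P.edgeLength k • P.dirNext k‖ ≤ P.edgeLength k ^ 2 := by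
  rw [P.vertex_succ hc hk]
  have h := self_sub_sin_add_one_sub_cos_le (P.edgeLength_pos hk) ((hP.edge k hk).trans hP.le_one)
  calc _ = ‖(Real.cos (P.edgeLength k) - 1) • P.vertex k
          - (P.edgeLength k - Real.sin (P.edgeLength k)) • P.dirNext k‖ := by congr 1; module
    _ ≤ _ := norm_sub_le _ _
    _ = |Real.cos (P.edgeLength k) - 1| + |P.edgeLength k - Real.sin (P.edgeLength k)| := by
        rw [norm_smul, norm_smul, P.norm_vertex hc hk.le, P.norm_dirNext hc hk, Real.norm_eq_abs,
          Real.norm_eq_abs, mul_one, mul_one]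
    _ ≤ _ := by linarith

omit hL in
-- The tangent of an edge has acceleration `-vertex` to leading order, since the edge lies on a unit
-- great circle. The corner at its end adds the jump.
theorem Fine.norm_dirNext_step {k : ℕ} (hk : k < P.n) :
    ‖P.dirNext (k + 1) - P.dirNext k - (P.jump (k + 1) - P.edgeLength k • P.vertex k)‖
      ≤ P.edgeLength k ^ 2 := by
  rw [jump, P.dirPrev_succ hc hk]
  have h := self_sub_sin_add_one_sub_cos_le (P.edgeLength_pos hk) ((hP.edge k hk).trans hP.le_one)
  calc _ = ‖(Real.cos (P.edgeLength k) - 1) • P.dirNext k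
          + (P.edgeLength k - Real.sin (P.edgeLength k)) • P.vertex k‖ := by congr 1; module
    _ ≤ _ := norm_add_le _ _
    _ = |Real.cos (P.edgeLength k) - 1| + |P.edgeLength k - Real.sin (P.edgeLength k)| := by
        rw [norm_smul, norm_smul, P.norm_vertex hc hk.le, P.norm_dirNext hc hk, Real.norm_eq_abs,
          Real.norm_eq_abs, mul_one, mul_one]
    _ ≤ _ := by linarith

omit hL hc in
theorem Fine.sum_sq_edgeLength_le {m k : ℕ} (hk : k ≤ P.n) :
    ∑ i ∈ Finset.Ico m k, P.edgeLength i ^ 2 ≤ (∑ i ∈ Finset.Ico m k, P.edgeLength i) * η := by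
  rw [Finset.sum_mul]
  refine Finset.sum_le_sum fun i hi ↦ ?_
  have hin : i < P.n := by rw [Finset.mem_Ico] at hi; omega
  rw [sq]
  exact mul_le_mul_of_nonneg_left (hP.edge i hin) (P.edgeLength_pos hin).le

omit hL in
theorem Fine.norm_dirNext_sub_le {m k : ℕ} (hmk : m ≤ k) (hk : k ≤ P.n) :
    ‖P.dirNext k - P.dirNext m
        - ∑ i ∈ Finset.Ico m k, (P.jump (i + 1) - P.edgeLength i • P.vertex i)‖
      ≤ (∑ i ∈ Finset.Ico m k, P.edgeLength i) * η :=
  (norm_sub_sub_sum_Ico_le hmk fun i hi ↦ hP.norm_dirNext_step hc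
    (by rw [Finset.mem_Ico] at hi; omega)).trans (hP.sum_sq_edgeLength_le hk)

omit hc in
theorem Fine.sum_edgeLength_idx_le {a b : ℝ} (ha : 0 ≤ a) (hab : a ≤ b) (hb : b ≤ L) :
    ∑ i ∈ Finset.Ico (P.idx a) (P.idx b), P.edgeLength i ≤ b - a + 2 * η := by
  have h1 := abs_le.1 (hP.abs_sum_edgeLength_sub_le (P.idx_mono hab) (P.idx_lt hL b).le)
  have h2 := P.t_idx_le (ha.trans hab)
  have h3 := hP.sub_le_t_idx hL (hab.trans hb)
  linarith [h1.2]

omit hc in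
theorem Fine.abs_sum_edgeLength_idx_sub_le {a b : ℝ} (ha : 0 ≤ a) (hab : a ≤ b) (hb : b ≤ L) :
    |∑ i ∈ Finset.Ico (P.idx a) (P.idx b), P.edgeLength i - (b - a)| ≤ 2 * η := by
  have h1 := abs_le.1 (hP.abs_sum_edgeLength_sub_le (P.idx_mono hab) (P.idx_lt hL b).le)
  have h2 := P.t_idx_le (ha.trans hab)
  have h3 := hP.sub_le_t_idx hL (hab.trans hb)
  have h4 := P.t_idx_le ha
  have h5 := hP.sub_le_t_idx hL hb
  rw [abs_le]
  constructor <;> linarith [h1.1, h1.2]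

omit hc in
-- Hölder's inequality with the corner lengths as weights. Their sum is at most the length of the
-- polygonal between the two indices.
theorem Fine.rpow_sum_norm_jump_le {p a b : ℝ} (hp : 1 < p) (ha : 0 ≤ a) (hab : a ≤ b)
    (hb : b ≤ L) :
    (∑ i ∈ Finset.Ico (P.idx a) (P.idx b), ‖P.jump (i + 1)‖) ^ p
      ≤ (∑ i ∈ Finset.Ico (P.idx a) (P.idx b),
          ‖P.jump (i + 1)‖ ^ p * P.cornerLength (i + 1) ^ (1 - p)) * (b - a + 2 * η) ^ (p - 1) := by
  have hmem : ∀ i ∈ Finset.Ico (P.idx a) (P.idx b), i + 1 ∈ Finset.Ico 1 P.n := by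
    intro i hi
    have := P.idx_lt hL b
    rw [Finset.mem_Ico] at hi ⊢
    omega
  have hpos : ∀ i ∈ Finset.Ico (P.idx a) (P.idx b), 0 < P.cornerLength (i + 1) :=
    fun i hi ↦ P.cornerLength_pos (hmem i hi)
  refine (rpow_sum_le _ (l := fun i ↦ P.cornerLength (i + 1)) hp (fun _ _ ↦ norm_nonneg _)
    hpos).trans ?_
  refine mul_le_mul_of_nonneg_left (Real.rpow_le_rpow (Finset.sum_nonneg fun i hi ↦ (hpos i hi).le)
    ?_ (by linarith)) (Finset.sum_nonneg fun i hi ↦ mul_nonneg (by positivity)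
      (Real.rpow_nonneg (hpos i hi).le _))
  refine le_trans (Finset.sum_le_sum fun i _ ↦ ?_) (hP.sum_edgeLength_idx_le hL ha hab hb)
  -- Each corner is charged to the edge that precedes it, so no edge is used twice.
  exact min_le_left _ _

omit hc in
-- This is the discrete form of the Riesz bound. The margin `2 * η` pays for the edges cut by the
-- ends of the intervals.
theorem Fine.sum_rpow_jump_le {p M : ℝ} (hp : 1 < p)
    (hM : ∑ i ∈ Finset.Ico 1 P.n, ‖P.jump i‖ ^ p * P.cornerLength i ^ (1 - p) ≤ M)
    (S : Finset ℕ) (a b : ℕ → ℝ) (hS : ∀ i ∈ S, 0 ≤ a i ∧ a i < b i ∧ b i ≤ L)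
    (hd : (S : Set ℕ).PairwiseDisjoint (fun i ↦ Ioc (a i) (b i))) :
    ∑ i ∈ S, ‖∑ k ∈ Finset.Ico (P.idx (a i)) (P.idx (b i)), P.jump (k + 1)‖ ^ p
      * (b i - a i + 2 * η) ^ (1 - p) ≤ M := by
  have hη := hP.pos hL
  have h1 : ∀ i ∈ S, ‖∑ k ∈ Finset.Ico (P.idx (a i)) (P.idx (b i)), P.jump (k + 1)‖ ^ p
      * (b i - a i + 2 * η) ^ (1 - p) ≤ ∑ k ∈ Finset.Ico (P.idx (a i)) (P.idx (b i)),
        ‖P.jump (k + 1)‖ ^ p * P.cornerLength (k + 1) ^ (1 - p) := by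
    intro i hi
    obtain ⟨h0, hab, hb⟩ := hS i hi
    have hpos : 0 < b i - a i + 2 * η := by linarith
    have hneg : (b i - a i + 2 * η) ^ (1 - p) = ((b i - a i + 2 * η) ^ (p - 1))⁻¹ := by
      rw [← Real.rpow_neg hpos.le, neg_sub]
    rw [hneg, ← div_eq_mul_inv, div_le_iff₀ (Real.rpow_pos_of_pos hpos _)]
    exact (Real.rpow_le_rpow (norm_nonneg _) (norm_sum_le _ _) (by linarith)).trans
      (hP.rpow_sum_norm_jump_le hL hp h0 hab.le hb)
  refine (Finset.sum_le_sum h1).trans (le_trans ?_ hM)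
  rw [← Finset.sum_biUnion]
  · rw [Finset.sum_Ico_eq_sum_range _ 1]
    simp only [add_comm 1]
    refine Finset.sum_le_sum_of_subset_of_nonneg ?_ fun k hk _ ↦ mul_nonneg (by positivity)
      (Real.rpow_nonneg (P.cornerLength_pos ?_).le _)
    · intro k hk
      obtain ⟨i, _, hk⟩ := Finset.mem_biUnion.1 hk
      have := P.idx_lt hL (b i)
      rw [Finset.mem_Ico] at hk
      exact Finset.mem_range.2 (by omega)
    · have := Finset.mem_range.1 hk
      exact Finset.mem_Ico.2 ⟨by omega, by omega⟩
  -- The corner `k + 1` has its parameter in `(a i, b i]`, so disjoint intervals collect disjoint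
  -- sets of corners.
  · have hmem : ∀ i ∈ S, ∀ k ∈ Finset.Ico (P.idx (a i)) (P.idx (b i)),
        P.t (k + 1) ∈ Ioc (a i) (b i) := by
      intro i hi k hk
      obtain ⟨h0, hab, hb⟩ := hS i hi
      rw [Finset.mem_Ico] at hk
      have := P.idx_lt hL (b i)
      exact ⟨P.lt_t_of_idx_lt (by omega) (by omega),
        (P.t_mono (by omega) this.le).trans (P.t_idx_le (h0.trans hab.le))⟩
    intro i hi j hj hij
    refine Finset.disjoint_left.2 fun k hki hkj ↦ ?_
    exact Set.disjoint_left.1 (hd hi hj hij) (hmem i hi k hki) (hmem j hj k hkj)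

variable (hlip : ∀ s ∈ Icc 0 L, ∀ t ∈ Icc 0 L, ‖c s - c t‖ ≤ |s - t|)
include hlip

omit hc in
theorem Fine.norm_sub_vertex_idx_le {s : ℝ} (hs : s ∈ Icc 0 L) :
    ‖c s - P.vertex (P.idx s)‖ ≤ η := by
  refine (hlip _ hs _ (P.t_mem (P.idx_lt hL s).le)).trans ?_
  rw [abs_of_nonneg (by linarith [P.t_idx_le hs.1])]
  linarith [hP.sub_le_t_idx hL hs.2]

/-- The increment of `c` is nearly the sum of the edges. On `[a, b]` their directions differ from
the initial one by the total jump, which Hölder's inequality bounds, and by the turning caused by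
the sphere, at most proportional to the length. In the limit this will identify the directions with
the derivative of `c`. In `4 * η`, half comes from moving the end points to vertices and half from
the difference between length and parameter. -/
theorem Fine.norm_sub_sub_dirNext_le {p M a b : ℝ} (hp : 1 < p)
    (hM : ∑ i ∈ Finset.Ico 1 P.n, ‖P.jump i‖ ^ p * P.cornerLength i ^ (1 - p) ≤ M)
    (ha : 0 ≤ a) (hab : a ≤ b) (hb : b ≤ L) :
    ‖c b - c a - (b - a) • P.dirNext (P.idx a)‖
      ≤ 4 * η + (b - a + 2 * η) * (η + ((M * (b - a + 2 * η) ^ (p - 1)) ^ p⁻¹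
          + 2 * (b - a + 2 * η))) := by
  have hη := hP.pos hL
  have hp0 : 0 < p := by linarith
  have hnb := P.idx_lt hL b
  set m := P.idx a with hm
  set n := P.idx b with hn
  set Λ := ∑ i ∈ Finset.Ico m n, P.edgeLength i with hΛ
  set J := (M * (b - a + 2 * η) ^ (p - 1)) ^ p⁻¹ with hJ
  have hmn : m ≤ n := P.idx_mono hab
  have hlen : ∀ i ∈ Finset.Ico m n, 0 < P.edgeLength i := fun i hi ↦
    P.edgeLength_pos (by rw [Finset.mem_Ico] at hi; omega)
  have hΛ0 : 0 ≤ Λ := Finset.sum_nonneg fun i hi ↦ (hlen i hi).le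
  have hΛ1 : Λ ≤ b - a + 2 * η := hP.sum_edgeLength_idx_le hL ha hab hb
  have hΛ2 : |Λ - (b - a)| ≤ 2 * η := hP.abs_sum_edgeLength_idx_sub_le hL ha hab hb
  have hterm : ∀ i ∈ Finset.Ico 1 P.n, 0 ≤ ‖P.jump i‖ ^ p * P.cornerLength i ^ (1 - p) :=
    fun i hi ↦ mul_nonneg (by positivity) (Real.rpow_nonneg (P.cornerLength_pos hi).le _)
  have hjump : ∑ i ∈ Finset.Ico m n, ‖P.jump (i + 1)‖ ≤ J := by
    have h1 := hP.rpow_sum_norm_jump_le hL hp ha hab hb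
    have h2 : ∑ i ∈ Finset.Ico m n, ‖P.jump (i + 1)‖ ^ p * P.cornerLength (i + 1) ^ (1 - p)
        ≤ M := by
      refine le_trans ?_ hM
      rw [Finset.sum_Ico_add' (fun i ↦ ‖P.jump i‖ ^ p * P.cornerLength i ^ (1 - p)) m n 1]
      refine Finset.sum_le_sum_of_subset_of_nonneg ?_ fun i hi _ ↦ hterm i hi
      intro i hi
      rw [Finset.mem_Ico] at hi ⊢
      omega
    have h3 : (∑ i ∈ Finset.Ico m n, ‖P.jump (i + 1)‖) ^ p ≤ M * (b - a + 2 * η) ^ (p - 1) :=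
      h1.trans (mul_le_mul_of_nonneg_right h2 (Real.rpow_nonneg (by linarith) _))
    exact (Real.le_rpow_inv_iff_of_pos (Finset.sum_nonneg fun _ _ ↦ norm_nonneg _)
      (le_trans (Real.rpow_nonneg (Finset.sum_nonneg fun _ _ ↦ norm_nonneg _) _) h3) hp0).2 h3
  have hdir : ∀ k ∈ Finset.Ico m n, ‖P.dirNext k - P.dirNext m‖ ≤ J + 2 * (b - a + 2 * η) := by
    intro k hk
    rw [Finset.mem_Ico] at hk
    have hsub : Finset.Ico m k ⊆ Finset.Ico m n := Finset.Ico_subset_Ico_right hk.2.le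
    have h1 := hP.norm_dirNext_sub_le hc hk.1 (by omega)
    have hΛk : ∑ i ∈ Finset.Ico m k, P.edgeLength i ≤ Λ :=
      Finset.sum_le_sum_of_subset_of_nonneg hsub fun i hi _ ↦ (hlen i hi).le
    have h2 : ‖∑ i ∈ Finset.Ico m k, (P.jump (i + 1) - P.edgeLength i • P.vertex i)‖ ≤ J + Λ := by
      refine (norm_sum_le _ _).trans ((Finset.sum_le_sum_of_subset_of_nonneg hsub fun _ _ _ ↦
        norm_nonneg _).trans ?_)
      calc ∑ i ∈ Finset.Ico m n, ‖P.jump (i + 1) - P.edgeLength i • P.vertex i‖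
          ≤ ∑ i ∈ Finset.Ico m n, (‖P.jump (i + 1)‖ + P.edgeLength i) := by
            refine Finset.sum_le_sum fun i hi ↦ (norm_sub_le _ _).trans ?_
            rw [norm_smul, P.norm_vertex hc (by rw [Finset.mem_Ico] at hi; omega),
              Real.norm_of_nonneg (hlen i hi).le, mul_one]
        _ ≤ J + Λ := by rw [Finset.sum_add_distrib]; gcongr
    have h3 := norm_le_norm_add_norm_sub' (P.dirNext k - P.dirNext m)
      (∑ i ∈ Finset.Ico m k, (P.jump (i + 1) - P.edgeLength i • P.vertex i))
    have h4 : (∑ i ∈ Finset.Ico m k, P.edgeLength i) * η ≤ Λ :=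
      (mul_le_mul_of_nonneg_right hΛk hη.le).trans (mul_le_of_le_one_right hΛ0 hP.le_one)
    linarith
  have hmain : ‖P.vertex n - P.vertex m - Λ • P.dirNext m‖
      ≤ Λ * (η + (J + 2 * (b - a + 2 * η))) := by
    rw [hΛ, Finset.sum_smul, Finset.sum_mul]
    refine norm_sub_sub_sum_Ico_le hmn fun k hk ↦ ?_
    have hkn : k < P.n := by rw [Finset.mem_Ico] at hk; omega
    calc _ = ‖(P.vertex (k + 1) - P.vertex k - P.edgeLength k • P.dirNext k)
            + P.edgeLength k • (P.dirNext k - P.dirNext m)‖ := by congr 1; module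
      _ ≤ _ := norm_add_le _ _
      _ ≤ P.edgeLength k * η + P.edgeLength k * (J + 2 * (b - a + 2 * η)) := by
          have hl := (hlen k hk).le
          rw [norm_smul, Real.norm_of_nonneg hl]
          gcongr
          · refine (hP.norm_vertex_step hc hkn).trans ?_
            rw [sq]
            exact mul_le_mul_of_nonneg_left (hP.edge k hkn) hl
          · exact hdir k hk
      _ = _ := by ring
  have hva := hP.norm_sub_vertex_idx_le hL hlip (s := a) ⟨ha, hab.trans hb⟩
  have hvb := hP.norm_sub_vertex_idx_le hL hlip (s := b) ⟨ha.trans hab, hb⟩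
  have hJ0 : 0 ≤ J := (Finset.sum_nonneg fun _ _ ↦ norm_nonneg _).trans hjump
  calc ‖c b - c a - (b - a) • P.dirNext m‖
      = ‖(c b - P.vertex n) - (c a - P.vertex m) + (Λ - (b - a)) • P.dirNext m
          + (P.vertex n - P.vertex m - Λ • P.dirNext m)‖ := by congr 1; module
    _ ≤ ‖c b - P.vertex n‖ + ‖c a - P.vertex m‖ + ‖(Λ - (b - a)) • P.dirNext m‖
          + ‖P.vertex n - P.vertex m - Λ • P.dirNext m‖ := by
        refine (norm_add_le _ _).trans (add_le_add_left ((norm_add_le _ _).trans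
          (add_le_add_left (norm_sub_le _ _) _)) _)
    _ ≤ η + η + 2 * η + (b - a + 2 * η) * (η + (J + 2 * (b - a + 2 * η))) := by
        gcongr
        · rw [norm_smul, P.norm_dirNext hc (P.idx_lt hL a), mul_one]
          exact hΛ2
        · refine hmain.trans (mul_le_mul_of_nonneg_right hΛ1 ?_)
          have : 0 ≤ b - a := by linarith
          positivity
    _ = _ := by ring

/-- When `norm_dirNext_step` is summed, the terms `edgeLength • vertex` form a Riemann sum for the
integral of `c`. The constant is `(L + 2) + (1 + L) + 1 + 1`: linearization, Riemann sum, and the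
two end points. -/
theorem Fine.norm_sum_jump_sub_le (hcont : ContinuousOn c (Icc 0 L)) {a b : ℝ} (ha : 0 ≤ a)
    (hab : a ≤ b) (hb : b ≤ L) :
    ‖∑ k ∈ Finset.Ico (P.idx a) (P.idx b), P.jump (k + 1)
        - (P.dirNext (P.idx b) - P.dirNext (P.idx a) + ((∫ s in (0 : ℝ)..b, c s)
          - ∫ s in (0 : ℝ)..a, c s))‖ ≤ (2 * L + 5) * η := by
  have hη := hP.pos hL
  have hnb := P.idx_lt hL b
  set m := P.idx a with hm
  set n := P.idx b with hn
  have hmn : m ≤ n := P.idx_mono hab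
  have hint : ∀ s ∈ Icc 0 L, ∀ t ∈ Icc 0 L, IntervalIntegrable c volume s t := fun s hs t ht ↦
    (hcont.mono (by rw [← uIcc_of_le hL.le] at hs ht ⊢; exact uIcc_subset_uIcc hs ht)).intervalIntegrable
  have h0L : (0 : ℝ) ∈ Icc 0 L := ⟨le_rfl, hL.le⟩
  have hClip : ∀ s ∈ Icc 0 L, ∀ t ∈ Icc 0 L, s ≤ t →
      ‖(∫ r in (0 : ℝ)..t, c r) - ∫ r in (0 : ℝ)..s, c r‖ ≤ t - s := by
    intro s hs t ht hst
    rw [intervalIntegral.integral_interval_sub_left (hint 0 h0L t ht) (hint 0 h0L s hs)]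
    refine (intervalIntegral.norm_integral_le_of_norm_le_const (C := 1) fun r hr ↦ ?_).trans_eq ?_
    · rw [uIoc_of_le hst] at hr
      exact (hc r ⟨hs.1.trans hr.1.le, hr.2.trans ht.2⟩).le
    · rw [one_mul, abs_of_nonneg (by linarith)]
  have h1 := hP.norm_dirNext_sub_le hc hmn hnb.le
  have hΛ : ∑ i ∈ Finset.Ico m n, P.edgeLength i ≤ L + 2 := by
    have := hP.sum_edgeLength_idx_le hL ha hab hb
    linarith [hP.le_one, abs_le.1 (hP.abs_sum_edgeLength_sub_le hmn hnb.le),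
      (P.t_mem hnb.le).2, (P.t_mem (P.idx_lt hL a).le).1]
  have h2 : ‖(∫ r in (0 : ℝ)..P.t n, c r) - (∫ r in (0 : ℝ)..P.t m, c r)
      - ∑ i ∈ Finset.Ico m n, P.edgeLength i • P.vertex i‖ ≤ η + L * η := by
    refine (norm_sub_sub_sum_Ico_le (f := fun k ↦ ∫ r in (0 : ℝ)..P.t k, c r)
      (e := fun i ↦ |P.edgeLength i - (P.t (i + 1) - P.t i)| + (P.t (i + 1) - P.t i) * η)
      hmn fun k hk ↦ ?_).trans ?_
    · have hkn : k < P.n := by rw [Finset.mem_Ico] at hk; omega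
      have hk0 := P.t_mem hkn.le
      have hk1 := P.t_mem (Nat.succ_le_of_lt hkn)
      have hlt := P.t_lt k hkn
      rw [intervalIntegral.integral_interval_sub_left (hint 0 h0L _ hk1) (hint 0 h0L _ hk0)]
      have e1 : (∫ r in P.t k..P.t (k + 1), c r) - P.edgeLength k • P.vertex k
          = (∫ r in P.t k..P.t (k + 1), (c r - P.vertex k))
            - (P.edgeLength k - (P.t (k + 1) - P.t k)) • P.vertex k := by
        rw [intervalIntegral.integral_sub (hint _ hk0 _ hk1) (by simp),
          intervalIntegral.integral_const]
        module
      rw [e1]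
      refine (norm_sub_le _ _).trans ?_
      rw [add_comm]
      gcongr
      · rw [norm_smul, P.norm_vertex hc hkn.le, mul_one, Real.norm_eq_abs]
      · refine (intervalIntegral.norm_integral_le_of_norm_le_const (C := η) fun r hr ↦ ?_).trans_eq ?_
        · rw [uIoc_of_le hlt.le] at hr
          refine (hlip r ⟨hk0.1.trans hr.1.le, hr.2.trans hk1.2⟩ _ hk0).trans ?_
          rw [abs_of_nonneg (by linarith [hr.1])]
          linarith [hP.mesh k hkn, hr.2]
        · rw [abs_of_nonneg (by linarith), mul_comm]
    · rw [Finset.sum_add_distrib, ← Finset.sum_mul, Finset.sum_Ico_sub P.t hmn]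
      gcongr
      · refine le_trans (Finset.sum_le_sum_of_subset_of_nonneg ?_ fun _ _ _ ↦ abs_nonneg _) hP.length
        intro i hi
        rw [Finset.mem_Ico] at hi
        exact Finset.mem_range.2 (by omega)
      · linarith [(P.t_mem hnb.le).2, (P.t_mem (P.idx_lt hL a).le).1]
  have hma := hClip _ (P.t_mem (P.idx_lt hL a).le) a ⟨ha, hab.trans hb⟩ (P.t_idx_le ha)
  have hnb' := hClip _ (P.t_mem hnb.le) b ⟨ha.trans hab, hb⟩ (P.t_idx_le (ha.trans hab))
  have hta := hP.sub_le_t_idx hL (hab.trans hb)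
  have htb := hP.sub_le_t_idx hL hb
  rw [Finset.sum_sub_distrib] at h1
  set B := P.dirNext n - P.dirNext m
  calc _ = ‖-(B - (∑ i ∈ Finset.Ico m n, P.jump (i + 1)
              - ∑ i ∈ Finset.Ico m n, P.edgeLength i • P.vertex i))
            - ((∫ r in (0 : ℝ)..P.t n, c r) - (∫ r in (0 : ℝ)..P.t m, c r)
              - ∑ i ∈ Finset.Ico m n, P.edgeLength i • P.vertex i)
            - ((∫ r in (0 : ℝ)..b, c r) - ∫ r in (0 : ℝ)..P.t n, c r)
            + ((∫ r in (0 : ℝ)..a, c r) - ∫ r in (0 : ℝ)..P.t m, c r)‖ := by congr 1; abel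
    _ ≤ _ := norm_add_le _ _
    _ ≤ _ := add_le_add_left (norm_sub_le _ _) _
    _ ≤ _ := add_le_add_left (add_le_add_left (norm_sub_le _ _) _) _
    _ ≤ (L + 2) * η + (η + L * η) + η + η := by
        rw [norm_neg]
        have : (∑ i ∈ Finset.Ico m n, P.edgeLength i) * η ≤ (L + 2) * η :=
          mul_le_mul_of_nonneg_right hΛ hη.le
        linarith
    _ = _ := by ring

end Estimates

end InscribedPolygonal

/-! ### Unit speed curves and inscribed polygonals of small modulus -/

section Distance

variable {x y : E3}

theorem sphDist_nonneg (x y : E3) : 0 ≤ sphDist x y := InnerProductGeometry.angle_nonneg _ _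

theorem sphDist_le_pi (x y : E3) : sphDist x y ≤ Real.pi := InnerProductGeometry.angle_le_pi _ _

theorem norm_sub_eq_two_mul_sin (hx : ‖x‖ = 1) (hy : ‖y‖ = 1) :
    ‖x - y‖ = 2 * Real.sin (sphDist x y / 2) := by
  have h0 : 0 ≤ Real.sin (sphDist x y / 2) := Real.sin_nonneg_of_nonneg_of_le_pi
    (by linarith [sphDist_nonneg x y]) (by linarith [sphDist_le_pi x y, Real.pi_pos])
  rw [← sq_eq_sq₀ (norm_nonneg _) (by positivity), norm_sub_sq_real, hx, hy,
    inner_eq_cos_sphDist hx hy]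
  have h2 := Real.cos_sq (sphDist x y / 2)
  have h3 := Real.sin_sq_add_cos_sq (sphDist x y / 2)
  rw [mul_div_cancel₀ _ (two_ne_zero' ℝ)] at h2
  linear_combination 4 * h2 - 4 * h3

theorem sphDist_pos (hx : ‖x‖ = 1) (hy : ‖y‖ = 1) (h : x ≠ y) : 0 < sphDist x y := by
  refine (sphDist_nonneg x y).lt_of_ne fun h0 ↦ h ?_
  rw [← sub_eq_zero, ← norm_eq_zero, norm_sub_eq_two_mul_sin hx hy, ← h0]
  simp

theorem norm_sub_le_sphDist (hx : ‖x‖ = 1) (hy : ‖y‖ = 1) : ‖x - y‖ ≤ sphDist x y := by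
  rw [norm_sub_eq_two_mul_sin hx hy]
  linarith [Real.sin_le (show 0 ≤ sphDist x y / 2 by linarith [sphDist_nonneg x y])]

theorem sphDist_le_two_mul (hx : ‖x‖ = 1) (hy : ‖y‖ = 1) : sphDist x y ≤ 2 * ‖x - y‖ := by
  rw [norm_sub_eq_two_mul_sin hx hy]
  have h := Real.mul_le_sin (show 0 ≤ sphDist x y / 2 by linarith [sphDist_nonneg x y])
    (by linarith [sphDist_le_pi x y])
  have h4 : (1 / 2 : ℝ) ≤ 2 / Real.pi := by
    rw [div_le_div_iff₀ two_pos Real.pi_pos]; linarith [Real.pi_le_four]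
  have := mul_le_mul_of_nonneg_right h4 (show 0 ≤ sphDist x y / 2 by linarith [sphDist_nonneg x y])
  linarith

/-- Arc and chord differ only to third order, so the lengths of the geodesic polygonal and of the
chordal one have the same limit. -/
theorem sphDist_sub_norm_sub_le (hx : ‖x‖ = 1) (hy : ‖y‖ = 1) :
    sphDist x y - ‖x - y‖ ≤ ‖x - y‖ ^ 3 := by
  rcases (sphDist_nonneg x y).eq_or_lt with h | h
  · rw [← h, zero_sub]
    linarith [norm_nonneg (x - y), pow_nonneg (norm_nonneg (x - y)) 3]
  · have h1 := Real.sin_gt_sub_cube (half_pos h)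
    have h2 := pow_le_pow_left₀ h.le (sphDist_le_two_mul hx hy) 3
    have h3 := norm_sub_eq_two_mul_sin hx hy
    have h4 : (sphDist x y / 2) ^ 3 / 6 * 2 = sphDist x y ^ 3 / 24 := by ring
    have h5 : (2 * ‖x - y‖) ^ 3 = 8 * ‖x - y‖ ^ 3 := by ring
    have h6 := pow_nonneg (norm_nonneg (x - y)) 3
    linarith

end Distance

/-! ### Small modulus forces small mesh and almost full length -/

section UnitSpeed

variable {L : ℝ} {c : ℝ → E3} (hu : HasUnitSpeedOn c (Icc 0 L))
include hu

theorem eVariationOn_eq_of_unitSpeed {s t : ℝ} (hs : s ∈ Icc 0 L) (ht : t ∈ Icc 0 L) :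
    eVariationOn c (Icc s t) = ENNReal.ofReal (t - s) := by
  have h := hu hs ht
  rwa [inter_eq_right.2 (Icc_subset_Icc hs.1 ht.2), NNReal.coe_one, one_mul] at h

theorem norm_sub_le_of_unitSpeed : ∀ s ∈ Icc 0 L, ∀ t ∈ Icc 0 L, ‖c s - c t‖ ≤ |s - t| := by
  intro s hs t ht
  wlog hst : s ≤ t generalizing s t
  · rw [norm_sub_rev, abs_sub_comm]
    exact this t ht s hs (not_le.1 hst).le
  have h := eVariationOn.edist_le c (left_mem_Icc.2 hst) (right_mem_Icc.2 hst)
  rw [eVariationOn_eq_of_unitSpeed hu hs ht, edist_dist, dist_eq_norm,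
    ENNReal.ofReal_le_ofReal_iff (by linarith)] at h
  rwa [abs_sub_comm, abs_of_nonneg (by linarith)]

theorem continuousOn_of_unitSpeed : ContinuousOn c (Icc 0 L) := by
  have : LipschitzOnWith 1 c (Icc 0 L) := LipschitzOnWith.of_dist_le_mul fun s hs t ht ↦ by
    rw [dist_eq_norm, NNReal.coe_one, one_mul, Real.dist_eq]
    exact norm_sub_le_of_unitSpeed hu s hs t ht
  exact this.continuousOn

variable (hL : 0 < L) (hc : ∀ s ∈ Icc 0 L, ‖c s‖ = 1)
include hL hc

/-- A curve of unit speed is constant on no interval. On each of finitely many pieces two distinct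
points are chosen, and `μ` is the least of their distances. This turns smallness of the modulus into
smallness of the mesh. -/
theorem exists_pos_le_sphDist {η : ℝ} (hη : 0 < η) :
    ∃ μ > 0, ∀ s ∈ Icc 0 L, ∀ t ∈ Icc 0 L, η ≤ t - s →
      ∃ x ∈ Icc s t, ∃ y ∈ Icc s t, μ ≤ sphDist (c x) (c y) := by
  -- Pieces shorter than `η / 2`, so that every interval of length `η` contains a whole piece.
  obtain ⟨N, hN⟩ := exists_nat_gt (2 * L / η)
  have hN0 : (0 : ℝ) < N := (by positivity : 0 < 2 * L / η).trans hN
  set d := L / N with hd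
  have hd0 : 0 < d := by positivity
  have hdη : 2 * d < η := by
    rw [div_lt_iff₀ hη] at hN
    rw [hd, ← mul_div_assoc, div_lt_iff₀ hN0]
    linarith
  have hdL : N * d = L := by rw [hd]; field_simp
  have hpt : ∀ j : ℕ, ∃ x ∈ Icc (j * d) ((j + 1) * d), ∃ y ∈ Icc (j * d) ((j + 1) * d),
      j < N → 0 < sphDist (c x) (c y) := by
    intro j
    by_cases hj : j < N
    · have hj' : ((j : ℝ) + 1) ≤ N := by exact_mod_cast hj
      have hsub : Icc (j * d) ((j + 1) * d) ⊆ Icc 0 L := Icc_subset_Icc (by positivity) (by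
        rw [← hdL]; gcongr)
      have hle : j * d ≤ (j + 1) * d := by linarith
      by_contra! hcon
      have hsing : (c '' Icc (j * d) ((j + 1) * d)).Subsingleton := by
        rintro _ ⟨x, hx, rfl⟩ _ ⟨y, hy, rfl⟩
        by_contra hne
        exact absurd (sphDist_pos (hc x (hsub hx)) (hc y (hsub hy)) hne)
          (not_lt.2 (hcon x hx y hy).2)
      have h1 := eVariationOn.constant_on hsing
      rw [eVariationOn_eq_of_unitSpeed hu (hsub (left_mem_Icc.2 hle)) (hsub (right_mem_Icc.2 hle)),
        ENNReal.ofReal_eq_zero] at h1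
      linarith
    · exact ⟨j * d, ⟨le_rfl, by linarith⟩, j * d, ⟨le_rfl, by linarith⟩, fun h ↦ absurd h hj⟩
  choose x hx y hy hxy using hpt
  have hN1 : 0 < N := by exact_mod_cast hN0
  obtain ⟨j₀, hj₀, hmin⟩ := Finset.exists_min_image (Finset.range N)
    (fun j ↦ sphDist (c (x j)) (c (y j))) ⟨0, Finset.mem_range.2 hN1⟩
  refine ⟨_, hxy j₀ (Finset.mem_range.1 hj₀), fun s hs t ht hst ↦ ?_⟩
  set j := ⌈s / d⌉₊ with hj
  have h1 : s ≤ j * d := by rw [← div_le_iff₀ hd0]; exact Nat.le_ceil _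
  have h2 : (j + 1) * d ≤ t := by
    have h3 := Nat.ceil_lt_add_one (div_nonneg hs.1 hd0.le)
    have h4 : (j : ℝ) * d < (s / d + 1) * d := mul_lt_mul_of_pos_right h3 hd0
    rw [add_mul, div_mul_cancel₀ _ hd0.ne'] at h4
    linarith
  have hjN : j < N := by
    have h3 : ((j : ℝ) + 1) * d ≤ N * d := h2.trans (ht.2.trans_eq hdL.symm)
    have h4 := le_of_mul_le_mul_right h3 hd0
    exact_mod_cast lt_of_lt_of_le (lt_add_one (j : ℝ)) h4
  exact ⟨x j, ⟨h1.trans (hx j).1, (hx j).2.trans h2⟩, y j, ⟨h1.trans (hy j).1, (hy j).2.trans h2⟩,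
    hmin j (Finset.mem_range.2 hjN)⟩

variable {P : ℕ → InscribedPolygonal L c}
  (hP : Tendsto (fun h ↦ (P h).modulus) atTop (𝓝 0))
include hP

theorem eventually_mesh_le {η : ℝ} (hη : 0 < η) :
    ∀ᶠ h in atTop, ∀ i < (P h).n, (P h).t (i + 1) - (P h).t i ≤ η := by
  obtain ⟨μ, hμ, hmu⟩ := exists_pos_le_sphDist hu hL hc hη
  filter_upwards [hP.eventually (gt_mem_nhds hμ)] with h hh i hi
  by_contra! hlt
  obtain ⟨x, hx, y, hy, hxy⟩ := hmu _ ((P h).t_mem hi.le) _ ((P h).t_mem (Nat.succ_le_of_lt hi))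
    hlt.le
  have hle : sphDist (c x) (c y) ≤ (P h).modulus := by
    refine le_csSup ⟨Real.pi, ?_⟩ ⟨i, hi, x, hx, y, hy, rfl⟩
    rintro _ ⟨_, _, _, _, _, _, rfl⟩
    exact sphDist_le_pi _ _
  linarith

/-- Lower semicontinuity of the variation: the step curves `s ↦ c (t (idx s))` converge pointwise to
`c`, and their variation is at most the sum of the chords. -/
theorem eventually_length_sub_le {ε : ℝ} (hε : 0 < ε) :
    ∀ᶠ h in atTop, L - ε ≤ ∑ i ∈ Finset.range (P h).n,
      ‖(P h).vertex i - (P h).vertex (i + 1)‖ := by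
  rcases lt_or_ge L ε with hlt | hle
  · exact Eventually.of_forall fun h ↦ le_trans (by linarith)
      (Finset.sum_nonneg fun _ _ ↦ norm_nonneg _)
  have hlim : ∀ s ∈ Icc 0 L, Tendsto (fun h ↦ c ((P h).t ((P h).idx s))) atTop (𝓝 (c s)) := by
    intro s hs
    rw [Metric.tendsto_nhds]
    intro δ hδ
    filter_upwards [eventually_mesh_le hu hL hc hP (half_pos hδ)] with h hh
    have h1 := hh _ ((P h).idx_lt hL s)
    have h2 := (P h).le_t_idx_succ hL hs.2
    have h3 := (P h).t_idx_le hs.1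
    have h4 := norm_sub_le_of_unitSpeed hu _ ((P h).t_mem ((P h).idx_lt hL s).le) s hs
    rw [abs_of_nonpos (by linarith)] at h4
    rw [dist_eq_norm]
    linarith
  have hvar : ENNReal.ofReal (L - ε) < eVariationOn c (Icc 0 L) := by
    rw [eVariationOn_eq_of_unitSpeed hu (left_mem_Icc.2 hL.le) (right_mem_Icc.2 hL.le),
      ENNReal.ofReal_lt_ofReal_iff (by linarith)]
    linarith
  filter_upwards [eVariationOn.lowerSemicontinuous_aux hlim hvar] with h hh
  -- The values of `t` above `n` are arbitrary. Truncating the index makes the sequence of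
  -- parameters monotone on all of `ℕ`.
  have hmono : Monotone fun k ↦ (P h).t (min k (P h).n) := fun a b hab ↦
    (P h).t_mono (min_le_min_right _ hab) (min_le_right _ _)
  have h1 : eVariationOn (c ∘ fun s ↦ (P h).t ((P h).idx s)) (Icc 0 L)
      ≤ eVariationOn c ((fun k ↦ (P h).t (min k (P h).n)) '' Iic (P h).n) := by
    refine eVariationOn.comp_le_of_monotoneOn c _ ?_ ?_
    · intro s _ s' _ hss
      exact (P h).t_mono ((P h).idx_mono hss) ((P h).idx_lt hL s').le
    · intro s _
      refine ⟨(P h).idx s, ((P h).idx_lt hL s).le, ?_⟩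
      simp only
      rw [min_eq_left ((P h).idx_lt hL s).le]
  rw [eVariationOn.image_range_of_monotone c hmono] at h1
  have h2 := (hh.trans_le h1).le
  have h3 : ∑ i ∈ Finset.range (P h).n, edist (c ((P h).t (min i (P h).n)))
      (c ((P h).t (min (i + 1) (P h).n)))
      = ENNReal.ofReal (∑ i ∈ Finset.range (P h).n,
          ‖(P h).vertex i - (P h).vertex (i + 1)‖) := by
    rw [ENNReal.ofReal_sum_of_nonneg fun _ _ ↦ norm_nonneg _]
    refine Finset.sum_congr rfl fun i hi ↦ ?_
    have hi' := Finset.mem_range.1 hi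
    rw [min_eq_left hi'.le, min_eq_left (Nat.succ_le_of_lt hi'), edist_dist, dist_eq_norm]
    rfl
  rwa [h3, ENNReal.ofReal_le_ofReal_iff (Finset.sum_nonneg fun _ _ ↦ norm_nonneg _)] at h2

theorem eventually_fine {η : ℝ} (hη : 0 < η) (hη1 : η ≤ 1) : ∀ᶠ h in atTop, (P h).Fine η := by
  -- The first bound gives edges at most `2 * δ ≤ η`. The second makes the total excess of arc over
  -- chord at most `η / 3`; the deficit of the chords takes another third.
  set δ := min (η / 2) (η / (3 * (L + 1))) with hδ
  have hδ0 : 0 < δ := by positivity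
  filter_upwards [eventually_mesh_le hu hL hc hP hδ0,
    eventually_length_sub_le hu hL hc hP (show 0 < η / 3 by positivity)] with h hmesh hlen
  have hδ2 : δ ≤ η / 2 := min_le_left _ _
  have hδL : δ * L ≤ η / 3 := by
    have h1 : δ ≤ η / (3 * (L + 1)) := min_le_right _ _
    rw [le_div_iff₀ (by positivity)] at h1
    linarith
  have hchord : ∀ i < (P h).n, ‖(P h).vertex i - (P h).vertex (i + 1)‖
      ≤ (P h).t (i + 1) - (P h).t i := by
    intro i hi
    have h1 := norm_sub_le_of_unitSpeed hu _ ((P h).t_mem hi.le) _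
      ((P h).t_mem (Nat.succ_le_of_lt hi))
    rwa [abs_sub_comm, abs_of_nonneg (by linarith [(P h).t_lt i hi])] at h1
  have hv : ∀ i ≤ (P h).n, ‖(P h).vertex i‖ = 1 := fun i hi ↦ (P h).norm_vertex hc hi
  have hsum : ∑ i ∈ Finset.range (P h).n, ((P h).t (i + 1) - (P h).t i) = L := by
    rw [Finset.sum_range_sub, (P h).t_last, (P h).t_zero, sub_zero]
  refine ⟨hη1, fun i hi ↦ (hmesh i hi).trans (by linarith), fun i hi ↦ ?_, ?_⟩
  · have h1 := sphDist_le_two_mul (hv i hi.le) (hv (i + 1) hi)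
    have h2 := hchord i hi
    have h3 := hmesh i hi
    have h4 : (P h).edgeLength i = sphDist ((P h).vertex i) ((P h).vertex (i + 1)) := rfl
    linarith
  · have hterm : ∀ i ∈ Finset.range (P h).n,
        |(P h).edgeLength i - ((P h).t (i + 1) - (P h).t i)|
        ≤ δ * ((P h).t (i + 1) - (P h).t i) + (((P h).t (i + 1) - (P h).t i)
          - ‖(P h).vertex i - (P h).vertex (i + 1)‖) := by
      intro i hi
      have hi := Finset.mem_range.1 hi
      have h1 := sphDist_sub_norm_sub_le (hv i hi.le) (hv (i + 1) hi)
      have h2 := hchord i hi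
      have h3 := hmesh i hi
      have h4 : (P h).edgeLength i = sphDist ((P h).vertex i) ((P h).vertex (i + 1)) := rfl
      have h5 := norm_sub_le_sphDist (hv i hi.le) (hv (i + 1) hi)
      have h0 := norm_nonneg ((P h).vertex i - (P h).vertex (i + 1))
      rw [← h4] at h1 h5
      generalize ‖(P h).vertex i - (P h).vertex (i + 1)‖ = ν at *
      generalize (P h).t (i + 1) - (P h).t i = Δ at *
      have h6 : ν ^ 3 ≤ δ * Δ := by
        have h7 : ν ^ 2 ≤ δ := by
          have : ν ≤ 1 := by linarith
          nlinarith
        calc ν ^ 3 = ν ^ 2 * ν := by ring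
          _ ≤ δ * Δ := mul_le_mul h7 h2 h0 hδ0.le
      rw [abs_le]
      constructor
      · have := mul_nonneg hδ0.le (h0.trans h2)
        linarith
      · linarith
    refine (Finset.sum_le_sum hterm).trans ?_
    rw [Finset.sum_add_distrib, ← Finset.mul_sum, hsum, Finset.sum_sub_distrib, hsum]
    linarith

end UnitSpeed

/-! ### The lower bound -/

/-- On `[0, L]` the curve `c` is continuously differentiable, and its derivative `v` is the
indefinite integral of the integrable function `w`. -/
structure HasSecondDeriv (L : ℝ) (c v w : ℝ → E3) : Prop where
  hasDerivWithinAt : ∀ t ∈ Icc 0 L, HasDerivWithinAt c (v t) (Icc 0 L) t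
  intervalIntegrable : IntervalIntegrable w volume 0 L
  eq_add_integral : ∀ t ∈ Icc 0 L, v t = v 0 + ∫ s in (0 : ℝ)..t, w s

/-- The hypothesis expands `c` only from the left end of each interval. The modulus of continuity of
`T` moves the expansion to the right end. -/
theorem hasDerivWithinAt_of_forall_le {L : ℝ} {c T : ℝ → E3} {m : ℝ → ℝ}
    (hm : Tendsto m (𝓝[≥] 0) (𝓝 0))
    (h : ∀ a ∈ Icc 0 L, ∀ b ∈ Icc 0 L, a < b → ‖c b - c a - (b - a) • T a‖ ≤ (b - a) * m (b - a))
    (hT : ∀ a ∈ Icc 0 L, ∀ b ∈ Icc 0 L, a < b → ‖T b - T a‖ ≤ m (b - a)) :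
    ∀ t ∈ Icc 0 L, HasDerivWithinAt c (T t) (Icc 0 L) t := by
  intro t ht
  rw [hasDerivWithinAt_iff_isLittleO, Asymptotics.isLittleO_iff]
  intro ε hε
  obtain ⟨δ, hδ, hmδ⟩ := Metric.mem_nhdsWithin_iff.1 (hm.eventually (gt_mem_nhds (half_pos hε)))
  have hmle : ∀ r, 0 ≤ r → r < δ → m r ≤ ε / 2 := fun r h0 h1 ↦
    (hmδ ⟨by rw [Metric.mem_ball, dist_zero_right, Real.norm_of_nonneg h0]; exact h1, h0⟩ :
      m r < ε / 2).le
  refine Metric.mem_nhdsWithin_iff.2 ⟨δ, hδ, ?_⟩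
  rintro s ⟨hs, hsL⟩
  rw [Metric.mem_ball, Real.dist_eq] at hs
  change ‖c s - c t - (s - t) • T t‖ ≤ ε * ‖s - t‖
  rw [Real.norm_eq_abs]
  rcases lt_trichotomy s t with hst | rfl | hst
  · rw [abs_of_neg (by linarith), neg_sub] at hs ⊢
    have h1 := hmle _ (by linarith) hs
    calc ‖c s - c t - (s - t) • T t‖
        = ‖(t - s) • (T t - T s) - (c t - c s - (t - s) • T s)‖ := by congr 1; module
      _ ≤ _ := norm_sub_le _ _
      _ ≤ (t - s) * (ε / 2) + (t - s) * (ε / 2) := by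
          have h0 : 0 ≤ t - s := by linarith
          rw [norm_smul, Real.norm_of_nonneg h0]
          gcongr
          · exact (hT s hsL t ht hst).trans h1
          · exact (h s hsL t ht hst).trans (mul_le_mul_of_nonneg_left h1 h0)
      _ = _ := by ring
  · simp
  · rw [abs_of_pos (by linarith)] at hs ⊢
    have h1 := hmle _ (by linarith) hs
    have h0 : 0 < s - t := by linarith
    refine (h t ht s hsL hst).trans ?_
    rw [mul_comm ε]
    exact mul_le_mul_of_nonneg_left (by linarith) h0.le

/-! ### Passage to the limit along an ultrafilter -/

section Limit

variable {L p M : ℝ} {c : ℝ → E3} (hp : 1 < p) (hL : 0 < L) (hc : ∀ s ∈ Icc 0 L, ‖c s‖ = 1)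
  {P : ℕ → InscribedPolygonal L c} {U : Ultrafilter ℕ}

include hL hc in
-- The directions lie in the compact unit sphere, so an ultrafilter makes them converge at every
-- parameter at once, without a selection theorem.
theorem exists_tendsto_dirNext (P : ℕ → InscribedPolygonal L c) (U : Ultrafilter ℕ) :
    ∃ T : ℝ → E3, ∀ s, Tendsto (fun h ↦ (P h).dirNext ((P h).idx s)) U (𝓝 (T s)) := by
  have : ∀ s, ∃ x, Tendsto (fun h ↦ (P h).dirNext ((P h).idx s)) U (𝓝 x) := by
    intro s
    obtain ⟨x, _, hx⟩ := (isCompact_sphere (0 : E3) 1).ultrafilter_le_nhds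
      (U.map fun h ↦ (P h).dirNext ((P h).idx s)) (by
        rw [Ultrafilter.coe_map, le_principal_iff]
        refine Filter.mem_map.2 (Eventually.of_forall fun h ↦ mem_sphere_zero_iff_norm.2 ?_)
        exact (P h).norm_dirNext hc ((P h).idx_lt hL s))
    exact ⟨x, hx⟩
  exact ⟨fun s ↦ (this s).choose, fun s ↦ (this s).choose_spec⟩

variable (hfine : ∀ η > 0, η ≤ 1 → ∀ᶠ h in U, (P h).Fine η)
  (hM : ∀ᶠ h in U, ∑ i ∈ Finset.Ico 1 (P h).n,
    ‖(P h).jump i‖ ^ p * (P h).cornerLength i ^ (1 - p) ≤ M)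
  (hlip : ∀ s ∈ Icc 0 L, ∀ t ∈ Icc 0 L, ‖c s - c t‖ ≤ |s - t|) (hcont : ContinuousOn c (Icc 0 L))
  {T : ℝ → E3} (hT : ∀ s, Tendsto (fun h ↦ (P h).dirNext ((P h).idx s)) U (𝓝 (T s)))

include hL hc hfine hlip hcont hT in
theorem tendsto_sum_jump {a b : ℝ} (ha : 0 ≤ a) (hab : a ≤ b) (hb : b ≤ L) :
    Tendsto (fun h ↦ ∑ k ∈ Finset.Ico ((P h).idx a) ((P h).idx b), (P h).jump (k + 1)) U
      (𝓝 (T b + (∫ s in (0 : ℝ)..b, c s) - (T a + ∫ s in (0 : ℝ)..a, c s))) := by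
  have h1 : Tendsto (fun h ↦ (P h).dirNext ((P h).idx b) - (P h).dirNext ((P h).idx a)
      + ((∫ s in (0 : ℝ)..b, c s) - ∫ s in (0 : ℝ)..a, c s)) U
      (𝓝 (T b - T a + ((∫ s in (0 : ℝ)..b, c s) - ∫ s in (0 : ℝ)..a, c s))) :=
    ((hT b).sub (hT a)).add_const _
  have h2 : Tendsto (fun h ↦ ∑ k ∈ Finset.Ico ((P h).idx a) ((P h).idx b), (P h).jump (k + 1)
      - ((P h).dirNext ((P h).idx b) - (P h).dirNext ((P h).idx a)
      + ((∫ s in (0 : ℝ)..b, c s) - ∫ s in (0 : ℝ)..a, c s))) U (𝓝 0) := by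
    rw [Metric.tendsto_nhds]
    intro ε hε
    have hη : 0 < min 1 (ε / (2 * (2 * L + 5))) := by positivity
    filter_upwards [hfine _ hη (min_le_left _ _)] with h hh
    rw [dist_zero_right]
    refine (hh.norm_sum_jump_sub_le hL hc hlip hcont ha hab hb).trans_lt ?_
    calc (2 * L + 5) * min 1 (ε / (2 * (2 * L + 5)))
        ≤ (2 * L + 5) * (ε / (2 * (2 * L + 5))) := by gcongr; exact min_le_right _ _
      _ = ε / 2 := by field_simp
      _ < ε := half_lt_self hε
  have h3 := h2.add h1
  simp only [sub_add_cancel, zero_add] at h3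
  convert h3 using 2
  abel

include hp hL hc hfine hM hlip hcont hT in
-- For fixed `η` the discrete bound passes to the limit along `U`, as only finitely many increments
-- occur. Then `η` tends to zero.
theorem rieszBound_limit : RieszBound p L M (fun t ↦ T t + ∫ s in (0 : ℝ)..t, c s) := by
  intro S a b hS hd
  have hη : ∀ η ∈ Ioc (0 : ℝ) 1, ∑ i ∈ S,
      ‖T (b i) + (∫ s in (0 : ℝ)..b i, c s) - (T (a i) + ∫ s in (0 : ℝ)..a i, c s)‖ ^ p
        * (b i - a i + 2 * η) ^ (1 - p) ≤ M := by
    intro η hη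
    have h1 : Tendsto (fun h ↦ ∑ i ∈ S, ‖∑ k ∈ Finset.Ico ((P h).idx (a i)) ((P h).idx (b i)),
        (P h).jump (k + 1)‖ ^ p * (b i - a i + 2 * η) ^ (1 - p)) U (𝓝 (∑ i ∈ S,
      ‖T (b i) + (∫ s in (0 : ℝ)..b i, c s) - (T (a i) + ∫ s in (0 : ℝ)..a i, c s)‖ ^ p
        * (b i - a i + 2 * η) ^ (1 - p))) := by
      refine tendsto_finsetSum _ fun i hi ↦ Tendsto.mul_const _ ?_
      obtain ⟨h0, hab, hb⟩ := hS i hi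
      exact ((tendsto_sum_jump hL hc hfine hlip hcont hT h0 hab.le hb).norm).rpow_const
        (Or.inr (by linarith))
    refine le_of_tendsto h1 ?_
    filter_upwards [hfine η hη.1 hη.2, hM] with h hh hMh
    exact hh.sum_rpow_jump_le hL hp hMh S a b hS hd
  have h2 : Tendsto (fun η : ℝ ↦ ∑ i ∈ S,
      ‖T (b i) + (∫ s in (0 : ℝ)..b i, c s) - (T (a i) + ∫ s in (0 : ℝ)..a i, c s)‖ ^ p
        * (b i - a i + 2 * η) ^ (1 - p)) (𝓝[>] 0) (𝓝 (∑ i ∈ S,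
      ‖T (b i) + (∫ s in (0 : ℝ)..b i, c s) - (T (a i) + ∫ s in (0 : ℝ)..a i, c s)‖ ^ p
        * (b i - a i) ^ (1 - p))) := by
    refine tendsto_finsetSum _ fun i hi ↦ Tendsto.const_mul _ ?_
    obtain ⟨h0, hab, hb⟩ := hS i hi
    have h3 : Tendsto (fun η : ℝ ↦ b i - a i + 2 * η) (𝓝 0) (𝓝 (b i - a i + 2 * 0)) :=
      (continuous_const.add (continuous_const.mul continuous_id)).tendsto 0
    rw [mul_zero, add_zero] at h3
    exact (h3.mono_left nhdsWithin_le_nhds).rpow_const (Or.inl (by linarith))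
  refine le_of_tendsto h2 ?_
  filter_upwards [Ioc_mem_nhdsGT (zero_lt_one' ℝ)] with η hη' using hη η hη'

include hp hL hc hfine hM hlip hT in
theorem norm_sub_sub_limit_le {a b : ℝ} (ha : 0 ≤ a) (hab : a ≤ b) (hb : b ≤ L) :
    ‖c b - c a - (b - a) • T a‖
      ≤ (b - a) * ((M * (b - a) ^ (p - 1)) ^ p⁻¹ + 2 * (b - a)) := by
  have hη : ∀ η ∈ Ioc (0 : ℝ) 1, ‖c b - c a - (b - a) • T a‖
      ≤ 4 * η + (b - a + 2 * η) * (η + ((M * (b - a + 2 * η) ^ (p - 1)) ^ p⁻¹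
          + 2 * (b - a + 2 * η))) := by
    intro η hη
    refine le_of_tendsto ((tendsto_const_nhds.sub ((hT a).const_smul (b - a))).norm) ?_
    filter_upwards [hfine η hη.1 hη.2, hM] with h hh hMh
    exact hh.norm_sub_sub_dirNext_le hL hc hlip hp hMh ha hab hb
  have hcont' : Continuous fun η : ℝ ↦ 4 * η + (b - a + 2 * η) * (η
      + ((M * (b - a + 2 * η) ^ (p - 1)) ^ p⁻¹ + 2 * (b - a + 2 * η))) := by
    have h1 : Continuous fun η : ℝ ↦ (M * (b - a + 2 * η) ^ (p - 1)) ^ p⁻¹ :=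
      ((continuous_const.mul ((by fun_prop : Continuous fun η : ℝ ↦ b - a + 2 * η).rpow_const
        fun _ ↦ Or.inr (by linarith))).rpow_const fun _ ↦ Or.inr (by positivity))
    fun_prop
  have h2 := (hcont'.tendsto 0).mono_left (nhdsWithin_le_nhds (s := Ioi 0))
  simp only [mul_zero, add_zero, zero_add] at h2
  refine ge_of_tendsto h2 ?_
  filter_upwards [Ioc_mem_nhdsGT (zero_lt_one' ℝ)] with η hη' using hη η hη'

include hp in
-- The Riesz bound for a single interval gives Hölder continuity with exponent `1 - 1/p`.
theorem RieszBound.norm_sub_le {G : ℝ → E3} (h : RieszBound p L M G) {a b : ℝ} (ha : 0 ≤ a)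
    (hab : a < b) (hb : b ≤ L) : ‖G b - G a‖ ≤ (M * (b - a) ^ (p - 1)) ^ p⁻¹ := by
  have h1 := h {0} (fun _ ↦ a) (fun _ ↦ b) (by simp [ha, hab, hb]) (by simp)
  have hpos : 0 < b - a := by linarith
  have hM : 0 ≤ M := by simpa using h ∅ 0 0 (by simp) (by simp)
  rw [Finset.sum_singleton, show 1 - p = -(p - 1) by ring, Real.rpow_neg hpos.le,
    ← div_eq_mul_inv, div_le_iff₀ (Real.rpow_pos_of_pos hpos _)] at h1
  exact (Real.le_rpow_inv_iff_of_pos (norm_nonneg _)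
    (mul_nonneg hM (Real.rpow_nonneg hpos.le _)) (by linarith)).2 h1

include hp hL hc hfine hM hlip hcont hT in
theorem hasDerivWithinAt_limit : ∀ t ∈ Icc 0 L, HasDerivWithinAt c (T t) (Icc 0 L) t := by
  have hR := rieszBound_limit hp hL hc hfine hM hlip hcont hT
  have hM0 : 0 ≤ M := by simpa using hR ∅ 0 0 (by simp) (by simp)
  have hp0 : 0 < p := by linarith
  refine hasDerivWithinAt_of_forall_le (m := fun r ↦ (M * r ^ (p - 1)) ^ p⁻¹ + 2 * r) ?_ ?_ ?_
  · have h1 : Continuous fun r : ℝ ↦ (M * r ^ (p - 1)) ^ p⁻¹ + 2 * r :=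
      ((continuous_const.mul (Real.continuous_rpow_const (by linarith))).rpow_const
        fun _ ↦ Or.inr (by positivity)).add (by fun_prop)
    have h2 := (h1.tendsto 0).mono_left (nhdsWithin_le_nhds (s := Ici 0))
    rwa [Real.zero_rpow (by linarith), mul_zero, mul_zero, add_zero, Real.zero_rpow (by positivity)]
      at h2
  · intro a ha b hb hab
    exact norm_sub_sub_limit_le hp hL hc hfine hM hlip hT ha.1 hab.le hb.2
  · intro a ha b hb hab
    have h1 := hR.norm_sub_le hp ha.1 hab hb.2
    have hint : ∀ s ∈ Icc 0 L, IntervalIntegrable c volume 0 s := fun s hs ↦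
      (hcont.mono (by rw [uIcc_of_le hs.1]; exact Icc_subset_Icc_right hs.2)).intervalIntegrable
    have h2 : ‖(∫ s in (0 : ℝ)..b, c s) - ∫ s in (0 : ℝ)..a, c s‖ ≤ b - a := by
      rw [intervalIntegral.integral_interval_sub_left (hint b hb) (hint a ha)]
      refine (intervalIntegral.norm_integral_le_of_norm_le_const (C := 1) fun r hr ↦ ?_).trans_eq ?_
      · rw [uIoc_of_le hab.le] at hr
        exact (hc r ⟨ha.1.trans hr.1.le, hr.2.trans hb.2⟩).le
      · rw [one_mul, abs_of_nonneg (by linarith)]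
    calc ‖T b - T a‖ = ‖(T b + (∫ s in (0 : ℝ)..b, c s) - (T a + ∫ s in (0 : ℝ)..a, c s))
            - ((∫ s in (0 : ℝ)..b, c s) - ∫ s in (0 : ℝ)..a, c s)‖ := by congr 1; abel
      _ ≤ _ := norm_sub_le _ _
      _ ≤ _ := by linarith

end Limit

theorem exists_hasSecondDeriv_of_pCurvature_lt {p L M : ℝ} {c : ℝ → E3} (hp : 1 < p) (hL : 0 < L)
    (hc : ∀ s ∈ Icc 0 L, ‖c s‖ = 1) (hu : HasUnitSpeedOn c (Icc 0 L))
    (hF : pCurvature p L c < ENNReal.ofReal M) :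
    ∃ v w, HasSecondDeriv L c v w ∧
      ∫⁻ s in Ioo 0 L, ‖w s + c s‖ₑ ^ p ≤ ENNReal.ofReal M := by
  simp only [pCurvature, iInf_lt_iff] at hF
  obtain ⟨P, hP, hlim⟩ := hF
  have hfreq : ∃ᶠ h in atTop, (P h).pRotation p < ENNReal.ofReal M := frequently_lt_of_liminf_lt
    (by isBoundedDefault) hlim
  have hM0 : 0 < M := by
    rw [← ENNReal.ofReal_pos]
    exact pos_of_gt hlim
  -- The bound on the liminf holds for infinitely many `h` only. The ultrafilter is chosen to
  -- contain that set of indices.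
  have : (atTop ⊓ 𝓟 {h | (P h).pRotation p < ENNReal.ofReal M}).NeBot :=
    frequently_mem_iff_neBot.1 hfreq
  obtain ⟨U, hU⟩ := Ultrafilter.exists_le (atTop ⊓ 𝓟 {h | (P h).pRotation p < ENNReal.ofReal M})
  have hUtop : (U : Filter ℕ) ≤ atTop := hU.trans inf_le_left
  have hUM : ∀ᶠ h in U, (P h).pRotation p < ENNReal.ofReal M :=
    le_principal_iff.1 (hU.trans inf_le_right)
  have hlip := norm_sub_le_of_unitSpeed hu
  have hcont := continuousOn_of_unitSpeed hu
  have hfine : ∀ η > 0, η ≤ 1 → ∀ᶠ h in U, (P h).Fine η := fun η h0 h1 ↦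
    hUtop (eventually_fine hu hL hc hP h0 h1)
  have hM : ∀ᶠ h in U, ∑ i ∈ Finset.Ico 1 (P h).n,
      ‖(P h).jump i‖ ^ p * (P h).cornerLength i ^ (1 - p) ≤ M := by
    filter_upwards [hUM] with h hh
    exact (ENNReal.ofReal_le_ofReal_iff hM0.le).1
      (((P h).sum_norm_rpow_le_pRotation hc hp).trans hh.le)
  obtain ⟨T, hT⟩ := exists_tendsto_dirNext hL hc P U
  have hR := rieszBound_limit hp hL hc hfine hM hlip hcont hT
  obtain ⟨g, hg, hGg⟩ := exists_eq_add_integral hL (hR.absolutelyContinuousOnInterval hp hL)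
  have hder := ae_hasDerivAt_of_eq_add_integral hL hg hGg
  have hcint : IntervalIntegrable c volume 0 L :=
    (hcont.mono (by rw [uIcc_of_le hL.le])).intervalIntegrable
  -- As `g` is the derivative of `T + ∫ c`, the second derivative of `c` is `g - c`.
  refine ⟨T, fun s ↦ g s - c s,
    ⟨hasDerivWithinAt_limit hp hL hc hfine hM hlip hcont hT, hg.sub hcint, fun t ht ↦ ?_⟩, ?_⟩
  · have hsub : uIcc 0 t ⊆ uIcc 0 L := by
      rw [uIcc_of_le ht.1, uIcc_of_le hL.le]; exact Icc_subset_Icc_right ht.2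
    rw [intervalIntegral.integral_sub (hg.mono_set hsub) (hcint.mono_set hsub)]
    have := hGg t ht
    rw [intervalIntegral.integral_same, add_zero] at this
    rw [← add_sub_assoc, ← this, add_sub_cancel_right]
  · simp only [sub_add_cancel]
    exact hR.lintegral_le hp hL hder

/-! ### Weak derivatives on an interval -/

/-- A smooth function with compact support in `(0, L)`. -/
structure IsTestFunction (L : ℝ) (φ : ℝ → ℝ) : Prop where
  contDiff : ContDiff ℝ ∞ φ
  hasCompactSupport : HasCompactSupport φ
  tsupport_subset : tsupport φ ⊆ Ioo 0 L

theorem IsTestFunction.eq_zero {L : ℝ} {φ : ℝ → ℝ} (h : IsTestFunction L φ) {t : ℝ}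
    (ht : t ∉ Ioo 0 L) : φ t = 0 :=
  image_eq_zero_of_notMem_tsupport fun h' ↦ ht (h.tsupport_subset h')

theorem setIntegral_Ioo_eq {E : Type*} [NormedAddCommGroup E] [NormedSpace ℝ E] {L : ℝ}
    (hL : 0 < L) (f : ℝ → E) : ∫ s in Ioo 0 L, f s = ∫ s in (0 : ℝ)..L, f s := by
  rw [intervalIntegral.integral_of_le hL.le, integral_Ioc_eq_integral_Ioo]

theorem intervalIntegrable_zero_iff {E : Type*} [NormedAddCommGroup E] {L : ℝ}
    (hL : 0 < L) {f : ℝ → E} : IntervalIntegrable f volume 0 L ↔ IntegrableOn f (Ioo 0 L) :=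
  intervalIntegrable_iff_integrableOn_Ioo_of_le hL.le

theorem intervalIntegrable_of_mem_Icc {E : Type*} [NormedAddCommGroup E] {L t : ℝ} {f : ℝ → E}
    (h : IntervalIntegrable f volume 0 L) (ht : t ∈ Icc 0 L) : IntervalIntegrable f volume 0 t :=
  h.mono_set (by rw [uIcc_of_le ht.1, uIcc_of_le (ht.1.trans ht.2)]; exact Icc_subset_Icc_right ht.2)

/-- Integration by parts for absolutely continuous functions. The boundary terms vanish with the
test function. -/
theorem integral_deriv_mul_primitive {L : ℝ} {φ v : ℝ → ℝ} (hφ : IsTestFunction L φ)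
    (hv : IntervalIntegrable v volume 0 L) :
    ∫ s in (0 : ℝ)..L, deriv φ s * ∫ r in (0 : ℝ)..s, v r = -∫ s in (0 : ℝ)..L, φ s * v s := by
  have h1 : AbsolutelyContinuousOnInterval φ 0 L :=
    ((hφ.contDiff.of_le (by exact_mod_cast le_top)).contDiffOn).absolutelyContinuousOnInterval
  have h2 := hv.absolutelyContinuousOnInterval_intervalIntegral (c := 0) (by simp)
  have h3 := h1.integral_mul_deriv_eq_deriv_mul h2
  rw [hφ.eq_zero (by simp), hφ.eq_zero (by simp), zero_mul, zero_mul, sub_zero, zero_sub] at h3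
  have h4 : ∫ s in (0 : ℝ)..L, φ s * v s
      = ∫ s in (0 : ℝ)..L, φ s * deriv (fun x ↦ ∫ r in (0 : ℝ)..x, v r) s := by
    refine intervalIntegral.integral_congr_ae ?_
    filter_upwards [hv.ae_hasDerivAt_integral] with s hs hsL
    rw [(hs (uIoc_subset_uIcc hsL) 0 (by simp)).deriv]
  rw [h4, h3, neg_neg]

theorem IsTestFunction.continuous_deriv {L : ℝ} {φ : ℝ → ℝ} (h : IsTestFunction L φ) :
    Continuous (deriv φ) := h.contDiff.continuous_deriv (by exact_mod_cast le_top)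

theorem integral_deriv_smul_primitive {L : ℝ} (hL : 0 < L) {φ : ℝ → ℝ} {v : ℝ → E3}
    (hφ : IsTestFunction L φ) (hv : IntervalIntegrable v volume 0 L) :
    ∫ s in Ioo 0 L, deriv φ s • ∫ r in (0 : ℝ)..s, v r = -∫ s in Ioo 0 L, φ s • v s := by
  have hprim : ContinuousOn (fun s ↦ ∫ r in (0 : ℝ)..s, v r) (uIcc 0 L) :=
    intervalIntegral.continuousOn_primitive_interval' hv (by simp)
  have hi1 : IntervalIntegrable (fun s ↦ deriv φ s • ∫ r in (0 : ℝ)..s, v r) volume 0 L :=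
    (hφ.continuous_deriv.continuousOn.smul hprim).intervalIntegrable
  have hi2 : IntervalIntegrable (fun s ↦ φ s • v s) volume 0 L :=
    hv.continuousOn_smul hφ.contDiff.continuous.continuousOn
  rw [setIntegral_Ioo_eq hL, setIntegral_Ioo_eq hL]
  ext k
  rw [PiLp.neg_apply, intervalIntegral_coord hi1, intervalIntegral_coord hi2]
  have h := integral_deriv_mul_primitive hφ (intervalIntegrable_coord hv k)
  simp only [PiLp.smul_apply, smul_eq_mul]
  rw [← h]
  refine intervalIntegral.integral_congr fun s hs ↦ ?_
  rw [uIcc_of_le hL.le] at hs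
  simp only
  rw [intervalIntegral_coord (intervalIntegrable_of_mem_Icc hv hs)]

theorem IsTestFunction.integral_deriv {L : ℝ} (hL : 0 < L) {φ : ℝ → ℝ} (hφ : IsTestFunction L φ) :
    ∫ s in Ioo 0 L, deriv φ s = 0 := by
  rw [setIntegral_Ioo_eq hL, intervalIntegral.integral_deriv_eq_sub
    (fun s _ ↦ (hφ.contDiff.differentiable (by simp)).differentiableAt)
    (hφ.continuous_deriv.intervalIntegrable _ _), hφ.eq_zero (by simp), hφ.eq_zero (by simp),
    sub_zero]

theorem isWeakDeriv_of_eq_add_integral {L : ℝ} (hL : 0 < L) {u v : ℝ → E3} {k : E3}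
    (hv : IntervalIntegrable v volume 0 L)
    (hu : ∀ᵐ t ∂volume.restrict (Ioo 0 L), u t = k + ∫ s in (0 : ℝ)..t, v s) :
    IsWeakDeriv L u v := by
  have hprim : ContinuousOn (fun s ↦ k + ∫ r in (0 : ℝ)..s, v r) (uIcc 0 L) :=
    continuousOn_const.add (intervalIntegral.continuousOn_primitive_interval' hv (by simp))
  have hint : IntegrableOn u (Ioo 0 L) :=
    ((intervalIntegrable_zero_iff hL).1 hprim.intervalIntegrable).congr_fun_ae
      (hu.mono fun _ h ↦ h.symm)
  refine ⟨hint, (intervalIntegrable_zero_iff hL).1 hv, fun φ h1 h2 h3 ↦ ?_⟩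
  have hφ : IsTestFunction L φ := ⟨h1, h2, h3⟩
  have hprim' : ContinuousOn (fun s ↦ ∫ r in (0 : ℝ)..s, v r) (uIcc 0 L) :=
    intervalIntegral.continuousOn_primitive_interval' hv (by simp)
  rw [← integral_deriv_smul_primitive hL hφ hv]
  calc ∫ s in Ioo 0 L, deriv φ s • u s
      = ∫ s in Ioo 0 L, (deriv φ s • k + deriv φ s • ∫ r in (0 : ℝ)..s, v r) := by
        refine integral_congr_ae (hu.mono fun s hs ↦ ?_)
        simp only
        rw [hs, smul_add]
    _ = _ := by
        rw [integral_add, integral_smul_const, hφ.integral_deriv hL, zero_smul, zero_add]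
        · exact (intervalIntegrable_zero_iff hL).1
            (hφ.continuous_deriv.smul continuous_const).continuousOn.intervalIntegrable
        · exact (intervalIntegrable_zero_iff hL).1
            (hφ.continuous_deriv.continuousOn.smul hprim').intervalIntegrable

theorem exists_isTestFunction {L : ℝ} (hL : 0 < L) :
    ∃ φ : ℝ → ℝ, IsTestFunction L φ ∧ ∫ s, φ s = 1 := by
  let f : ContDiffBump (L / 2) := ⟨L / 8, L / 4, by positivity, by linarith⟩
  refine ⟨f.normed volume, ⟨f.contDiff_normed, f.hasCompactSupport_normed, ?_⟩, f.integral_normed⟩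
  rw [f.tsupport_normed_eq, Real.closedBall_eq_Icc]
  intro s hs
  change s ∈ Icc (L / 2 - L / 4) (L / 2 + L / 4) at hs
  exact ⟨by linarith [hs.1], by linarith [hs.2]⟩

/-- A smooth function of compact support and zero mean has a primitive of compact support. -/
theorem IsTestFunction.exists_primitive {L : ℝ} (hL : 0 < L) {φ : ℝ → ℝ} (hφ : IsTestFunction L φ)
    (h0 : ∫ s, φ s = 0) : ∃ ψ, IsTestFunction L ψ ∧ deriv ψ = φ := by
  have hc := hφ.contDiff.continuous
  obtain ⟨a, b, ha, hb, hab⟩ : ∃ a b, 0 < a ∧ b < L ∧ tsupport φ ⊆ Icc a b := by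
    rcases (tsupport φ).eq_empty_or_nonempty with he | hne
    -- If the support is empty, the interval `Icc L 0` is empty too.
    · exact ⟨L, 0, hL, hL, by simp [he]⟩
    · obtain ⟨a, ha⟩ := hφ.hasCompactSupport.isCompact.exists_isLeast hne
      obtain ⟨b, hb⟩ := hφ.hasCompactSupport.isCompact.exists_isGreatest hne
      exact ⟨a, b, (hφ.tsupport_subset ha.1).1, (hφ.tsupport_subset hb.1).2,
        fun s hs ↦ ⟨ha.2 hs, hb.2 hs⟩⟩
  have hzero : ∀ s, s ∉ Icc a b → φ s = 0 := fun s hs ↦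
    image_eq_zero_of_notMem_tsupport fun h ↦ hs (hab h)
  have hder : deriv (fun t ↦ ∫ s in (0 : ℝ)..t, φ s) = φ :=
    funext fun t ↦ (hc.integral_hasStrictDerivAt 0 t).hasDerivAt.deriv
  have hL0 : ∫ s in (0 : ℝ)..L, φ s = 0 := by
    rw [← setIntegral_Ioo_eq hL, setIntegral_eq_integral_of_forall_compl_eq_zero
      fun s hs ↦ hφ.eq_zero hs, h0]
  have hsupp : ∀ t, t ∉ Icc a b → ∫ s in (0 : ℝ)..t, φ s = 0 := by
    intro t ht
    rw [mem_Icc, not_and_or, not_le, not_le] at ht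
    rcases ht with ht | ht
    · refine intervalIntegral.integral_zero_ae (Eventually.of_forall fun s hs ↦ hzero s fun h ↦ ?_)
      have : s ≤ max 0 t := hs.2
      have h2 : max 0 t < a := max_lt ha ht
      linarith [h.1]
    · rw [← intervalIntegral.integral_add_adjacent_intervals (b := L) (hc.intervalIntegrable _ _)
        (hc.intervalIntegrable _ _), hL0, zero_add]
      refine intervalIntegral.integral_zero_ae (Eventually.of_forall fun s hs ↦ hzero s fun h ↦ ?_)
      have : min L t < s := hs.1
      have h2 : b < min L t := lt_min hb ht
      linarith [h.2]
  have hts : tsupport (fun t ↦ ∫ s in (0 : ℝ)..t, φ s) ⊆ Icc a b :=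
    closure_minimal (fun t ht ↦ by_contra fun h ↦ ht (hsupp t h)) isClosed_Icc
  refine ⟨fun t ↦ ∫ s in (0 : ℝ)..t, φ s, ⟨?_, ?_, ?_⟩, hder⟩
  · refine contDiff_infty_iff_deriv.2 ⟨fun t ↦ ?_, ?_⟩
    · exact (hc.integral_hasStrictDerivAt 0 t).hasDerivAt.differentiableAt
    · rw [hder]; exact hφ.contDiff
  · exact HasCompactSupport.of_support_subset_isCompact isCompact_Icc
      ((subset_tsupport _).trans hts)
  · exact hts.trans fun s hs ↦ ⟨ha.trans_le hs.1, hs.2.trans_lt hb⟩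

/-- The lemma of du Bois-Reymond. -/
theorem ae_eq_const_of_integral_deriv_smul_eq_zero {L : ℝ} (hL : 0 < L) {u : ℝ → E3}
    (hu : IntegrableOn u (Ioo 0 L))
    (h : ∀ φ, IsTestFunction L φ → ∫ s in Ioo 0 L, deriv φ s • u s = 0) :
    ∃ k : E3, ∀ᵐ t ∂volume.restrict (Ioo 0 L), u t = k := by
  obtain ⟨φ₀, hφ₀, hφ₀1⟩ := exists_isTestFunction hL
  have hsm : ∀ φ, IsTestFunction L φ → IntegrableOn (fun s ↦ φ s • u s) (Ioo 0 L) := fun φ hφ ↦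
    (intervalIntegrable_zero_iff hL).1 (((intervalIntegrable_zero_iff hL).2 hu).continuousOn_smul
      hφ.contDiff.continuous.continuousOn)
  refine ⟨∫ s in Ioo 0 L, φ₀ s • u s, ?_⟩
  set k := ∫ s in Ioo 0 L, φ₀ s • u s with hk
  have key : ∀ᵐ t, t ∈ Ioo 0 L → u t - k = 0 := by
    refine isOpen_Ioo.ae_eq_zero_of_integral_contDiff_smul_eq_zero
      (hu.sub (integrableOn_const (by simp))).locallyIntegrableOn fun g hg1 hg2 hg3 ↦ ?_
    have hg : IsTestFunction L g := ⟨hg1, hg2, hg3⟩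
    have hgi : Integrable g := hg1.continuous.integrable_of_hasCompactSupport hg2
    have hφi : Integrable φ₀ :=
      hφ₀.contDiff.continuous.integrable_of_hasCompactSupport hφ₀.hasCompactSupport
    -- Subtracting a multiple of `φ₀` gives mean zero, hence the derivative of a test function.
    have hg0 : IsTestFunction L (fun s ↦ g s - (∫ r, g r) * φ₀ s) := by
      have hcs : HasCompactSupport fun s ↦ (∫ r, g r) * φ₀ s := hφ₀.hasCompactSupport.mul_left
      refine ⟨hg1.sub (contDiff_const.mul hφ₀.contDiff), hg2.sub hcs, ?_⟩
      refine (tsupport_sub _ _).trans (union_subset hg3 (Subset.trans ?_ hφ₀.tsupport_subset))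
      exact tsupport_mul_subset_right
    obtain ⟨ψ, hψ, hψd⟩ := hg0.exists_primitive hL (by
      rw [integral_sub hgi (hφi.const_mul _), integral_const_mul, hφ₀1, mul_one, sub_self])
    have h1 := h ψ hψ
    rw [hψd] at h1
    have h2 : ∫ s in Ioo 0 L, (g s • u s - (∫ r, g r) • (φ₀ s • u s)) = 0 := by
      rw [← h1]
      refine integral_congr_ae (Eventually.of_forall fun s ↦ ?_)
      simp only
      rw [sub_smul, smul_smul]
    rw [integral_sub (hsm g hg) (Integrable.fun_smul _ (hsm φ₀ hφ₀)), integral_smul, ← hk] at h2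
    rw [← setIntegral_eq_integral_of_forall_compl_eq_zero (s := Ioo 0 L)
      fun s hs ↦ by rw [hg.eq_zero hs, zero_smul]]
    have h3 : ∫ s in Ioo 0 L, g s • (u s - k) = (∫ s in Ioo 0 L, g s • u s) - (∫ r, g r) • k := by
      simp only [smul_sub]
      rw [integral_sub (hsm g hg) (hgi.integrableOn.smul_const k), integral_smul_const,
        setIntegral_eq_integral_of_forall_compl_eq_zero fun s hs ↦ hg.eq_zero hs]
    rw [h3, h2]
  rw [ae_restrict_iff' measurableSet_Ioo]
  filter_upwards [key] with t ht htL using sub_eq_zero.1 (ht htL)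

/-- The difference of `u` and a primitive of `v` has weak derivative zero, so it is constant almost
everywhere. -/
theorem IsWeakDeriv.exists_eq_add_integral {L : ℝ} (hL : 0 < L) {u v : ℝ → E3}
    (h : IsWeakDeriv L u v) :
    ∃ k : E3, ∀ᵐ t ∂volume.restrict (Ioo 0 L), u t = k + ∫ s in (0 : ℝ)..t, v s := by
  have hv := (intervalIntegrable_zero_iff hL).2 h.2.1
  have hprim : ContinuousOn (fun s ↦ ∫ r in (0 : ℝ)..s, v r) (uIcc 0 L) :=
    intervalIntegral.continuousOn_primitive_interval' hv (by simp)
  have hi : IntegrableOn (fun s ↦ ∫ r in (0 : ℝ)..s, v r) (Ioo 0 L) :=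
    (intervalIntegrable_zero_iff hL).1 hprim.intervalIntegrable
  obtain ⟨k, hk⟩ := ae_eq_const_of_integral_deriv_smul_eq_zero hL (h.1.sub hi) fun φ hφ ↦ by
    have h1 := h.2.2 φ hφ.contDiff hφ.hasCompactSupport hφ.tsupport_subset
    have h2 := integral_deriv_smul_primitive hL hφ hv
    simp only [Pi.sub_apply, smul_sub]
    rw [integral_sub, h1, h2, sub_self]
    · exact (intervalIntegrable_zero_iff hL).1 (((intervalIntegrable_zero_iff hL).2
        h.1).continuousOn_smul hφ.continuous_deriv.continuousOn)
    · exact (intervalIntegrable_zero_iff hL).1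
        (hφ.continuous_deriv.continuousOn.smul hprim).intervalIntegrable
  exact ⟨k, hk.mono fun t ht ↦ by rw [← ht]; simp⟩

theorem exists_hasSecondDeriv_of_isWeakDeriv {L : ℝ} (hL : 0 < L) {c c' c'' : ℝ → E3}
    (hcont : ContinuousOn c (Icc 0 L)) (h1 : IsWeakDeriv L c c') (h2 : IsWeakDeriv L c' c'') :
    ∃ v, HasSecondDeriv L c v c'' ∧ c' =ᵐ[volume.restrict (Ioo 0 L)] v := by
  obtain ⟨k, hk⟩ := h1.exists_eq_add_integral hL
  obtain ⟨k', hk'⟩ := h2.exists_eq_add_integral hL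
  have hwi : Integrable ((Ioo 0 L).indicator c'') :=
    (integrable_indicator_iff measurableSet_Ioo).2 h2.2.1
  -- The indicator makes `v` continuous on the whole line, so its primitive is differentiable at the
  -- end points of `[0, L]` as well.
  set v : ℝ → E3 := fun t ↦ k' + ∫ s in (0 : ℝ)..t, (Ioo 0 L).indicator c'' s with hv
  have hvc : Continuous v := continuous_const.add
    (intervalIntegral.continuous_primitive (fun a b ↦ hwi.intervalIntegrable) 0)
  have hveq : ∀ t ∈ Icc 0 L, v t = k' + ∫ s in (0 : ℝ)..t, c'' s := by
    intro t ht
    simp only [hv]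
    congr 1
    refine intervalIntegral.integral_congr_ae ?_
    filter_upwards [compl_mem_ae_iff.2 (Real.volume_singleton (a := L))] with s hsL hs
    rw [uIoc_of_le ht.1] at hs
    exact indicator_of_mem (mem_Ioo.2 ⟨hs.1, lt_of_le_of_ne (hs.2.trans ht.2) hsL⟩) _
  have hc'v : c' =ᵐ[volume.restrict (Ioo 0 L)] v := by
    filter_upwards [hk', ae_restrict_mem measurableSet_Ioo] with t ht htL
    rw [ht, hveq t (Ioo_subset_Icc_self htL)]
  have hCc : Continuous fun t ↦ k + ∫ s in (0 : ℝ)..t, v s := continuous_const.add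
    (intervalIntegral.continuous_primitive (fun a b ↦ hvc.intervalIntegrable a b) 0)
  have hceq : EqOn c (fun t ↦ k + ∫ s in (0 : ℝ)..t, v s) (Icc 0 L) := by
    refine Measure.eqOn_Icc_of_ae_eq volume hL.ne ?_ hcont hCc.continuousOn
    rw [← restrict_Ioo_eq_restrict_Icc]
    filter_upwards [hk, ae_restrict_mem measurableSet_Ioo] with t ht htL
    rw [ht]
    congr 1
    refine intervalIntegral.integral_congr_ae ?_
    have := (ae_restrict_iff' measurableSet_Ioo).1 hc'v
    filter_upwards [this] with s hs hs'
    rw [uIoc_of_le htL.1.le] at hs'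
    exact hs ⟨hs'.1, hs'.2.trans_lt htL.2⟩
  refine ⟨v, ⟨fun t ht ↦ ?_, (intervalIntegrable_zero_iff hL).2 h2.2.1, fun t ht ↦ ?_⟩, hc'v⟩
  · have h := ((hvc.integral_hasStrictDerivAt 0 t).hasDerivAt.const_add k).hasDerivWithinAt
      (s := Icc 0 L)
    exact h.congr hceq (hceq ht)
  · have h0 := hveq 0 ⟨le_rfl, hL.le⟩
    rw [intervalIntegral.integral_same, add_zero] at h0
    rw [hveq t ht, h0]

/-! ### Curves with a second derivative -/

namespace HasSecondDeriv

variable {L : ℝ} {c v w : ℝ → E3} (hL : 0 < L)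

include hL in
theorem continuousOn (h : HasSecondDeriv L c v w) : ContinuousOn v (Icc 0 L) := by
  have hprim : ContinuousOn (fun s ↦ v 0 + ∫ r in (0 : ℝ)..s, w r) (uIcc 0 L) :=
    continuousOn_const.add
      (intervalIntegral.continuousOn_primitive_interval' h.intervalIntegrable (by simp))
  rw [uIcc_of_le hL.le] at hprim
  exact hprim.congr h.eq_add_integral

theorem continuousOn_curve (h : HasSecondDeriv L c v w) : ContinuousOn c (Icc 0 L) :=
  fun t ht ↦ (h.hasDerivWithinAt t ht).continuousWithinAt

theorem hasDerivAt (h : HasSecondDeriv L c v w) {t : ℝ} (ht : t ∈ Ioo 0 L) :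
    HasDerivAt c (v t) t :=
  (h.hasDerivWithinAt t (Ioo_subset_Icc_self ht)).hasDerivAt (Icc_mem_nhds ht.1 ht.2)

include hL in
theorem ae_hasDerivAt (h : HasSecondDeriv L c v w) :
    ∀ᵐ t, t ∈ Ioo 0 L → HasDerivAt v (w t) t :=
  ae_hasDerivAt_of_eq_add_integral hL h.intervalIntegrable h.eq_add_integral

include hL in
theorem unique {v' w' : ℝ → E3} (h : HasSecondDeriv L c v w) (h' : HasSecondDeriv L c v' w') :
    w =ᵐ[volume.restrict (Ioo 0 L)] w' := by
  have hv : EqOn v v' (Icc 0 L) := fun t ht ↦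
    UniqueDiffWithinAt.eq_deriv _ (uniqueDiffOn_Icc hL t ht) (h.hasDerivWithinAt t ht)
      (h'.hasDerivWithinAt t ht)
  rw [EventuallyEq, ae_restrict_iff' measurableSet_Ioo]
  filter_upwards [h.ae_hasDerivAt hL, h'.ae_hasDerivAt hL] with t h1 h2 ht
  refine (h1 ht).unique ((h2 ht).congr_of_eventuallyEq ?_)
  filter_upwards [isOpen_Ioo.mem_nhds ht] with s hs using hv (Ioo_subset_Icc_self hs)

include hL in
theorem isWeakDeriv (h : HasSecondDeriv L c v w) : IsWeakDeriv L c v := by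
  have hvi : IntervalIntegrable v volume 0 L :=
    ContinuousOn.intervalIntegrable (by rw [uIcc_of_le hL.le]; exact h.continuousOn hL)
  refine isWeakDeriv_of_eq_add_integral hL (k := c 0) hvi ?_
  filter_upwards [ae_restrict_mem measurableSet_Ioo] with t ht
  rw [intervalIntegral.integral_eq_sub_of_hasDerivAt_of_le ht.1.le
    (h.continuousOn_curve.mono (Icc_subset_Icc_right ht.2.le))
    (fun s hs ↦ h.hasDerivAt ⟨hs.1, hs.2.trans ht.2⟩)
    (intervalIntegrable_of_mem_Icc hvi (Ioo_subset_Icc_self ht))]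
  abel

include hL in
theorem isWeakDeriv' (h : HasSecondDeriv L c v w) : IsWeakDeriv L v w :=
  isWeakDeriv_of_eq_add_integral hL (k := v 0) h.intervalIntegrable (by
    filter_upwards [ae_restrict_mem measurableSet_Ioo] with t ht
      using h.eq_add_integral t (Ioo_subset_Icc_self ht))

theorem memLp_of_continuousOn {u : ℝ → E3} (hu : ContinuousOn u (Icc 0 L)) (q : ℝ≥0∞) :
    MemLp u q (volume.restrict (Ioo 0 L)) := by
  obtain ⟨C, hC⟩ := isCompact_Icc.exists_bound_of_continuousOn hu
  refine MemLp.of_bound ((hu.mono Ioo_subset_Icc_self).aestronglyMeasurable measurableSet_Ioo) C ?_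
  filter_upwards [ae_restrict_mem measurableSet_Ioo] with t ht using hC t (Ioo_subset_Icc_self ht)

include hL in
theorem memW2 {p : ℝ} (hp : 1 < p) (h : HasSecondDeriv L c v w) (hc : ∀ s ∈ Icc 0 L, ‖c s‖ = 1)
    (hw : ∫⁻ s in Ioo 0 L, ‖w s + c s‖ₑ ^ p < ⊤) : MemW2 p L c := by
  have hp0 : 0 < p := by linarith
  refine ⟨?_, v, w, h.isWeakDeriv hL, h.isWeakDeriv' hL, memLp_of_continuousOn h.continuousOn_curve _,
    memLp_of_continuousOn (h.continuousOn hL) _, ?_⟩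
  · filter_upwards [ae_restrict_mem measurableSet_Ioo] with t ht using hc t (Ioo_subset_Icc_self ht)
  · have hcm := memLp_of_continuousOn h.continuousOn_curve (ENNReal.ofReal p)
    have hwm : AEStronglyMeasurable w (volume.restrict (Ioo 0 L)) :=
      ((intervalIntegrable_zero_iff hL).1 h.intervalIntegrable).aestronglyMeasurable
    have hg : MemLp (fun s ↦ w s + c s) (ENNReal.ofReal p) (volume.restrict (Ioo 0 L)) := by
      refine ⟨hwm.add hcm.aestronglyMeasurable, ?_⟩
      rw [eLpNorm_lt_top_iff_lintegral_rpow_enorm_lt_top (by simpa using hp0) ENNReal.ofReal_ne_top,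
        ENNReal.toReal_ofReal hp0.le]
      exact hw
    exact (hg.sub hcm).ae_eq (Eventually.of_forall fun s ↦ by simp)

/-! ### Orthogonality relations for a spherical curve of unit speed -/

section Sphere

variable (h : HasSecondDeriv L c v w) (hc : ∀ s ∈ Icc 0 L, ‖c s‖ = 1)
  (hu : HasUnitSpeedOn c (Icc 0 L))
include h

include hL hu in
theorem norm_deriv {t : ℝ} (ht : t ∈ Ioo 0 L) : ‖v t‖ = 1 := by
  refine le_antisymm ?_ (not_lt.1 fun hlt ↦ ?_)
  · refine (h.hasDerivAt ht).le_of_lip' zero_le_one ?_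
    filter_upwards [isOpen_Ioo.mem_nhds ht] with s hs
    rw [one_mul, Real.norm_eq_abs]
    exact norm_sub_le_of_unitSpeed hu s (Ioo_subset_Icc_self hs) t (Ioo_subset_Icc_self ht)
  -- If the speed were below 1 at `t`, then near `t` the curve would be Lipschitz with a constant `r
  -- < 1`, and a short arc would be shorter than its parameter interval.
  · obtain ⟨r, hr1, hr2⟩ := exists_between hlt
    have hcv : ContinuousAt v t := (h.continuousOn hL).continuousAt (Icc_mem_nhds ht.1 ht.2)
    have hev := (hcv.norm.eventually (gt_mem_nhds hr1)).and (isOpen_Ioo.mem_nhds ht)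
    obtain ⟨δ, hδ, hball⟩ := Metric.nhds_basis_closedBall.mem_iff.1 hev
    rw [Real.closedBall_eq_Icc] at hball
    have hr0 : 0 ≤ r := (norm_nonneg _).trans hr1.le
    have hlip : LipschitzOnWith r.toNNReal c (Icc (t - δ) (t + δ)) := by
      refine Convex.lipschitzOnWith_of_nnnorm_hasDerivWithin_le (f' := v) (convex_Icc _ _)
        (fun x hx ↦ (h.hasDerivAt (hball hx).2).hasDerivWithinAt) fun x hx ↦ ?_
      rw [← NNReal.coe_le_coe, coe_nnnorm, Real.coe_toNNReal r hr0]
      exact (hball hx).1.le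
    have hvar := hlip.comp_eVariationOn_le (g := id) (mapsTo_id _)
    rw [Function.comp_id, eVariationOn_id_Icc, eVariationOn_eq_of_unitSpeed hu
      (Ioo_subset_Icc_self (hball ⟨le_rfl, by linarith⟩).2)
      (Ioo_subset_Icc_self (hball ⟨by linarith, le_rfl⟩).2),
      show ((r.toNNReal : NNReal) : ℝ≥0∞) = ENNReal.ofReal r from rfl,
      ← ENNReal.ofReal_mul hr0, ENNReal.ofReal_le_ofReal_iff (by nlinarith)] at hvar
    nlinarith

include hc in
theorem inner_deriv {t : ℝ} (ht : t ∈ Ioo 0 L) : inner ℝ (c t) (v t) = 0 := by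
  have h1 := (h.hasDerivAt ht).inner ℝ (h.hasDerivAt ht)
  have h2 : (fun s ↦ inner ℝ (c s) (c s)) =ᶠ[𝓝 t] fun _ ↦ (1 : ℝ) := by
    filter_upwards [isOpen_Ioo.mem_nhds ht] with s hs
    rw [real_inner_self_eq_norm_sq, hc s (Ioo_subset_Icc_self hs), one_pow]
  have h3 := (h1.congr_of_eventuallyEq h2.symm).unique (hasDerivAt_const t (1 : ℝ))
  rw [real_inner_comm] at h3
  rw [real_inner_comm]
  linarith

include hL hc hu in
-- Differentiate `⟪c, v⟫ = 0` and `⟪v, v⟫ = 1`.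
theorem ae_inner : ∀ᵐ t, t ∈ Ioo 0 L → inner ℝ (c t) (w t) = -1 ∧ inner ℝ (v t) (w t) = 0 := by
  filter_upwards [h.ae_hasDerivAt hL] with t hw ht
  have hw := hw ht
  constructor
  · have h1 := (h.hasDerivAt ht).inner ℝ hw
    have h2 : (fun s ↦ inner ℝ (c s) (v s)) =ᶠ[𝓝 t] fun _ ↦ (0 : ℝ) := by
      filter_upwards [isOpen_Ioo.mem_nhds ht] with s hs using h.inner_deriv hc hs
    have h3 := (h1.congr_of_eventuallyEq h2.symm).unique (hasDerivAt_const t (0 : ℝ))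
    rw [real_inner_self_eq_norm_sq, h.norm_deriv hL hu ht] at h3
    linarith
  · have h1 := hw.inner ℝ hw
    have h2 : (fun s ↦ inner ℝ (v s) (v s)) =ᶠ[𝓝 t] fun _ ↦ (1 : ℝ) := by
      filter_upwards [isOpen_Ioo.mem_nhds ht] with s hs
      rw [real_inner_self_eq_norm_sq, h.norm_deriv hL hu hs, one_pow]
    have h3 := (h1.congr_of_eventuallyEq h2.symm).unique (hasDerivAt_const t (1 : ℝ))
    rw [real_inner_comm] at h3
    rw [real_inner_comm]
    linarith

include hL hc hu in
theorem ae_tangentPart_eq : ∀ᵐ t, t ∈ Ioo 0 L → tangentPart (c t) (w t) = w t + c t := by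
  filter_upwards [h.ae_inner hL hc hu] with t ht htL
  rw [tangentPart, (ht htL).1, neg_one_smul, sub_neg_eq_add]

include hL hc hu in
-- By `ae_inner`, `w + c` is orthogonal to `c` and to `v`, so it is a multiple of the conormal. The
-- Gram determinant gives its length.
theorem ae_enorm_geodCurvature_eq :
    ∀ᵐ t, t ∈ Ioo 0 L → ‖geodCurvature (c t) (v t) (w t)‖ₑ = ‖w t + c t‖ₑ := by
  filter_upwards [h.ae_inner hL hc hu] with t ht htL
  obtain ⟨h1, h2⟩ := ht htL
  have hn : ‖geodCurvature (c t) (v t) (w t)‖ = ‖w t + c t‖ := by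
    rw [← sq_eq_sq₀ (norm_nonneg _) (norm_nonneg _), Real.norm_eq_abs, sq_abs, geodCurvature,
      sq_inner_cross, real_inner_comm (c t) (w t), h.inner_deriv hc htL, h1, h2, norm_add_sq_real,
      real_inner_comm (c t) (w t), h1,
      real_inner_self_eq_norm_sq, real_inner_self_eq_norm_sq, real_inner_self_eq_norm_sq,
      h.norm_deriv hL hu htL, hc t (Ioo_subset_Icc_self htL)]
    ring
  rw [← ofReal_norm, hn, ofReal_norm]

end Sphere

end HasSecondDeriv

/-! ### The energy of an almost straight corner -/

theorem cos_half_ge {l ε : ℝ} (h : l ^ 2 ≤ 4 * ε) (hε : 0 ≤ ε) : 1 - ε ≤ Real.cos (l / 2) := by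
  have := Real.one_sub_sq_div_two_le_cos (x := l / 2)
  have h2 : (l / 2) ^ 2 / 2 = l ^ 2 / 8 := by ring
  linarith

/-- The projection onto the tangent plane as a linear map. -/
noncomputable def tangentMap (x : E3) : E3 →L[ℝ] E3 :=
  ContinuousLinearMap.id ℝ E3 - (innerSL ℝ x).smulRight x

theorem tangentMap_apply (x w : E3) : tangentMap x w = tangentPart x w := by
  simp [tangentMap, tangentPart]

theorem tangentMap_self {x : E3} (hx : ‖x‖ = 1) : tangentMap x x = 0 := by
  rw [tangentMap_apply, tangentPart, real_inner_self_eq_norm_sq, hx]; simp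

theorem norm_tangentMap_le {x : E3} (hx : ‖x‖ = 1) (w : E3) : ‖tangentMap x w‖ ≤ ‖w‖ := by
  rw [tangentMap_apply]; exact norm_tangentPart_le hx w

section Corner

variable {x y z : E3} {ε δ : ℝ}

theorem edge_bounds (hx : ‖x‖ = 1) (hy : ‖y‖ = 1) (hε0 : 0 < ε) (hε : ε ≤ 1 / 10)
    (hδ : 0 < δ) (hδε : δ ^ 2 ≤ ε) (h1 : (1 - ε) * δ ≤ ‖x - y‖) (h2 : ‖x - y‖ ≤ δ) :
    0 < sphDist x y ∧ sphDist x y < Real.pi ∧ 1 - ε ≤ Real.cos (sphDist x y / 2)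
      ∧ (1 - ε) ^ 2 * δ ≤ Real.sin (sphDist x y) ∧ Real.sin (sphDist x y) ≤ δ := by
  have hpos : 0 < ‖x - y‖ := lt_of_lt_of_le (mul_pos (by linarith) hδ) h1
  have hl := sphDist_le_two_mul hx hy
  have hl0 : 0 < sphDist x y := hpos.trans_le (norm_sub_le_sphDist hx hy)
  have hδ1 : δ < 1 := by nlinarith
  have hcos : 1 - ε ≤ Real.cos (sphDist x y / 2) := by
    refine cos_half_ge ?_ hε0.le
    calc sphDist x y ^ 2 ≤ (2 * δ) ^ 2 := by
          refine pow_le_pow_left₀ hl0.le (by linarith) 2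
      _ ≤ 4 * ε := by nlinarith
  have hsin : Real.sin (sphDist x y) = ‖x - y‖ * Real.cos (sphDist x y / 2) := by
    rw [norm_sub_eq_two_mul_sin hx hy, ← Real.sin_two_mul, mul_div_cancel₀ _ (two_ne_zero' ℝ)]
  refine ⟨hl0, by linarith [Real.pi_gt_three], hcos, ?_, ?_⟩
  · rw [hsin]
    calc (1 - ε) ^ 2 * δ = (1 - ε) * δ * (1 - ε) := by ring
      _ ≤ _ := mul_le_mul h1 hcos (by linarith) hpos.le
  · rw [hsin]
    exact (mul_le_of_le_one_right hpos.le (Real.cos_le_one _)).trans h2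

/-- The left side is the length of the component of `s • b + t • a` orthogonal to `a`. -/
theorem mul_sin_turn_le {a b : E3} (ha : ‖a‖ = 1) (hb : ‖b‖ = 1) {s : ℝ} (hs : 0 ≤ s) (t : ℝ) :
    s * Real.sin (turn a b) ≤ ‖s • b + t • a‖ := by
  have h0 : 0 ≤ Real.sin (turn a b) := InnerProductGeometry.sin_angle_nonneg _ _
  rw [← sq_le_sq₀ (mul_nonneg hs h0) (norm_nonneg _), norm_add_sq_real, norm_smul,
    norm_smul, ha, hb, real_inner_smul_left, real_inner_smul_right, real_inner_comm,
    Real.norm_eq_abs, Real.norm_eq_abs, mul_one, mul_one, sq_abs, sq_abs, mul_pow, Real.sin_sq,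
    cos_turn ha hb]
  nlinarith [sq_nonneg (s * inner ℝ a b + t)]

/-- The coefficients `s` and `t` are nearly equal, so a small combination forces `a + b` to be
small, that is, a small turning angle. -/
theorem le_one_add_cos_turn {a b : E3} (ha : ‖a‖ = 1) (hb : ‖b‖ = 1) (hε0 : 0 < ε)
    (hε : ε ≤ 1 / 10) (hδ : 0 < δ) {s t : ℝ} (hs1 : (1 - ε) ^ 2 * δ ≤ s) (hs2 : s ≤ δ)
    (ht1 : (1 - ε) ^ 2 * δ ≤ t) (ht2 : t ≤ δ) (h : ‖s • b + t • a‖ ≤ 2 * ε * δ) :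
    2 * (1 - ε) ≤ 1 + Real.cos (turn a b) := by
  have hs0 : 0 ≤ s := le_trans (by positivity) hs1
  have hsq : (1 - 2 * ε) * δ ≤ (1 - ε) ^ 2 * δ :=
    mul_le_mul_of_nonneg_right (by linarith [sq_nonneg ε, sub_sq 1 ε]) hδ.le
  have h1 : s • (a + b) = (s • b + t • a) + (s - t) • a := by module
  have h3 : |s - t| ≤ 2 * ε * δ := by
    rw [abs_le]
    constructor <;> linarith
  have h2 : s * ‖a + b‖ ≤ 4 * ε * δ := by
    have e : s * ‖a + b‖ = ‖s • (a + b)‖ := by rw [norm_smul, Real.norm_of_nonneg hs0]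
    rw [e, h1]
    refine (norm_add_le _ _).trans ?_
    rw [norm_smul, ha, mul_one, Real.norm_eq_abs]
    linarith
  have h23 : 2 / 3 * δ ≤ s := by
    have : 2 / 3 * δ ≤ (1 - 2 * ε) * δ := mul_le_mul_of_nonneg_right (by linarith) hδ.le
    linarith
  have hab : ‖a + b‖ ≤ 6 * ε := by
    have h5 : 2 / 3 * δ * ‖a + b‖ ≤ 4 * ε * δ :=
      (mul_le_mul_of_nonneg_right h23 (norm_nonneg _)).trans h2
    refine le_of_mul_le_mul_left ?_ hδ
    linarith
  have h6 := norm_add_sq_real a b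
  rw [ha, hb] at h6
  have h7 : ‖a + b‖ ^ 2 ≤ (6 * ε) ^ 2 := pow_le_pow_left₀ (norm_nonneg _) hab 2
  -- Here `ε ≤ 1/9` is needed.
  have h8 : 18 * ε ^ 2 ≤ 2 * ε := by nlinarith
  rw [cos_turn ha hb]
  linarith [mul_pow 6 ε 2]

theorem tan_half_eq {θ : ℝ} (h0 : 0 ≤ θ) (h1 : θ < Real.pi) :
    Real.tan (θ / 2) = Real.sin θ / (1 + Real.cos θ) := by
  have hc : 0 < Real.cos (θ / 2) :=
    Real.cos_pos_of_mem_Ioo ⟨by linarith [Real.pi_pos], by linarith⟩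
  have h1 : Real.sin θ = 2 * Real.sin (θ / 2) * Real.cos (θ / 2) := by
    rw [← Real.sin_two_mul, mul_div_cancel₀ _ (two_ne_zero' ℝ)]
  have h2 : 1 + Real.cos θ = 2 * Real.cos (θ / 2) ^ 2 := by
    rw [Real.cos_sq, mul_div_cancel₀ _ (two_ne_zero' ℝ)]; ring
  rw [h1, h2, Real.tan_eq_sin_div_cos]
  field_simp

/-- The length costs one factor `(1 - ε)⁻¹`. The curvature costs four: two from `hsin`, one from `1
+ cos θ`, one from `sin (l/2)`. This gives the exponent `-(1 + 4 * p)`. -/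
theorem bend_energy_le {p l θ τ : ℝ} (hp : 0 < p) (hε : ε < 1) (hδ : 0 < δ) (hl0 : 0 < l)
    (hlpi : l < Real.pi) (hθ0 : 0 ≤ θ) (hθpi : θ < Real.pi)
    (hlc : 1 - ε ≤ Real.cos (l / 2)) (hl1 : (1 - ε) * δ ≤ 2 * Real.sin (l / 2))
    (hl2 : 2 * Real.sin (l / 2) ≤ δ) (hcos : 2 * (1 - ε) ≤ 1 + Real.cos θ)
    (hsin : (1 - ε) ^ 2 * δ * Real.sin θ ≤ τ) (hτ : 0 ≤ τ) :
    2 * bendHalfLength l θ * (Real.tan (θ / 2) / Real.sin (l / 2)) ^ p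
      ≤ (1 - ε) ^ (-(1 + 4 * p)) * δ ^ (1 - 2 * p) * τ ^ p := by
  have hq : 0 < 1 - ε := by linarith
  have hqδ : 0 < (1 - ε) * δ := mul_pos hq hδ
  have hq2 : 0 < (1 - ε) ^ 2 * δ := by positivity
  have hsin0 : 0 ≤ Real.sin θ := Real.sin_nonneg_of_nonneg_of_le_pi hθ0 hθpi.le
  have hlcpos : 0 < Real.cos (l / 2) := by linarith
  have hlspos : 0 < Real.sin (l / 2) := by linarith
  have hlen : 2 * bendHalfLength l θ ≤ δ / (1 - ε) := by
    have h1 := bendHalfLength_le hl0 hlpi hθ0 hθpi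
    rw [Real.tan_eq_sin_div_cos] at h1
    calc 2 * bendHalfLength l θ ≤ 2 * Real.sin (l / 2) / Real.cos (l / 2) := by
          rw [mul_div_assoc]; linarith
      _ ≤ δ / (1 - ε) := div_le_div₀ hδ.le hl2 hq hlc
  have hcurv0 : 0 ≤ Real.tan (θ / 2) / Real.sin (l / 2) := by
    rw [tan_half_eq hθ0 hθpi]
    exact div_nonneg (div_nonneg hsin0 (by linarith)) hlspos.le
  have hcurv : Real.tan (θ / 2) / Real.sin (l / 2) ≤ τ / ((1 - ε) ^ 4 * δ ^ 2) := by
    have h1 : Real.sin θ ≤ τ / ((1 - ε) ^ 2 * δ) := by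
      rw [le_div_iff₀ hq2, mul_comm]
      exact hsin
    rw [tan_half_eq hθ0 hθpi]
    calc Real.sin θ / (1 + Real.cos θ) / Real.sin (l / 2)
        ≤ τ / ((1 - ε) ^ 2 * δ) / (2 * (1 - ε)) / ((1 - ε) * δ / 2) := by
          refine div_le_div₀ (by positivity) (div_le_div₀ (by positivity) h1 (by linarith) hcos)
            (by linarith) (by linarith)
      _ = τ / ((1 - ε) ^ 4 * δ ^ 2) := by field_simp
  calc 2 * bendHalfLength l θ * (Real.tan (θ / 2) / Real.sin (l / 2)) ^ p
      ≤ δ / (1 - ε) * (τ / ((1 - ε) ^ 4 * δ ^ 2)) ^ p :=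
        mul_le_mul hlen (Real.rpow_le_rpow hcurv0 hcurv hp.le) (Real.rpow_nonneg hcurv0 _)
          (by positivity)
    _ = (1 - ε) ^ (-(1 + 4 * p)) * δ ^ (1 - 2 * p) * τ ^ p := by
        rw [Real.div_rpow hτ (by positivity),
          Real.mul_rpow (by positivity) (by positivity), ← Real.rpow_natCast_mul hq.le,
          ← Real.rpow_natCast_mul hδ.le, Real.rpow_neg hq.le, Real.rpow_add hq, Real.rpow_one,
          Real.rpow_sub hδ, Real.rpow_one]
        push_cast
        field_simp

/-- The tangential part of `y - x` is `sin (sphDist x y)` times the direction of the edge, and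
likewise for `z`. Their sum is the tangential part of the second difference, and its size controls
the sine of the turning angle. -/
theorem corner_energy_le {p : ℝ} (hp : 0 < p) (hx : ‖x‖ = 1) (hy : ‖y‖ = 1) (hz : ‖z‖ = 1)
    (hε0 : 0 < ε) (hε : ε ≤ 1 / 10) (hδ : 0 < δ) (hδε : δ ^ 2 ≤ ε)
    (hy1 : (1 - ε) * δ ≤ ‖x - y‖) (hy2 : ‖x - y‖ ≤ δ)
    (hz1 : (1 - ε) * δ ≤ ‖x - z‖) (hz2 : ‖x - z‖ ≤ δ) (hyz : ‖y + z - (2 : ℝ) • x‖ ≤ 2 * ε * δ) :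
    turn (direction x z) (direction x y) ≠ Real.pi ∧
    2 * bendHalfLength (min (sphDist x z) (sphDist x y)) (turn (direction x z) (direction x y))
      * (Real.tan (turn (direction x z) (direction x y) / 2)
        / Real.sin (min (sphDist x z) (sphDist x y) / 2)) ^ p
      ≤ (1 - ε) ^ (-(1 + 4 * p)) * δ ^ (1 - 2 * p) * ‖tangentMap x (y + z - (2 : ℝ) • x)‖ ^ p := by
  obtain ⟨ly0, lypi, lycos, lys1, lys2⟩ := edge_bounds hx hy hε0 hε hδ hδε hy1 hy2
  obtain ⟨lz0, lzpi, lzcos, lzs1, lzs2⟩ := edge_bounds hx hz hε0 hε hδ hδε hz1 hz2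
  have hb := norm_direction hx hy ly0 lypi
  have ha := norm_direction hx hz lz0 lzpi
  have hq2 : 0 < (1 - ε) ^ 2 * δ := mul_pos (pow_pos (by linarith) 2) hδ
  have hcomb : Real.sin (sphDist x y) • direction x y + Real.sin (sphDist x z) • direction x z
      = tangentMap x (y + z - (2 : ℝ) • x) := by
    rw [map_sub, map_smul, tangentMap_self hx, smul_zero, sub_zero, map_add, tangentMap_apply,
      tangentMap_apply, direction, direction, norm_tangentPart_eq_sin hx hy,
      norm_tangentPart_eq_sin hx hz, smul_smul, smul_smul, mul_inv_cancel₀ (hq2.trans_le lys1).ne',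
      mul_inv_cancel₀ (hq2.trans_le lzs1).ne', one_smul, one_smul]
  have hτ : ‖tangentMap x (y + z - (2 : ℝ) • x)‖ ≤ 2 * ε * δ := (norm_tangentMap_le hx _).trans hyz
  have hcos := le_one_add_cos_turn ha hb hε0 hε hδ lys1 lys2 lzs1 lzs2 (by rwa [hcomb])
  have hsin := mul_sin_turn_le ha hb (hq2.le.trans lys1) (Real.sin (sphDist x z))
  rw [hcomb] at hsin
  have hsin0 : 0 ≤ Real.sin (turn (direction x z) (direction x y)) :=
    InnerProductGeometry.sin_angle_nonneg _ _
  have hθ0 := turn_nonneg (direction x z) (direction x y)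
  have hθ1 := turn_le_pi (direction x z) (direction x y)
  generalize turn (direction x z) (direction x y) = θ at *
  have hθpi : θ ≠ Real.pi := by
    intro h
    rw [h, Real.cos_pi] at hcos
    linarith
  refine ⟨hθpi, ?_⟩
  have hl : 1 - ε ≤ Real.cos (min (sphDist x z) (sphDist x y) / 2)
      ∧ (1 - ε) * δ ≤ 2 * Real.sin (min (sphDist x z) (sphDist x y) / 2)
      ∧ 2 * Real.sin (min (sphDist x z) (sphDist x y) / 2) ≤ δ := by
    rw [norm_sub_eq_two_mul_sin hx hy] at hy1 hy2
    rw [norm_sub_eq_two_mul_sin hx hz] at hz1 hz2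
    rcases min_choice (sphDist x z) (sphDist x y) with h | h
    · rw [h]; exact ⟨lzcos, hz1, hz2⟩
    · rw [h]; exact ⟨lycos, hy1, hy2⟩
  exact bend_energy_le hp (by linarith) hδ (lt_min lz0 ly0) ((min_le_left _ _).trans_lt lzpi) hθ0
    (lt_of_le_of_ne hθ1 hθpi) hl.1 hl.2.1 hl.2.2 hcos
    ((mul_le_mul_of_nonneg_right lys1 hsin0).trans hsin) (norm_nonneg _)

end Corner

/-! ### Second differences -/

theorem rpow_lintegral_le {α : Type*} [MeasurableSpace α] {μ : Measure α} {p : ℝ} (hp : 1 < p)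
    {F : α → ℝ≥0∞} (hF : AEMeasurable F μ) :
    (∫⁻ a, F a ∂μ) ^ p ≤ μ univ ^ (p - 1) * ∫⁻ a, F a ^ p ∂μ := by
  have hp0 : 0 < p := by linarith
  have hpq := Real.HolderConjugate.conjExponent hp
  have h := ENNReal.lintegral_mul_le_Lp_mul_Lq μ hpq hF (aemeasurable_const (b := (1 : ℝ≥0∞)))
  simp only [Pi.mul_apply, mul_one, ENNReal.one_rpow, lintegral_one] at h
  have hq' : 1 / p.conjExponent * p = p - 1 := by
    rw [Real.conjExponent]
    have : p - 1 ≠ 0 := by linarith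
    field_simp
  calc (∫⁻ a, F a ∂μ) ^ p ≤ ((∫⁻ a, F a ^ p ∂μ) ^ (1 / p) * μ univ ^ (1 / p.conjExponent)) ^ p :=
        ENNReal.rpow_le_rpow h hp0.le
    _ = _ := by
        rw [ENNReal.mul_rpow_of_nonneg _ _ hp0.le, ← ENNReal.rpow_mul, ← ENNReal.rpow_mul, hq',
          one_div, inv_mul_cancel₀ hp0.ne', ENNReal.rpow_one, mul_comm]

/-- Only superadditivity of the lower integral is used, so no measurability is required. -/
theorem sum_lintegral_le {α ι : Type*} [MeasurableSpace α] {μ : Measure α} (s : Finset ι)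
    (f : ι → α → ℝ≥0∞) : ∑ i ∈ s, ∫⁻ a, f i a ∂μ ≤ ∫⁻ a, ∑ i ∈ s, f i a ∂μ := by
  classical
  induction s using Finset.induction_on with
  | empty => simp
  | insert i s hi ih =>
    simp only [Finset.sum_insert hi]
    exact (add_le_add_right ih _).trans (le_lintegral_add _ _)

namespace HasSecondDeriv

variable {L : ℝ} {c v w : ℝ → E3} (hL : 0 < L) (h : HasSecondDeriv L c v w)
  (hc : ∀ s ∈ Icc 0 L, ‖c s‖ = 1)
  (hlip : ∀ s ∈ Icc 0 L, ∀ t ∈ Icc 0 L, ‖c s - c t‖ ≤ |s - t|)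
include hL h

omit hL in
theorem sub_eq_integral {a b : ℝ} (ha : a ∈ Icc 0 L) (hb : b ∈ Icc 0 L) :
    v b - v a = ∫ s in a..b, w s := by
  rw [h.eq_add_integral a ha, h.eq_add_integral b hb, add_sub_add_left_eq_sub,
    intervalIntegral.integral_interval_sub_left (intervalIntegrable_of_mem_Icc h.intervalIntegrable hb)
      (intervalIntegrable_of_mem_Icc h.intervalIntegrable ha)]

theorem curve_sub_eq_integral {a b : ℝ} (ha : 0 ≤ a) (hab : a ≤ b) (hb : b ≤ L) :
    c b - c a = ∫ s in a..b, v s := by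
  rw [intervalIntegral.integral_eq_sub_of_hasDerivAt_of_le hab
    (h.continuousOn_curve.mono (Icc_subset_Icc ha hb))
    (fun s hs ↦ h.hasDerivAt ⟨ha.trans_lt hs.1, hs.2.trans_le hb⟩)]
  exact ContinuousOn.intervalIntegrable (by
    rw [uIcc_of_le hab]; exact (h.continuousOn hL).mono (Icc_subset_Icc ha hb))

theorem second_difference {t δ : ℝ} (hδ : 0 < δ) (ht0 : 0 ≤ t - δ) (htL : t + δ ≤ L) :
    c (t + δ) + c (t - δ) - (2 : ℝ) • c t
      = ∫ s in (0 : ℝ)..δ, (v (t + s) - v (t - δ + s)) := by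
  have hv := h.continuousOn hL
  have hi : ∀ a, 0 ≤ a → a + δ ≤ L → IntervalIntegrable (fun s ↦ v (a + s)) volume 0 δ := by
    intro a ha haL
    refine ContinuousOn.intervalIntegrable ?_
    rw [uIcc_of_le hδ.le]
    refine hv.comp (by fun_prop) fun s hs ↦ ⟨by linarith [hs.1], by linarith [hs.2]⟩
  rw [intervalIntegral.integral_sub (hi t (by linarith) htL) (hi (t - δ) ht0 (by linarith)),
    intervalIntegral.integral_comp_add_left (fun s ↦ v s),
    intervalIntegral.integral_comp_add_left (fun s ↦ v s), add_zero, add_zero, sub_add_cancel,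
    ← h.curve_sub_eq_integral hL (by linarith) (by linarith) htL,
    ← h.curve_sub_eq_integral hL ht0 (by linarith) (by linarith)]
  module

include hc hlip

/-- The projection at `c t` annihilates `c t`, so `w r` may be replaced by `w r + c r` with error at
most `‖c r - c t‖ ≤ δ`. This is how the tangential part of the acceleration enters. -/
theorem enorm_tangentMap_sub_le {t δ a b : ℝ} (ht : t ∈ Icc 0 L)
    (ha : 0 ≤ a) (hab : a ≤ b) (hb : b ≤ L) (ha' : t - δ ≤ a) (hb' : b ≤ t + δ) :
    ‖tangentMap (c t) (v b - v a)‖ₑ ≤ ∫⁻ r in Ioc a b, (‖w r + c r‖ₑ + ENNReal.ofReal δ) := by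
  have hx := hc t ht
  have haI : a ∈ Icc 0 L := ⟨ha, hab.trans hb⟩
  have hbI : b ∈ Icc 0 L := ⟨ha.trans hab, hb⟩
  rw [h.sub_eq_integral haI hbI, ← ContinuousLinearMap.intervalIntegral_comp_comm _
    (h.intervalIntegrable.mono_set (by
      rw [uIcc_of_le hab, uIcc_of_le hL.le]; exact Icc_subset_Icc ha hb)),
    intervalIntegral.integral_of_le hab]
  refine (enorm_integral_le_lintegral_enorm _).trans ?_
  refine setLIntegral_mono' measurableSet_Ioc fun r hr ↦ ?_
  have h1 : tangentMap (c t) (w r)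
      = tangentMap (c t) (w r + c r) - tangentMap (c t) (c r - c t) := by
    rw [map_add, map_sub, tangentMap_self hx]; abel
  have h2 : ‖tangentMap (c t) (w r)‖ ≤ ‖w r + c r‖ + δ := by
    rw [h1]
    refine (norm_sub_le _ _).trans (add_le_add (norm_tangentMap_le hx _)
      ((norm_tangentMap_le hx _).trans ((hlip r ⟨ha.trans hr.1.le, hr.2.trans hb⟩ t ht).trans ?_)))
    rw [abs_le]
    constructor <;> linarith [hr.1, hr.2]
  have hδ : 0 ≤ δ := by linarith [hr.1, hr.2]
  rw [← ofReal_norm, ← ofReal_norm, ← ENNReal.ofReal_add (norm_nonneg _) hδ]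
  exact ENNReal.ofReal_le_ofReal h2

/-- Jensen's inequality in each of the two integrations over intervals of length `δ`. -/
theorem rpow_second_difference_le {p t δ : ℝ} (hp : 1 < p) (hδ : 0 < δ) (ht0 : 0 ≤ t - δ)
    (htL : t + δ ≤ L) :
    ‖tangentMap (c t) (c (t + δ) + c (t - δ) - (2 : ℝ) • c t)‖ₑ ^ p
      ≤ ENNReal.ofReal δ ^ (p - 1) * ∫⁻ s in Ioc 0 δ, ENNReal.ofReal δ ^ (p - 1)
        * ∫⁻ r in Ioc (t - δ + s) (t + s), (‖w r + c r‖ₑ + ENNReal.ofReal δ) ^ p := by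
  have hp0 : 0 < p := by linarith
  have hv := h.continuousOn hL
  have ht : t ∈ Icc 0 L := ⟨by linarith, by linarith⟩
  have hF : ContinuousOn (fun s ↦ v (t + s) - v (t - δ + s)) (Icc 0 δ) := by
    refine ContinuousOn.sub (hv.comp (by fun_prop) fun s hs ↦ ?_) (hv.comp (by fun_prop) fun s hs ↦ ?_)
    · exact ⟨by linarith [hs.1], by linarith [hs.2]⟩
    · exact ⟨by linarith [hs.1], by linarith [hs.2]⟩
  have hFm : AEMeasurable (fun s ↦ ‖tangentMap (c t) (v (t + s) - v (t - δ + s))‖ₑ)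
      (volume.restrict (Ioc 0 δ)) :=
    (ContinuousOn.aestronglyMeasurable ((tangentMap (c t)).continuous.comp_continuousOn
      (hF.mono (Ioc_subset_Icc_self : Ioc (0 : ℝ) δ ⊆ Icc 0 δ))) measurableSet_Ioc).enorm
  have hwc : AEMeasurable (fun r ↦ ‖w r + c r‖ₑ + ENNReal.ofReal δ) (volume.restrict (Ioc 0 L)) := by
    refine AEMeasurable.add_const ?_ _
    refine (AEStronglyMeasurable.add h.intervalIntegrable.1.aestronglyMeasurable
      (ContinuousOn.aestronglyMeasurable (h.continuousOn_curve.mono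
        (Ioc_subset_Icc_self : Ioc (0 : ℝ) L ⊆ Icc 0 L)) measurableSet_Ioc)).enorm
  have h1 : ‖tangentMap (c t) (c (t + δ) + c (t - δ) - (2 : ℝ) • c t)‖ₑ
      ≤ ∫⁻ s in Ioc 0 δ, ‖tangentMap (c t) (v (t + s) - v (t - δ + s))‖ₑ := by
    have hFi : IntervalIntegrable (fun s ↦ v (t + s) - v (t - δ + s)) volume 0 δ :=
      ContinuousOn.intervalIntegrable (by rwa [uIcc_of_le hδ.le])
    rw [h.second_difference hL hδ ht0 htL, ← ContinuousLinearMap.intervalIntegral_comp_comm _ hFi,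
      intervalIntegral.integral_of_le hδ.le]
    exact enorm_integral_le_lintegral_enorm _
  refine (ENNReal.rpow_le_rpow h1 hp0.le).trans ((rpow_lintegral_le hp hFm).trans ?_)
  rw [Measure.restrict_apply_univ, Real.volume_Ioc, sub_zero]
  refine mul_le_mul' le_rfl (setLIntegral_mono' measurableSet_Ioc fun s hs ↦ ?_)
  have h2 := h.enorm_tangentMap_sub_le hL hc hlip (δ := δ) (a := t - δ + s) (b := t + s) ht
    (by linarith [hs.1]) (by linarith) (by linarith [hs.2]) (by linarith [hs.1])
    (by linarith [hs.2])
  refine (ENNReal.rpow_le_rpow h2 hp0.le).trans ((rpow_lintegral_le hp (hwc.mono_measure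
    (Measure.restrict_mono (Ioc_subset_Ioc (by linarith [hs.1]) (by linarith [hs.2]))
      le_rfl))).trans ?_)
  rw [Measure.restrict_apply_univ, Real.volume_Ioc,
    show t + s - (t - δ + s) = δ by ring]

theorem sum_rpow_second_difference_le {p δ : ℝ} (hp : 1 < p) (hδ : 0 < δ) {N : ℕ}
    (hN : N * δ = L) :
    ∑ i ∈ Finset.Ico 1 N,
      ‖tangentMap (c (i * δ)) (c (i * δ + δ) + c (i * δ - δ) - (2 : ℝ) • c (i * δ))‖ₑ ^ p
      ≤ ENNReal.ofReal δ ^ (2 * p - 1)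
        * ∫⁻ r in Ioc 0 L, (‖w r + c r‖ₑ + ENNReal.ofReal δ) ^ p := by
  have hδ' : ENNReal.ofReal δ ≠ 0 := by simpa using hδ
  set J := ∫⁻ r in Ioc 0 L, (‖w r + c r‖ₑ + ENNReal.ofReal δ) ^ p with hJ
  have h1 : ∀ i ∈ Finset.Ico 1 N,
      ‖tangentMap (c (i * δ)) (c (i * δ + δ) + c (i * δ - δ) - (2 : ℝ) • c (i * δ))‖ₑ ^ p
      ≤ ENNReal.ofReal δ ^ (p - 1) * ∫⁻ s in Ioc 0 δ, ENNReal.ofReal δ ^ (p - 1)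
        * ∫⁻ r in Ioc (i * δ - δ + s) (i * δ + s), (‖w r + c r‖ₑ + ENNReal.ofReal δ) ^ p := by
    intro i hi
    obtain ⟨hi1, hi2⟩ := Finset.mem_Ico.1 hi
    have e1 : (1 : ℝ) ≤ i := by exact_mod_cast hi1
    have e2 : (i : ℝ) + 1 ≤ N := by exact_mod_cast hi2
    exact h.rpow_second_difference_le hL hc hlip hp hδ (by nlinarith) (by nlinarith)
  refine (Finset.sum_le_sum h1).trans ?_
  rw [← Finset.mul_sum]
  calc _ ≤ ENNReal.ofReal δ ^ (p - 1) * ∫⁻ s in Ioc 0 δ, ENNReal.ofReal δ ^ (p - 1) * J := by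
        gcongr
        refine (sum_lintegral_le _ _).trans (setLIntegral_mono' measurableSet_Ioc fun s hs ↦ ?_)
        rw [← Finset.mul_sum]
        gcongr
        rw [← lintegral_biUnion_finset]
        · refine lintegral_mono_set (iUnion₂_subset fun i hi ↦ ?_)
          obtain ⟨hi1, hi2⟩ := Finset.mem_Ico.1 hi
          have e1 : (1 : ℝ) ≤ i := by exact_mod_cast hi1
          have e2 : (i : ℝ) + 1 ≤ N := by exact_mod_cast hi2
          exact Ioc_subset_Ioc (by nlinarith [hs.1]) (by nlinarith [hs.2])
        -- For fixed `s` the windows `(i δ - δ + s, i δ + s]` are consecutive, hence disjoint. The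
        -- integral over `s` then contributes only a factor `δ`.
        · have hm : Monotone fun j : ℕ ↦ (j : ℝ) * δ - δ + s := fun i j hij ↦ by
            simp only; gcongr
          have := (hm.pairwise_disjoint_on_Ioc_succ).set_pairwise (Finset.Ico 1 N : Set ℕ)
          refine this.mono' ?_
          intro i j hij
          have e : ∀ k : ℕ, ((Order.succ k : ℕ) : ℝ) * δ - δ + s = k * δ + s := fun k ↦ by
            rw [Order.succ_eq_add_one]; push_cast; ring
          simpa only [Function.onFun, e] using hij
        · exact fun _ _ ↦ measurableSet_Ioc
    _ = _ := by
        rw [lintegral_const, Measure.restrict_apply_univ, Real.volume_Ioc, sub_zero,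
          show 2 * p - 1 = (p - 1) + (p - 1) + 1 by ring,
          ENNReal.rpow_add _ _ hδ' ENNReal.ofReal_ne_top,
          ENNReal.rpow_add _ _ hδ' ENNReal.ofReal_ne_top, ENNReal.rpow_one]
        ring

end HasSecondDeriv

/-! ### The upper bound -/

namespace HasSecondDeriv

variable {L : ℝ} {c v w : ℝ → E3} (hL : 0 < L) (h : HasSecondDeriv L c v w)
  (hc : ∀ s ∈ Icc 0 L, ‖c s‖ = 1)
include hL h

theorem norm_deriv_of_mem_Icc (hu : HasUnitSpeedOn c (Icc 0 L)) {t : ℝ} (ht : t ∈ Icc 0 L) :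
    ‖v t‖ = 1 := by
  have h1 : EqOn (fun s ↦ ‖v s‖) (fun _ ↦ 1) (Ioo 0 L) := fun s hs ↦ h.norm_deriv hL hu hs
  exact h1.of_subset_closure (h.continuousOn hL).norm continuousOn_const Ioo_subset_Icc_self
    (by rw [closure_Ioo hL.ne]) ht

theorem exists_pos_norm_sub_le {ε : ℝ} (hε : 0 < ε) :
    ∃ δ > 0, ∀ s ∈ Icc 0 L, ∀ t ∈ Icc 0 L, |s - t| ≤ δ → ‖v s - v t‖ ≤ ε := by
  have hu := isCompact_Icc.uniformContinuousOn_of_continuous (h.continuousOn hL)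
  obtain ⟨δ, hδ, h1⟩ := Metric.uniformContinuousOn_iff_le.1 hu ε hε
  exact ⟨δ, hδ, fun s hs t ht hst ↦ by
    simpa [dist_eq_norm] using h1 s hs t ht (by rwa [Real.dist_eq])⟩

theorem norm_curve_sub_sub_le {a b r ε : ℝ} (ha : 0 ≤ a) (hab : a ≤ b) (hb : b ≤ L)
    (hε : ∀ s ∈ Icc a b, ‖v s - v r‖ ≤ ε) :
    ‖c b - c a - (b - a) • v r‖ ≤ ε * (b - a) := by
  have hi : IntervalIntegrable v volume a b := ContinuousOn.intervalIntegrable (by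
    rw [uIcc_of_le hab]; exact (h.continuousOn hL).mono (Icc_subset_Icc ha hb))
  have h1 : c b - c a - (b - a) • v r = ∫ s in a..b, (v s - v r) := by
    rw [intervalIntegral.integral_sub hi intervalIntegrable_const,
      h.curve_sub_eq_integral hL ha hab hb, intervalIntegral.integral_const]
  rw [h1, ← abs_of_nonneg (sub_nonneg.2 hab)]
  refine intervalIntegral.norm_integral_le_of_norm_le_const fun s hs ↦ hε s ?_
  rw [uIoc_of_le hab] at hs
  exact Ioc_subset_Icc_self hs

variable (hu : HasUnitSpeedOn c (Icc 0 L))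
include hu

theorem le_norm_curve_sub {a b ε : ℝ} (ha : 0 ≤ a) (hab : a ≤ b) (hb : b ≤ L)
    (hε : ∀ s ∈ Icc a b, ‖v s - v a‖ ≤ ε) : (1 - ε) * (b - a) ≤ ‖c b - c a‖ := by
  have h1 := h.norm_curve_sub_sub_le hL ha hab hb hε
  have h2 := norm_sub_norm_le ((b - a) • v a) (c b - c a)
  rw [norm_smul, h.norm_deriv_of_mem_Icc hL hu ⟨ha, hab.trans hb⟩, mul_one,
    Real.norm_of_nonneg (sub_nonneg.2 hab), norm_sub_rev ((b - a) • v a)] at h2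
  linarith

omit hu in
theorem norm_second_difference_le {t δ ε : ℝ} (hδ : 0 < δ) (ht0 : 0 ≤ t - δ) (htL : t + δ ≤ L)
    (hε : ∀ s ∈ Icc (t - δ) (t + δ), ‖v s - v t‖ ≤ ε) :
    ‖c (t + δ) + c (t - δ) - (2 : ℝ) • c t‖ ≤ 2 * ε * δ := by
  have h1 := h.norm_curve_sub_sub_le hL (a := t) (b := t + δ) (r := t) (ε := ε) (by linarith)
    (by linarith) htL fun s hs ↦ hε s ⟨by linarith [hs.1], hs.2⟩
  have h2 := h.norm_curve_sub_sub_le hL (a := t - δ) (b := t) (r := t) (ε := ε) ht0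
    (by linarith) (by linarith) fun s hs ↦ hε s ⟨hs.1, by linarith [hs.2]⟩
  have h3 : c (t + δ) + c (t - δ) - (2 : ℝ) • c t = (c (t + δ) - c t - (t + δ - t) • v t)
      - (c t - c (t - δ) - (t - (t - δ)) • v t) := by module
  rw [h3]
  refine (norm_sub_le _ _).trans ?_
  linarith

include hc

/-- Polygonals with equidistant vertices. -/
theorem exists_inscribedPolygonal {p ε : ℝ} (hp : 1 < p) (hε0 : 0 < ε) (hε : ε ≤ 1 / 10) :
    ∃ δ₀ > 0, ∀ (N : ℕ) (δ : ℝ), 0 < δ → δ ≤ δ₀ → N * δ = L →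
      ∃ P : InscribedPolygonal L c, 0 ≤ P.modulus ∧ P.modulus ≤ 2 * δ ∧
        P.pRotation p ≤ ENNReal.ofReal ((1 - ε) ^ (-(1 + 4 * p)))
          * ∫⁻ r in Ioc 0 L, (‖w r + c r‖ₑ + ENNReal.ofReal δ) ^ p := by
  have hp0 : 0 < p := by linarith
  have hlip := norm_sub_le_of_unitSpeed hu
  obtain ⟨δ₁, hδ₁, hv⟩ := h.exists_pos_norm_sub_le hL hε0
  -- The first bound makes the velocity vary by at most `ε` over one step. The second gives `δ² ≤
  -- ε`, which controls the cosines of the half edges.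
  refine ⟨min δ₁ (√ε), lt_min hδ₁ (Real.sqrt_pos.2 hε0), fun N δ hδ hδ₀ hN ↦ ?_⟩
  have hδv : δ ≤ δ₁ := hδ₀.trans (min_le_left _ _)
  have hδε : δ ^ 2 ≤ ε := (Real.le_sqrt hδ.le hε0.le).1 (hδ₀.trans (min_le_right _ _))
  have hmem : ∀ i ≤ N, (i : ℝ) * δ ∈ Icc 0 L := fun i hi ↦
    ⟨by positivity, by rw [← hN]; gcongr⟩
  have hsucc : ∀ i : ℕ, ((i + 1 : ℕ) : ℝ) * δ = i * δ + δ := fun i ↦ by push_cast; ring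
  have hchord : ∀ i < N, (1 - ε) * δ ≤ ‖c (i * δ) - c (i * δ + δ)‖
      ∧ ‖c (i * δ) - c (i * δ + δ)‖ ≤ δ := by
    intro i hi
    have h0 := hmem i hi.le
    have h1 := hmem (i + 1) hi
    rw [hsucc] at h1
    constructor
    · have := h.le_norm_curve_sub hL hu h0.1 (by linarith : (i : ℝ) * δ ≤ i * δ + δ) h1.2
        (ε := ε) fun s hs ↦ hv s ⟨h0.1.trans hs.1, hs.2.trans h1.2⟩ _ h0 (by
          rw [abs_of_nonneg] <;> linarith [hs.1, hs.2])
      rwa [add_sub_cancel_left, norm_sub_rev] at this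
    · simpa [abs_of_pos hδ] using hlip _ h0 _ h1
  have hedge : ∀ i < N, 0 < sphDist (c (i * δ)) (c ((i + 1 : ℕ) * δ))
      ∧ sphDist (c (i * δ)) (c ((i + 1 : ℕ) * δ)) < Real.pi := by
    intro i hi
    have h1 := hmem (i + 1) hi
    rw [hsucc] at h1 ⊢
    have := edge_bounds (hc _ (hmem i hi.le)) (hc _ h1) hε0 hε hδ hδε (hchord i hi).1 (hchord i hi).2
    exact ⟨this.1, this.2.1⟩
  let P : InscribedPolygonal L c :=
    { n := N
      t := fun i ↦ i * δ
      t_zero := by simp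
      t_last := hN
      t_lt := fun i _ ↦ by simp only [hsucc]; linarith
      edge_pos := fun i hi ↦ (hedge i hi).1
      edge_lt_pi := fun i hi ↦ (hedge i hi).2 }
  refine ⟨P, Real.sSup_nonneg ?_, Real.sSup_le ?_ (by linarith), ?_⟩
  · rintro r ⟨i, -, x, -, y, -, rfl⟩
    exact sphDist_nonneg _ _
  · rintro r ⟨i, hi, x, hx, y, hy, rfl⟩
    have h0 : (i : ℝ) * δ ∈ Icc 0 L := hmem i (le_of_lt hi)
    have h1 := hmem (i + 1) hi
    have hx' : (i : ℝ) * δ ≤ x ∧ x ≤ (i + 1 : ℕ) * δ := hx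
    have hy' : (i : ℝ) * δ ≤ y ∧ y ≤ (i + 1 : ℕ) * δ := hy
    have hxI : x ∈ Icc 0 L := ⟨h0.1.trans hx'.1, hx'.2.trans h1.2⟩
    have hyI : y ∈ Icc 0 L := ⟨h0.1.trans hy'.1, hy'.2.trans h1.2⟩
    have h2 : |x - y| ≤ δ := by
      rw [hsucc] at hx' hy'
      rw [abs_le]; constructor <;> linarith
    have h3 := sphDist_le_two_mul (hc x hxI) (hc y hyI)
    have h4 := hlip x hxI y hyI
    linarith
  have hcorner : ∀ i ∈ Finset.Ico 1 N, P.turnAngle i ≠ Real.pi ∧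
      2 * bendHalfLength (P.cornerLength i) (P.turnAngle i)
        * (Real.tan (P.turnAngle i / 2) / Real.sin (P.cornerLength i / 2)) ^ p
      ≤ (1 - ε) ^ (-(1 + 4 * p)) * δ ^ (1 - 2 * p)
        * ‖tangentMap (c (i * δ)) (c (i * δ + δ) + c (i * δ - δ) - (2 : ℝ) • c (i * δ))‖ ^ p := by
    intro i hi
    obtain ⟨hi1, hi2⟩ := Finset.mem_Ico.1 hi
    obtain ⟨j, rfl⟩ : ∃ j, i = j + 1 := ⟨i - 1, by omega⟩
    have hj : ((j + 1 : ℕ) : ℝ) * δ - δ = j * δ := by rw [hsucc]; ring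
    have m0 := hmem j (by omega)
    have m1 := hmem (j + 1) hi2.le
    have m2 := hmem (j + 1 + 1) hi2
    have k0 := hchord j (by omega)
    have k1 := hchord (j + 1) hi2
    rw [← hsucc, norm_sub_rev] at k0
    rw [hsucc] at m2
    have hd : ‖c ((j + 1 : ℕ) * δ + δ) + c (j * δ) - (2 : ℝ) • c ((j + 1 : ℕ) * δ)‖
        ≤ 2 * ε * δ := by
      have := h.norm_second_difference_le hL hδ (by rw [hj]; exact m0.1) m2.2 (ε := ε)
        fun s hs ↦ hv s ⟨by rw [hj] at hs; exact m0.1.trans hs.1, hs.2.trans m2.2⟩ _ m1 (by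
          rw [abs_le]; constructor <;> linarith [hs.1, hs.2])
      rwa [hj] at this
    have := corner_energy_le hp0 (hc _ m1) (hc _ m2) (hc _ m0) hε0 hε hδ hδε k1.1 k1.2 k0.1 k0.2 hd
    have e1 : P.vertex (j + 1) = c ((j + 1 : ℕ) * δ) := rfl
    have e0 : P.vertex j = c (j * δ) := rfl
    have e2 : P.vertex (j + 1 + 1) = c ((j + 1 : ℕ) * δ + δ) := by
      rw [← hsucc]; rfl
    rw [hj, InscribedPolygonal.turnAngle, InscribedPolygonal.cornerLength,
      InscribedPolygonal.dirPrev, InscribedPolygonal.dirNext, InscribedPolygonal.edgeLength,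
      InscribedPolygonal.edgeLength, Nat.add_sub_cancel, sphDist_comm (P.vertex j), e0, e1, e2]
    exact this
  rw [P.pRotation_eq hc hp0 fun i hi ↦ (hcorner i hi).1]
  have hq : 0 < 1 - ε := by linarith
  calc _ ≤ ∑ i ∈ Finset.Ico 1 N, ENNReal.ofReal ((1 - ε) ^ (-(1 + 4 * p)))
        * (ENNReal.ofReal δ ^ (1 - 2 * p)
        * ‖tangentMap (c (i * δ))
          (c (i * δ + δ) + c (i * δ - δ) - (2 : ℝ) • c (i * δ))‖ₑ ^ p) := by
        refine Finset.sum_le_sum fun i hi ↦ (ENNReal.ofReal_le_ofReal (hcorner i hi).2).trans ?_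
        rw [mul_assoc, ENNReal.ofReal_mul (by positivity), ENNReal.ofReal_mul (by positivity),
          ← ENNReal.ofReal_rpow_of_pos hδ, ← ENNReal.ofReal_rpow_of_nonneg (norm_nonneg _) hp0.le,
          ofReal_norm]
    _ ≤ ENNReal.ofReal ((1 - ε) ^ (-(1 + 4 * p))) * (ENNReal.ofReal δ ^ (1 - 2 * p)
        * (ENNReal.ofReal δ ^ (2 * p - 1)
          * ∫⁻ r in Ioc 0 L, (‖w r + c r‖ₑ + ENNReal.ofReal δ) ^ p)) := by
        rw [← Finset.mul_sum, ← Finset.mul_sum]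
        exact mul_le_mul' le_rfl (mul_le_mul' le_rfl
          (h.sum_rpow_second_difference_le hL hc hlip hp hδ hN))
    _ = _ := by
        rw [← mul_assoc (_ ^ _), ← ENNReal.rpow_add _ _ (by simpa using hδ) ENNReal.ofReal_ne_top,
          show 1 - 2 * p + (2 * p - 1) = 0 by ring, ENNReal.rpow_zero, one_mul]

omit hc hu in
-- Dominated convergence. The dominating function comes from the convexity inequality `(x + y)^p ≤
-- 2^(p-1) (x^p + y^p)`.
theorem tendsto_lintegral_add_rpow {p : ℝ} (hp : 1 < p)
    (hfin : ∫⁻ s in Ioc 0 L, ‖w s + c s‖ₑ ^ p ≠ ⊤) {δ : ℕ → ℝ} (hδ : Tendsto δ atTop (𝓝 0))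
    (hδ1 : ∀ n, δ n ≤ L) :
    Tendsto (fun n ↦ ∫⁻ s in Ioc 0 L, (‖w s + c s‖ₑ + ENNReal.ofReal (δ n)) ^ p) atTop
      (𝓝 (∫⁻ s in Ioc 0 L, ‖w s + c s‖ₑ ^ p)) := by
  have hp0 : 0 < p := by linarith
  have hm : AEMeasurable (fun r ↦ ‖w r + c r‖ₑ) (volume.restrict (Ioc 0 L)) :=
    (AEStronglyMeasurable.add h.intervalIntegrable.1.aestronglyMeasurable
      (ContinuousOn.aestronglyMeasurable (h.continuousOn_curve.mono
        (Ioc_subset_Icc_self : Ioc (0 : ℝ) L ⊆ Icc 0 L)) measurableSet_Ioc)).enorm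
  refine tendsto_lintegral_of_dominated_convergence' (fun s ↦ 2 ^ (p - 1) *
    (‖w s + c s‖ₑ ^ p + ENNReal.ofReal L ^ p)) (fun n ↦ (hm.add_const _).pow_const _) (fun n ↦ ?_) ?_
    ?_
  · refine Eventually.of_forall fun s ↦ ?_
    refine (ENNReal.rpow_le_rpow (add_le_add_right (ENNReal.ofReal_le_ofReal (hδ1 n)) _)
      hp0.le).trans ?_
    exact ENNReal.rpow_add_le_mul_rpow_add_rpow _ _ hp.le
  · rw [lintegral_const_mul' _ _ (by finiteness), lintegral_add_right _ measurable_const,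
      lintegral_const, Measure.restrict_apply_univ, Real.volume_Ioc]
    finiteness
  · refine Eventually.of_forall fun s ↦ ?_
    have h1 := (ENNReal.continuous_ofReal.tendsto 0).comp hδ
    rw [ENNReal.ofReal_zero] at h1
    have h2 := (h1.const_add ‖w s + c s‖ₑ).ennrpow_const p
    simpa using h2

/-- For fixed `ε` the number of vertices tends to infinity and gives the bound with the factor `(1 -
ε)^(-(1 + 4 * p))`. Then `ε` tends to zero. -/
theorem pCurvature_le {p : ℝ} (hp : 1 < p) :
    pCurvature p L c ≤ ∫⁻ s in Ioo 0 L, ‖w s + c s‖ₑ ^ p := by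
  rw [restrict_Ioo_eq_restrict_Ioc]
  by_cases hfin : ∫⁻ s in Ioc 0 L, ‖w s + c s‖ₑ ^ p = ⊤
  · rw [hfin]; exact le_top
  have key : ∀ ε : ℝ, 0 < ε → ε ≤ 1 / 10 → pCurvature p L c
      ≤ ENNReal.ofReal ((1 - ε) ^ (-(1 + 4 * p))) * ∫⁻ s in Ioc 0 L, ‖w s + c s‖ₑ ^ p := by
    intro ε hε0 hε
    obtain ⟨δ₀, hδ₀, hP⟩ := h.exists_inscribedPolygonal hL hc hu hp hε0 hε
    obtain ⟨N₀, hN₀⟩ := exists_nat_gt (L / δ₀)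
    have hpos : ∀ n : ℕ, (0 : ℝ) < (N₀ + n + 1 : ℕ) := fun n ↦ by positivity
    have hδle : ∀ n : ℕ, L / (N₀ + n + 1 : ℕ) ≤ δ₀ := fun n ↦ by
      rw [div_le_iff₀ (hpos n)]
      rw [div_lt_iff₀ hδ₀] at hN₀
      push_cast
      nlinarith [(Nat.cast_nonneg n : (0 : ℝ) ≤ n)]
    choose P hP0 hP1 hP2 using fun n : ℕ ↦ hP (N₀ + n + 1) (L / (N₀ + n + 1 : ℕ))
      (div_pos hL (hpos n)) (hδle n) (mul_div_cancel₀ _ (hpos n).ne')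
    have hδ : Tendsto (fun n : ℕ ↦ L / ((N₀ + n + 1 : ℕ) : ℝ)) atTop (𝓝 0) := by
      refine tendsto_const_nhds.div_atTop (tendsto_natCast_atTop_atTop.comp ?_)
      exact tendsto_atTop_mono (fun n ↦ (by omega : n ≤ N₀ + n + 1)) tendsto_id
    have hmod : Tendsto (fun n ↦ (P n).modulus) atTop (𝓝 0) :=
      squeeze_zero hP0 hP1 (by simpa using hδ.const_mul 2)
    have hδL : ∀ n : ℕ, L / ((N₀ + n + 1 : ℕ) : ℝ) ≤ L := fun n ↦
      div_le_self hL.le (by exact_mod_cast Nat.le_add_left 1 _)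
    have hlim := ENNReal.Tendsto.const_mul (a := ENNReal.ofReal ((1 - ε) ^ (-(1 + 4 * p))))
      (h.tendsto_lintegral_add_rpow hL hp hfin hδ hδL) (Or.inr ENNReal.ofReal_ne_top)
    calc pCurvature p L c ≤ liminf (fun n ↦ (P n).pRotation p) atTop := iInf₂_le P hmod
      _ ≤ _ := liminf_le_liminf (Eventually.of_forall hP2)
      _ = _ := hlim.liminf_eq
  have hcont : Tendsto (fun ε : ℝ ↦ ENNReal.ofReal ((1 - ε) ^ (-(1 + 4 * p)))
      * ∫⁻ s in Ioc 0 L, ‖w s + c s‖ₑ ^ p) (𝓝[>] 0) (𝓝 (∫⁻ s in Ioc 0 L, ‖w s + c s‖ₑ ^ p)) := by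
    have h1 : ContinuousAt (fun ε : ℝ ↦ (1 - ε) ^ (-(1 + 4 * p))) 0 :=
      ContinuousAt.rpow_const (by fun_prop) (Or.inl (by norm_num))
    have h2 := (ENNReal.continuous_ofReal.tendsto _).comp
      (h1.tendsto.mono_left (nhdsWithin_le_nhds (s := Ioi 0)))
    have h3 := ENNReal.Tendsto.mul_const (b := ∫⁻ s in Ioc 0 L, ‖w s + c s‖ₑ ^ p) h2
      (Or.inr hfin)
    simpa using h3
  refine ge_of_tendsto hcont ?_
  filter_upwards [Ioc_mem_nhdsGT (show (0 : ℝ) < 1 / 10 by norm_num)] with ε hε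
  exact key ε hε.1 hε.2

end HasSecondDeriv

namespace HasSecondDeriv

variable {L p : ℝ} {c v w : ℝ → E3}

/-- For the lower bound, each finite `M` above the relaxed energy yields some second derivative with
energy at most `M`. By `unique` it is `w` almost everywhere. -/
theorem pCurvature_eq (hL : 0 < L) (h : HasSecondDeriv L c v w) (hc : ∀ s ∈ Icc 0 L, ‖c s‖ = 1)
    (hu : HasUnitSpeedOn c (Icc 0 L)) (hp : 1 < p) :
    pCurvature p L c = ∫⁻ s in Ioo 0 L, ‖w s + c s‖ₑ ^ p := by
  refine le_antisymm (h.pCurvature_le hL hc hu hp) (le_of_forall_gt_imp_ge_of_dense fun M hM ↦ ?_)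
  by_cases hM' : M = ⊤
  · rw [hM']; exact le_top
  rw [← ENNReal.ofReal_toReal hM'] at hM ⊢
  obtain ⟨v', w', h', hle⟩ := exists_hasSecondDeriv_of_pCurvature_lt hp hL hc hu hM
  refine le_of_eq_of_le (lintegral_congr_ae ?_) hle
  filter_upwards [h.unique hL h'] with t ht
  rw [ht]

end HasSecondDeriv

end SphericalCurve

/-! ### Conclusion for arbitrary weak derivatives -/

theorem mainTheorem1 (p L : ℝ) (hp : 1 < p) (hL : 0 < L) (c : ℝ → SphericalCurve.E3)
    (hc_sphere : ∀ s ∈ Set.Icc 0 L, ‖c s‖ = 1)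
    (hc_arclength : HasUnitSpeedOn c (Set.Icc 0 L)) :
    (SphericalCurve.pCurvature p L c < ⊤ ↔ SphericalCurve.MemW2 p L c) ∧
    (SphericalCurve.MemW2 p L c →
      ∀ c' c'' : ℝ → SphericalCurve.E3,
        SphericalCurve.IsWeakDeriv L c c' → SphericalCurve.IsWeakDeriv L c' c'' →
        SphericalCurve.pCurvature p L c =
            ∫⁻ s in Set.Icc 0 L, ‖SphericalCurve.geodCurvature (c s) (c' s) (c'' s)‖ₑ ^ p ∧
        SphericalCurve.pCurvature p L c =
            ∫⁻ s in Set.Icc 0 L, ‖SphericalCurve.tangentPart (c s) (c'' s)‖ₑ ^ p) := by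
  have hcont := SphericalCurve.continuousOn_of_unitSpeed hc_arclength
  have hp0 : 0 < p := by linarith
  refine ⟨⟨fun hF ↦ ?_, ?_⟩, fun _ c' c'' h1 h2 ↦ ?_⟩
  · have hlt : SphericalCurve.pCurvature p L c < ENNReal.ofReal ((SphericalCurve.pCurvature p L c).toReal + 1) := by
      rw [ENNReal.lt_ofReal_iff_toReal_lt hF.ne]
      linarith
    obtain ⟨v, w, h, hle⟩ :=
      SphericalCurve.exists_hasSecondDeriv_of_pCurvature_lt hp hL hc_sphere hc_arclength hlt
    exact h.memW2 hL hp hc_sphere (hle.trans_lt ENNReal.ofReal_lt_top)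
  · rintro ⟨-, c', c'', h1, h2, -, -, hw⟩
    obtain ⟨v, h, -⟩ := SphericalCurve.exists_hasSecondDeriv_of_isWeakDeriv hL hcont h1 h2
    rw [h.pCurvature_eq hL hc_sphere hc_arclength hp]
    have hg := (hw.add (SphericalCurve.HasSecondDeriv.memLp_of_continuousOn hcont (ENNReal.ofReal p))).2
    rw [eLpNorm_lt_top_iff_lintegral_rpow_enorm_lt_top (by simpa using hp0) ENNReal.ofReal_ne_top,
      ENNReal.toReal_ofReal hp0.le] at hg
    exact hg
  · obtain ⟨v, h, hv⟩ := SphericalCurve.exists_hasSecondDeriv_of_isWeakDeriv hL hcont h1 h2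
    -- The end points form a null set, and the given `c'` agrees with the continuous velocity `v`
    -- only almost everywhere, so the integrands are compared on the open interval.
    rw [h.pCurvature_eq hL hc_sphere hc_arclength hp, ← restrict_Ioo_eq_restrict_Icc]
    constructor
    · refine lintegral_congr_ae ?_
      filter_upwards [hv, ae_restrict_mem measurableSet_Ioo,
        ae_restrict_of_ae (h.ae_enorm_geodCurvature_eq hL hc_sphere hc_arclength)] with t ht htL hk
      rw [ht, hk htL]
    · refine lintegral_congr_ae ?_
      filter_upwards [ae_restrict_mem measurableSet_Ioo,
        ae_restrict_of_ae (h.ae_tangentPart_eq hL hc_sphere hc_arclength)] with t htL hk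
      rw [hk htL]
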